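/- Let $\mathcal E$ be a category with finite limits, with chosen binary products and a chosen terminal object, and let $V$ be an internal monoidal category in $\mathcal E$, with object of objects $V_0$ and object of morphisms $V_1$. *The indexed monoidal category $\mathrm{Ext}\,V$.* For $X\in\mathcal E$, the category $\mathrm{Ext}\,V[X]$ has as objects the arrows $x\colon X\to V_0$ and as morphisms $x_0\to x_1$ the arrows $X\to V_1$ with source $x_0$ and target $x_1$; composition and the monoidal structure are computed pointwise in $V$, and reindexing along $u\colon X'\to X$ is precomposition with $u$. *Small $W$-categories.* Let $W$ be an $\mathcal E$-indexed monoidal category (a pseudofunctor from $\mathcal E^{\mathrm{op}}$ to monoidal categories and strong monoidal functors). A small $W$-category $A$ consists of an object $A_0$ of $\mathcal E$, an object $\mathrm{Hom}_A$ of $W(A_0\times A_0)$, a morphism $\mathbb 1\to\Delta^*\mathrm{Hom}_A$ in $W(A_0)$ and a morphism $(\pi_2,\pi_3)^*\mathrm{Hom}_A\otimes(\pi_1,\pi_2)^*\mathrm{Hom}_A\to(\pi_1,\pi_3)^*\mathrm{Hom}_A$ in $W(A_0\times A_0\times A_0)$, satisfying the unit laws (over $A_0\times A_0$) and the associativity law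 (over $A_0^4$). A functor $F\colon A\to B$ is an arrow $F_0\colon A_0\to B_0$ with a morphism $\mathrm{Hom}_A\to(F_0\times F_0)^*\mathrm{Hom}_B$ in $W(A_0\times A_0)$ compatible with identities and composition; a natural transformation $F\to G$ is a morphism $\mathbb 1\to(F_0,G_0)^*\mathrm{Hom}_B$ in $W(A_0)$ satisfying the naturality condition over $A_0\times A_0$. These form a (strict) 2-category $\mathbf{SCat}_{\mathcal E}^{W}$. *Indexed $W$-categories.* An indexed $W$-category $\mathcal B$ consists of a $W(X)$-enriched category $\mathcal B^X$ for every $X$, a fully faithful $W(X)$-functor $f^*\colon (f^*)_\bullet\mathcal B^Y\to\mathcal B^X$ for every $f\colon X\to Y$, where $(f^*)_\bullet$ is change of base along the reindexing functor $W(Y)\to W(X)$, and coherent isomorphisms $(gf)^*\cong f^*\circ(f^*)_\bullet(g^*)$ and $(\mathrm{id}_X)^*\cong\mathrm{id}$. An indexed $W$-functor $\mathcal F\colon\mathcal B\to\mathcal B'$ consists of $W(X)$-functors $\mathcal F^X$ with coherent isomorphisms $\mathcal F^X\circ f^*\cong f^*\circ(f^*)_\bullet(\mathcal F^Y)$; an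 indexed natural transformation $\alpha\colon\mathcal F\to\mathcal G$ consists of $W(X)$-natural transformations $\alpha^X\colon\mathcal F^X\to\mathcal G^X$ compatible with these isomorphisms. These form a (strict) 2-category $\mathbf{ICat}_{\mathcal E}^{W}$. *The assignment.* For $W=\mathrm{Ext}\,V$, assign to a small $W$-category $A$ the indexed $W$-category whose fibre over $I$ has as objects the arrows $x\colon I\to A_0$, with hom-objects $(x_0,x_1)^*\mathrm{Hom}_A$ and with composition and identities those of $A$ reindexed along $(x_0,x_1,x_2)$ and $x$, and whose reindexing functors are precomposition on objects and the canonical isomorphisms on hom-objects. Assign to $F\colon A\to B$ the indexed functor $x\mapsto F_0x$, with action on hom-objects obtained by reindexing that of $F$, and to $\alpha\colon F\to G$ the indexed natural transformation with component $x^*\alpha$ at $x$. **Corollary.** $\mathbf{SCat}_{\mathcal E}^{\mathrm{Ext}\,V}$ is a full sub-2-category of $\mathbf{ICat}_{\mathcal E}^{\mathrm{Ext}\,V}$, with this assignment as inclusion. Precisely, the assignment is a strict 2-functor $\Phi\colon\mathbf{SCat}_{\mathcal E}^{\mathrm{Ext}\,V}\to\mathbf{ICat}_{\mathcal E}^{\mathrm{Ext}\,V}$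 such that, for all small $\mathrm{Ext}\,V$-categories $A$ and $B$: 1. the functor $\mathbf{SCat}_{\mathcal E}^{\mathrm{Ext}\,V}(A,B)\to\mathbf{ICat}_{\mathcal E}^{\mathrm{Ext}\,V}(\Phi A,\Phi B)$ induced by $\Phi$ is an equivalence of categories (in particular, $\Phi$ is bijective on natural transformations between any two functors $A\to B$); 2. $\Phi$ is injective on functors $A\to B$; 3. if $\Phi A=\Phi B$, then $A$ and $B$ are isomorphic in $\mathbf{SCat}_{\mathcal E}^{\mathrm{Ext}\,V}$. -/

import Mathlib

open CategoryTheory MonoidalCategory CartesianMonoidalCategory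

set_option linter.unusedVariables false
set_option linter.unusedSectionVars false
set_option linter.unusedSimpArgs false
set_option linter.checkUnivs false

universe t w w' v u

noncomputable section

namespace IndexedEnrichment


/-! ### Categories enriched in a monoidal category -/

/-- A category enriched in the (not necessarily symmetric) monoidal category `V`, with the
composition written in the order `hom y z ⊗ hom x y ⟶ hom x z`. -/
structure VCat (V : Type w) [Category.{w'} V] [MonoidalCategory V] where
  Ob : Type t
  hom : Ob → Ob → V
  id (x : Ob) : 𝟙_ V ⟶ hom x x
  comp (x y z : Ob) : hom y z ⊗ hom x y ⟶ hom x z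
  assoc (x₀ x₁ x₂ x₃ : Ob) :
    comp x₁ x₂ x₃ ▷ hom x₀ x₁ ≫ comp x₀ x₁ x₃ =
      (α_ (hom x₂ x₃) (hom x₁ x₂) (hom x₀ x₁)).hom ≫ hom x₂ x₃ ◁ comp x₀ x₁ x₂ ≫ comp x₀ x₂ x₃
  id_comp (x y : Ob) : id y ▷ hom x y ≫ comp x y y = (λ_ (hom x y)).hom
  comp_id (x y : Ob) : hom x y ◁ id x ≫ comp x x y = (ρ_ (hom x y)).hom

namespace VCat

variable {V : Type w} [Category.{w'} V] [MonoidalCategory V] (A : VCat.{t} V)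

/-- Composition of the morphisms `𝟙_ V ⟶ hom x y` of the underlying category. -/
def vcomp {x y z : A.Ob} (f : 𝟙_ V ⟶ A.hom x y) (g : 𝟙_ V ⟶ A.hom y z) : 𝟙_ V ⟶ A.hom x z :=
  (λ_ (𝟙_ V)).inv ≫ (g ⊗ₘ f) ≫ A.comp x y z

/-- The identity of the underlying category, transported along an equality of objects. -/
def ofEq {x y : A.Ob} (h : x = y) : 𝟙_ V ⟶ A.hom x y := h ▸ A.id x

/-- Composition with a morphism of the underlying category on the left. -/
def post (x : A.Ob) {y z : A.Ob} (g : 𝟙_ V ⟶ A.hom y z) : A.hom x y ⟶ A.hom x z :=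
  (λ_ (A.hom x y)).inv ≫ g ▷ A.hom x y ≫ A.comp x y z

/-- Composition with a morphism of the underlying category on the right. -/
def pre {x y : A.Ob} (f : 𝟙_ V ⟶ A.hom x y) (z : A.Ob) : A.hom y z ⟶ A.hom x z :=
  (ρ_ (A.hom y z)).inv ≫ A.hom y z ◁ f ≫ A.comp x y z

theorem vcomp_eq_post {x y z : A.Ob} (f : 𝟙_ V ⟶ A.hom x y) (g : 𝟙_ V ⟶ A.hom y z) :
    A.vcomp f g = f ≫ A.post x g := by
  simp [vcomp, post, MonoidalCategory.tensorHom_def']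

theorem vcomp_eq_pre {x y z : A.Ob} (f : 𝟙_ V ⟶ A.hom x y) (g : 𝟙_ V ⟶ A.hom y z) :
    A.vcomp f g = g ≫ A.pre f z := by
  simp [vcomp, pre, MonoidalCategory.tensorHom_def, unitors_inv_equal]

theorem post_id (x y : A.Ob) : A.post x (A.id y) = 𝟙 _ := by
  simp [post, A.id_comp]

theorem pre_id (x y : A.Ob) : A.pre (A.id x) y = 𝟙 _ := by
  simp [pre, A.comp_id]

theorem comp_post (x y : A.Ob) {z z' : A.Ob} (g : 𝟙_ V ⟶ A.hom z z') :
    A.comp x y z ≫ A.post x g = A.post y g ▷ A.hom x y ≫ A.comp x y z' := by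
  simp only [post, comp_whiskerRight, Category.assoc, A.assoc x y z z',
    leftUnitor_inv_naturality_assoc, whisker_exchange_assoc]
  simp

theorem comp_pre {x' x : A.Ob} (y z : A.Ob) (f : 𝟙_ V ⟶ A.hom x' x) :
    A.comp x y z ≫ A.pre f z = A.hom y z ◁ A.pre f y ≫ A.comp x' y z := by
  have := A.assoc x' x y z
  rw [← Iso.inv_comp_eq] at this
  simp only [pre, MonoidalCategory.whiskerLeft_comp, Category.assoc, ← this,
    rightUnitor_inv_naturality_assoc, ← whisker_exchange_assoc]
  simp

theorem pre_post (x : A.Ob) {y z : A.Ob} (w : A.Ob) (g : 𝟙_ V ⟶ A.hom y z) :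
    A.pre g w ▷ A.hom x y ≫ A.comp x y w = A.hom z w ◁ A.post x g ≫ A.comp x z w := by
  simp only [pre, post, comp_whiskerRight, MonoidalCategory.whiskerLeft_comp, Category.assoc,
    A.assoc]
  simp

theorem post_vcomp (w : A.Ob) {x y z : A.Ob} (f : 𝟙_ V ⟶ A.hom x y) (g : 𝟙_ V ⟶ A.hom y z) :
    A.post w (A.vcomp f g) = A.post w f ≫ A.post w g := by
  rw [vcomp_eq_post]
  conv_lhs => rw [post, comp_whiskerRight, Category.assoc, ← comp_post]
  simp [post]

theorem pre_vcomp {x y z : A.Ob} (w : A.Ob) (f : 𝟙_ V ⟶ A.hom x y) (g : 𝟙_ V ⟶ A.hom y z) :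
    A.pre (A.vcomp f g) w = A.pre g w ≫ A.pre f w := by
  rw [vcomp_eq_pre, pre, MonoidalCategory.whiskerLeft_comp, Category.assoc, ← comp_pre]
  simp [pre]

theorem post_pre {x' x y y' : A.Ob} (f : 𝟙_ V ⟶ A.hom x' x) (g : 𝟙_ V ⟶ A.hom y y') :
    A.post x g ≫ A.pre f y' = A.pre f y ≫ A.post x' g := by
  conv_lhs => rw [post]
  conv_rhs => rw [post]
  simp only [Category.assoc]
  rw [comp_pre, ← whisker_exchange_assoc, leftUnitor_inv_naturality_assoc]

theorem vcomp_assoc {x y z w : A.Ob} (f : 𝟙_ V ⟶ A.hom x y) (g : 𝟙_ V ⟶ A.hom y z)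
    (h : 𝟙_ V ⟶ A.hom z w) : A.vcomp (A.vcomp f g) h = A.vcomp f (A.vcomp g h) := by
  simp only [vcomp_eq_post, ← post_vcomp, Category.assoc]

theorem id_vcomp {x y : A.Ob} (f : 𝟙_ V ⟶ A.hom x y) : A.vcomp (A.id x) f = f := by
  rw [vcomp_eq_pre, pre_id, Category.comp_id]

theorem vcomp_id {x y : A.Ob} (f : 𝟙_ V ⟶ A.hom x y) : A.vcomp f (A.id y) = f := by
  rw [vcomp_eq_post, post_id, Category.comp_id]

theorem ofEq_rfl (x : A.Ob) (h : x = x) : A.ofEq h = A.id x := rfl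

theorem ofEq_vcomp_ofEq {x y z : A.Ob} (h : x = y) (h' : y = z) :
    A.vcomp (A.ofEq h) (A.ofEq h') = A.ofEq (h.trans h') := by
  subst h h'; exact A.id_vcomp _

theorem ofEq_conj {x y : A.Ob} (h : x = x) (h' : y = y) (f : 𝟙_ V ⟶ A.hom x y) :
    A.vcomp (A.ofEq h) (A.vcomp f (A.ofEq h')) = f := by
  rw [ofEq_rfl, ofEq_rfl, id_vcomp, vcomp_id]

theorem post_ofEq (w : A.Ob) {x y : A.Ob} (h : x = y) :
    A.post w (A.ofEq h) = eqToHom (by rw [h]) := by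
  subst h; exact A.post_id _ _

theorem pre_ofEq {x y : A.Ob} (h : x = y) (w : A.Ob) :
    A.pre (A.ofEq h) w = eqToHom (by rw [h]) := by
  subst h; exact A.pre_id _ _

end VCat

/-- A `V`-enriched functor. -/
structure VFunctor {V : Type w} [Category.{w'} V] [MonoidalCategory V] (A B : VCat.{t} V) where
  obj : A.Ob → B.Ob
  map (x y : A.Ob) : A.hom x y ⟶ B.hom (obj x) (obj y)
  map_comp (x y z : A.Ob) :
    A.comp x y z ≫ map x z = (map y z ⊗ₘ map x y) ≫ B.comp (obj x) (obj y) (obj z)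
  map_id (x : A.Ob) : A.id x ≫ map x x = B.id (obj x)

namespace VFunctor

variable {V : Type w} [Category.{w'} V] [MonoidalCategory V] {A B C D : VCat.{t} V}

/-- The identity `V`-functor. -/
abbrev id (A : VCat.{t} V) : VFunctor A A where
  obj x := x
  map x y := 𝟙 _
  map_comp x y z := by simp
  map_id x := by simp

/-- Composition of `V`-functors, in diagrammatic order. -/
abbrev comp (F : VFunctor A B) (G : VFunctor B C) : VFunctor A C where
  obj x := G.obj (F.obj x)
  map x y := F.map x y ≫ G.map (F.obj x) (F.obj y)
  map_comp x y z := by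
    rw [← Category.assoc, F.map_comp, Category.assoc, G.map_comp, ← tensorHom_comp_tensorHom,
      Category.assoc]
  map_id x := by rw [← Category.assoc, F.map_id, G.map_id]

theorem ext' {F G : VFunctor A B} (h : ∀ x, F.obj x = G.obj x)
    (h' : ∀ x y, F.map x y ≫ eqToHom (by rw [h, h]) = G.map x y) : F = G := by
  obtain ⟨fo, fm, _, _⟩ := F
  obtain ⟨go, gm, _, _⟩ := G
  obtain rfl : fo = go := funext h
  obtain rfl : fm = gm := by funext x y; simpa using h' x y
  rfl

theorem map_post (F : VFunctor A B) (x : A.Ob) {y z : A.Ob} (g : 𝟙_ V ⟶ A.hom y z) :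
    A.post x g ≫ F.map x z = F.map x y ≫ B.post (F.obj x) (g ≫ F.map y z) := by
  simp only [VCat.post, Category.assoc, F.map_comp, MonoidalCategory.tensorHom_def,
    comp_whiskerRight, leftUnitor_inv_naturality_assoc, whisker_exchange_assoc]

theorem map_pre (F : VFunctor A B) {x y : A.Ob} (z : A.Ob) (f : 𝟙_ V ⟶ A.hom x y) :
    A.pre f z ≫ F.map x z = F.map y z ≫ B.pre (f ≫ F.map x y) (F.obj z) := by
  simp only [VCat.pre, Category.assoc, F.map_comp, MonoidalCategory.tensorHom_def',
    MonoidalCategory.whiskerLeft_comp, rightUnitor_inv_naturality_assoc, ← whisker_exchange_assoc]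

theorem map_vcomp (F : VFunctor A B) {x y z : A.Ob} (f : 𝟙_ V ⟶ A.hom x y)
    (g : 𝟙_ V ⟶ A.hom y z) :
    A.vcomp f g ≫ F.map x z = B.vcomp (f ≫ F.map x y) (g ≫ F.map y z) := by
  simp only [VCat.vcomp_eq_post, Category.assoc, map_post]

theorem ofEq_map (F : VFunctor A B) {x y : A.Ob} (h : x = y) :
    A.ofEq h ≫ F.map x y = B.ofEq (congrArg F.obj h) := by
  subst h; exact F.map_id x

end VFunctor

/-- A `V`-enriched natural transformation: the naturality square is a square of morphisms out of
the hom-object `A.hom x y`. -/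
@[ext]
structure VNat {V : Type w} [Category.{w'} V] [MonoidalCategory V] {A B : VCat.{t} V}
    (F G : VFunctor A B) where
  app (x : A.Ob) : 𝟙_ V ⟶ B.hom (F.obj x) (G.obj x)
  naturality (x y : A.Ob) :
    (λ_ (A.hom x y)).inv ≫ (app y ⊗ₘ F.map x y) ≫ B.comp (F.obj x) (F.obj y) (G.obj y) =
      (ρ_ (A.hom x y)).inv ≫ (G.map x y ⊗ₘ app x) ≫ B.comp (F.obj x) (G.obj x) (G.obj y)

namespace VNat

variable {V : Type w} [Category.{w'} V] [MonoidalCategory V] {A B C D : VCat.{t} V}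

theorem naturality_iff {F G : VFunctor A B} (app : ∀ x, 𝟙_ V ⟶ B.hom (F.obj x) (G.obj x))
    (x y : A.Ob) :
    (λ_ (A.hom x y)).inv ≫ (app y ⊗ₘ F.map x y) ≫ B.comp (F.obj x) (F.obj y) (G.obj y) =
      (ρ_ (A.hom x y)).inv ≫ (G.map x y ⊗ₘ app x) ≫ B.comp (F.obj x) (G.obj x) (G.obj y) ↔
    F.map x y ≫ B.post (F.obj x) (app y) = G.map x y ≫ B.pre (app x) (G.obj y) := by
  simp only [VCat.post, VCat.pre, leftUnitor_inv_naturality_assoc,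
    rightUnitor_inv_naturality_assoc]
  rw [MonoidalCategory.tensorHom_def', MonoidalCategory.tensorHom_def, Category.assoc,
    Category.assoc]

theorem nat {F G : VFunctor A B} (α : VNat F G) (x y : A.Ob) :
    F.map x y ≫ B.post (F.obj x) (α.app y) = G.map x y ≫ B.pre (α.app x) (G.obj y) :=
  (naturality_iff α.app x y).1 (α.naturality x y)

/-- A naturality square in the underlying category. -/
theorem nat_pt {F G : VFunctor A B} (α : VNat F G) {x y : A.Ob} (f : 𝟙_ V ⟶ A.hom x y) :
    B.vcomp (f ≫ F.map x y) (α.app y) = B.vcomp (α.app x) (f ≫ G.map x y) := by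
  rw [VCat.vcomp_eq_post, VCat.vcomp_eq_pre, Category.assoc, Category.assoc, α.nat]

/-- The identity transformation. -/
def id (F : VFunctor A B) : VNat F F where
  app x := B.id (F.obj x)
  naturality x y := by
    rw [naturality_iff (fun x => B.id (F.obj x))]; simp [VCat.post_id, VCat.pre_id]

/-- Vertical composition. -/
def vcomp {F G H : VFunctor A B} (α : VNat F G) (β : VNat G H) : VNat F H where
  app x := B.vcomp (α.app x) (β.app x)
  naturality x y := by
    rw [naturality_iff (fun x => B.vcomp (α.app x) (β.app x)), VCat.post_vcomp, VCat.pre_vcomp,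
      ← Category.assoc, α.nat, Category.assoc, ← VCat.post_pre, ← Category.assoc, β.nat,
      Category.assoc]

/-- `V`-functors and `V`-natural transformations form a category. -/
instance : Category (VFunctor A B) where
  Hom F G := VNat F G
  id F := VNat.id F
  comp α β := VNat.vcomp α β
  id_comp _ := VNat.ext (funext fun _ => VCat.id_vcomp _ _)
  comp_id _ := VNat.ext (funext fun _ => VCat.vcomp_id _ _)
  assoc _ _ _ := VNat.ext (funext fun _ => VCat.vcomp_assoc _ _ _ _)

theorem comp_app {F G H : VFunctor A B} (α : F ⟶ G) (β : G ⟶ H) (x : A.Ob) :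
    (α ≫ β).app x = B.vcomp (α.app x) (β.app x) := rfl

theorem id_app (F : VFunctor A B) (x : A.Ob) : VNat.app (𝟙 F) x = B.id (F.obj x) := rfl

theorem hom_ext {F G : VFunctor A B} {α β : F ⟶ G} (h : ∀ x, α.app x = β.app x) : α = β :=
  VNat.ext (funext h)

theorem eqToHom_app {F G : VFunctor A B} (h : F = G) (x : A.Ob) :
    VNat.app (eqToHom h) x = B.ofEq (by rw [h]) := by
  subst h; rfl

/-- Whiskering with a functor on the source side. -/
def whiskerLeft (L : VFunctor A B) {F G : VFunctor B C} (α : VNat F G) :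
    VNat (L.comp F) (L.comp G) where
  app x := α.app (L.obj x)
  naturality x y := by
    rw [naturality_iff (F := L.comp F) (G := L.comp G) (fun x => α.app (L.obj x))]
    simp only [VFunctor.comp, Category.assoc, α.nat]

/-- Whiskering with a functor on the target side. -/
def whiskerRight {F G : VFunctor A B} (α : VNat F G) (R : VFunctor B C) :
    VNat (F.comp R) (G.comp R) where
  app x := α.app x ≫ R.map (F.obj x) (G.obj x)
  naturality x y := by
    rw [naturality_iff (F := F.comp R) (G := G.comp R)
      (fun x => α.app x ≫ R.map (F.obj x) (G.obj x))]
    simp only [VFunctor.comp, Category.assoc, ← VFunctor.map_post, ← VFunctor.map_pre]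
    rw [← Category.assoc, α.nat, Category.assoc]

theorem iso_hom_inv {F G : VFunctor A B} (α : F ≅ G) (x : A.Ob) :
    B.vcomp (α.hom.app x) (α.inv.app x) = B.id _ :=
  congrArg (fun β : F ⟶ F => β.app x) α.hom_inv_id

theorem iso_inv_hom {F G : VFunctor A B} (α : F ≅ G) (x : A.Ob) :
    B.vcomp (α.inv.app x) (α.hom.app x) = B.id _ :=
  congrArg (fun β : G ⟶ G => β.app x) α.inv_hom_id

end VNat

/-- A `V`-natural isomorphism from its components. -/
def VFunctor.isoMk {V : Type w} [Category.{w'} V] [MonoidalCategory V] {A B : VCat.{t} V}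
    {F G : VFunctor A B} (α : VNat F G)
    (inv : ∀ x, 𝟙_ V ⟶ B.hom (G.obj x) (F.obj x))
    (h : ∀ x, B.vcomp (α.app x) (inv x) = B.id _) (h' : ∀ x, B.vcomp (inv x) (α.app x) = B.id _) :
    F ≅ G where
  hom := α
  inv :=
    { app := inv
      naturality := fun x y => by
        rw [VNat.naturality_iff]
        have key := α.nat x y
        have e₁ : B.pre (α.app x) (G.obj y) ≫ B.pre (inv x) (G.obj y) = 𝟙 _ := by
          rw [← VCat.pre_vcomp, h', VCat.pre_id]
        have e₂ : B.post (F.obj x) (α.app y) ≫ B.post (F.obj x) (inv y) = 𝟙 _ := by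
          rw [← VCat.post_vcomp, h, VCat.post_id]
        calc G.map x y ≫ B.post (G.obj x) (inv y)
            = G.map x y ≫ (B.pre (α.app x) (G.obj y) ≫ B.pre (inv x) (G.obj y)) ≫
                B.post (G.obj x) (inv y) := by rw [e₁, Category.id_comp]
          _ = F.map x y ≫ (B.post (F.obj x) (α.app y) ≫ B.post (F.obj x) (inv y)) ≫
                B.pre (inv x) (F.obj y) := by
              rw [Category.assoc, ← Category.assoc, ← key]
              simp only [Category.assoc, VCat.post_pre]
          _ = _ := by rw [e₂, Category.id_comp] }
  hom_inv_id := VNat.hom_ext h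
  inv_hom_id := VNat.hom_ext h'

/-! ### Change of base along a lax monoidal functor -/

section BaseChange

variable {V : Type w} [Category.{w'} V] [MonoidalCategory V]
variable {V' : Type w} [Category.{w'} V'] [MonoidalCategory V']
variable (T : V ⥤ V') [T.LaxMonoidal]

open Functor.LaxMonoidal

/-- The `V'`-category obtained by applying the lax monoidal functor `T` to the hom-objects. -/
abbrev VCat.bc (A : VCat.{t} V) : VCat.{t} V' where
  Ob := A.Ob
  hom x y := T.obj (A.hom x y)
  id x := ε T ≫ T.map (A.id x)
  comp x y z := μ T _ _ ≫ T.map (A.comp x y z)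
  assoc x₀ x₁ x₂ x₃ := by
    simp only [comp_whiskerRight, Category.assoc, μ_natural_left_assoc, ← T.map_comp, A.assoc,
      MonoidalCategory.whiskerLeft_comp, μ_natural_right_assoc]
    simp only [T.map_comp, associativity_assoc]
  id_comp x y := by
    simp only [comp_whiskerRight, Category.assoc, μ_natural_left_assoc, ← T.map_comp, A.id_comp,
      left_unitality]
  comp_id x y := by
    simp only [MonoidalCategory.whiskerLeft_comp, Category.assoc, μ_natural_right_assoc,
      ← T.map_comp, A.comp_id, right_unitality]

/-- The functor induced by a `V`-functor on the change of base. -/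
abbrev VFunctor.bc {A B : VCat.{t} V} (F : VFunctor A B) : VFunctor (A.bc T) (B.bc T) where
  obj := F.obj
  map x y := T.map (F.map x y)
  map_comp x y z := by
    simp only [VCat.bc, Category.assoc, ← T.map_comp, F.map_comp, μ_natural_assoc]
  map_id x := by
    simp only [VCat.bc, Category.assoc, ← T.map_comp, F.map_id]

/-- The action of the change of base on morphisms of the underlying category. -/
def VCat.bcPt (A : VCat.{t} V) {x y : A.Ob} (f : 𝟙_ V ⟶ A.hom x y) :
    𝟙_ V' ⟶ (A.bc T).hom x y :=
  ε T ≫ T.map f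

theorem VCat.bc_post (A : VCat.{t} V) (x : A.Ob) {y z : A.Ob} (g : 𝟙_ V ⟶ A.hom y z) :
    (A.bc T).post x (A.bcPt T g) = T.map (A.post x g) := by
  simp [VCat.post, VCat.bcPt, VCat.bc, left_unitality_inv_assoc]

theorem VCat.bc_pre (A : VCat.{t} V) {x y : A.Ob} (z : A.Ob) (f : 𝟙_ V ⟶ A.hom x y) :
    (A.bc T).pre (A.bcPt T f) z = T.map (A.pre f z) := by
  simp [VCat.pre, VCat.bcPt, VCat.bc, right_unitality_inv_assoc]

theorem VCat.bcPt_vcomp (A : VCat.{t} V) {x y z : A.Ob} (f : 𝟙_ V ⟶ A.hom x y)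
    (g : 𝟙_ V ⟶ A.hom y z) :
    A.bcPt T (A.vcomp f g) = (A.bc T).vcomp (A.bcPt T f) (A.bcPt T g) := by
  rw [VCat.vcomp_eq_post, VCat.vcomp_eq_post, VCat.bc_post]
  simp [VCat.bcPt]

theorem VCat.bcPt_id (A : VCat.{t} V) (x : A.Ob) : A.bcPt T (A.id x) = (A.bc T).id x := rfl

/-- The transformation induced by a `V`-natural transformation on the change of base. -/
def VNat.bc {A B : VCat.{t} V} {F G : VFunctor A B} (α : VNat F G) :
    VNat (F.bc T) (G.bc T) where
  app x := B.bcPt T (α.app x)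
  naturality x y := by
    rw [VNat.naturality_iff (F := F.bc T) (G := G.bc T) (fun x => B.bcPt T (α.app x))]
    simp only [VFunctor.bc]
    rw [VCat.bc_post, VCat.bc_pre]
    rw [← T.map_comp, ← T.map_comp, α.nat]

end BaseChange

end IndexedEnrichment

namespace IndexedEnrichment


/-- An `E`-indexed monoidal category: a pseudofunctor from `Eᵒᵖ` to the 2-category of monoidal
categories, strong monoidal functors and monoidal transformations.  The compositor is given for
every factorisation `f ≫ g = k`, so that the coherence conditions involve no transport along the
associativity of composition in `E`. -/
structure IndexedMonoidalCategory (E : Type u) [Category.{v} E] where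
  fib : E → Type w
  cat (X : E) : Category.{w'} (fib X)
  mon (X : E) : MonoidalCategory (fib X)
  re {X Y : E} (f : X ⟶ Y) : fib Y ⥤ fib X
  reMonoidal {X Y : E} (f : X ⟶ Y) : (re f).Monoidal
  reId (X : E) : re (𝟙 X) ≅ 𝟭 (fib X)
  reComp {X Y Z : E} (f : X ⟶ Y) (g : Y ⟶ Z) (k : X ⟶ Z) (e : f ≫ g = k) : re k ≅ re g ⋙ re f
  reId_monoidal (X : E) : NatTrans.IsMonoidal (reId X).hom
  reComp_monoidal {X Y Z : E} (f : X ⟶ Y) (g : Y ⟶ Z) (k : X ⟶ Z) (e : f ≫ g = k) :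
    NatTrans.IsMonoidal (reComp f g k e).hom
  reComp_assoc {X Y Z T : E} (f : X ⟶ Y) (g : Y ⟶ Z) (h : Z ⟶ T) (fg : X ⟶ Z) (gh : Y ⟶ T)
    (k : X ⟶ T) (e₁ : f ≫ g = fg) (e₂ : g ≫ h = gh) (e₃ : f ≫ gh = k) (e₄ : fg ≫ h = k)
    (A : fib T) :
    (reComp f gh k e₃).hom.app A ≫ (re f).map ((reComp g h gh e₂).hom.app A) =
      (reComp fg h k e₄).hom.app A ≫ (reComp f g fg e₁).hom.app ((re h).obj A)
  reComp_id_left {X Y : E} (f : X ⟶ Y) (A : fib Y) :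
    (reComp (𝟙 X) f f (Category.id_comp f)).hom.app A ≫ (reId X).hom.app ((re f).obj A) = 𝟙 _
  reComp_id_right {X Y : E} (f : X ⟶ Y) (A : fib Y) :
    (reComp f (𝟙 Y) f (Category.comp_id f)).hom.app A ≫ (re f).map ((reId Y).hom.app A) = 𝟙 _

attribute [instance] IndexedMonoidalCategory.cat IndexedMonoidalCategory.mon
  IndexedMonoidalCategory.reMonoidal IndexedMonoidalCategory.reId_monoidal
  IndexedMonoidalCategory.reComp_monoidal

variable {E : Type u} [Category.{v} E]

open Functor.LaxMonoidal

section Comparison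

variable {V : Type w} [Category.{w'} V] [MonoidalCategory V]
variable {V' : Type w} [Category.{w'} V'] [MonoidalCategory V']
variable {V'' : Type w} [Category.{w'} V''] [MonoidalCategory V'']

/-- The identification of the two changes of base `K_• A` and `S_• T_• A` along a monoidal
transformation `K ⟶ T ⋙ S`: it is the identity on objects. -/
abbrev VCat.bcComp {T : V ⥤ V'} {S : V' ⥤ V''} {K : V ⥤ V''} [T.LaxMonoidal] [S.LaxMonoidal]
    [K.LaxMonoidal] (κ : K ⟶ T ⋙ S) [NatTrans.IsMonoidal κ] (A : VCat.{t} V) :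
    VFunctor (A.bc K) ((A.bc T).bc S) where
  obj x := x
  map x y := κ.app (A.hom x y)
  map_comp x y z := by
    have := NatTrans.IsMonoidal.tensor (τ := κ) (A.hom y z) (A.hom x y)
    simp only [Functor.LaxMonoidal.comp_μ] at this
    simp only [Category.assoc, κ.naturality, Functor.comp_map, Functor.map_comp]
    rw [← Category.assoc, this]
    simp only [Category.assoc]
  map_id x := by
    have := NatTrans.IsMonoidal.unit (τ := κ)
    simp only [Functor.LaxMonoidal.comp_ε] at this
    simp only [Category.assoc, κ.naturality, Functor.comp_map, Functor.map_comp]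
    rw [← Category.assoc, this]
    simp only [Category.assoc]

/-- The identification of the change of base `K_• A` with `A` along a monoidal transformation
from `K` to the identity functor: it is the identity on objects. -/
abbrev VCat.bcId {K : V ⥤ V} [K.LaxMonoidal] (κ : K ⟶ 𝟭 V) [NatTrans.IsMonoidal κ]
    (A : VCat.{t} V) : VFunctor (A.bc K) A where
  obj x := x
  map x y := κ.app (A.hom x y)
  map_comp x y z := by
    have := NatTrans.IsMonoidal.tensor (τ := κ) (A.hom y z) (A.hom x y)
    simp only [Functor.LaxMonoidal.id_μ, Category.comp_id] at this
    simp only [Category.assoc, κ.naturality, Functor.id_map]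
    rw [← Category.assoc, this]
  map_id x := by
    have := NatTrans.IsMonoidal.unit (τ := κ)
    simp only [Functor.LaxMonoidal.id_ε] at this
    simp only [Category.assoc, κ.naturality, Functor.id_map]
    rw [← Category.assoc, this, Category.id_comp]

end Comparison

/-! ### Indexed enriched categories -/

/-- An indexed `W`-category: enriched categories over the fibres of `W`, with fully faithful
reindexing functors `re f` out of the change of base of `fib Y` along `W.re f`, and with coherent
comparison isomorphisms.  As for `W`, the comparison for composites is given for every
factorisation `f ≫ g = k`. -/
structure IndexedCat (W : IndexedMonoidalCategory.{w, w'} E) where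
  fib (X : E) : VCat.{t} (W.fib X)
  re {X Y : E} (f : X ⟶ Y) : VFunctor ((fib Y).bc (W.re f)) (fib X)
  re_ff {X Y : E} (f : X ⟶ Y) (x y : (fib Y).Ob) : IsIso ((re f).map x y)
  reComp {X Y Z : E} (f : X ⟶ Y) (g : Y ⟶ Z) (k : X ⟶ Z) (e : f ≫ g = k) :
    re k ≅ ((fib Z).bcComp (W.reComp f g k e).hom).comp (((re g).bc (W.re f)).comp (re f))
  reId (X : E) : re (𝟙 X) ≅ (fib X).bcId (W.reId X).hom
  reComp_assoc {X Y Z T : E} (f : X ⟶ Y) (g : Y ⟶ Z) (h : Z ⟶ T) (fg : X ⟶ Z) (gh : Y ⟶ T)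
    (k : X ⟶ T) (e₁ : f ≫ g = fg) (e₂ : g ≫ h = gh) (e₃ : f ≫ gh = k) (e₄ : fg ≫ h = k)
    (x : (fib T).Ob) :
    (fib X).vcomp ((reComp f gh k e₃).hom.app x)
        ((fib Y).bcPt (W.re f) ((reComp g h gh e₂).hom.app x) ≫ (re f).map _ _) =
      (fib X).vcomp ((reComp fg h k e₄).hom.app x) ((reComp f g fg e₁).hom.app ((re h).obj x))
  reComp_id_left {X Y : E} (f : X ⟶ Y) (x : (fib Y).Ob) :
    (fib X).vcomp ((reComp (𝟙 X) f f (Category.id_comp f)).hom.app x)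
      ((reId X).hom.app ((re f).obj x)) = (fib X).id ((re f).obj x)
  reComp_id_right {X Y : E} (f : X ⟶ Y) (x : (fib Y).Ob) :
    (fib X).vcomp ((reComp f (𝟙 Y) f (Category.comp_id f)).hom.app x)
      ((fib Y).bcPt (W.re f) ((reId Y).hom.app x) ≫ (re f).map _ _) = (fib X).id ((re f).obj x)

variable {W : IndexedMonoidalCategory.{w, w'} E}

namespace IndexedCat

/-- The action of reindexing on morphisms of the underlying categories. -/
def rePt (B : IndexedCat.{t} W) {X Y : E} (f : X ⟶ Y) {x y : (B.fib Y).Ob}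
    (a : 𝟙_ (W.fib Y) ⟶ (B.fib Y).hom x y) :
    𝟙_ (W.fib X) ⟶ (B.fib X).hom ((B.re f).obj x) ((B.re f).obj y) :=
  (B.fib Y).bcPt (W.re f) a ≫ (B.re f).map x y

theorem rePt_vcomp (B : IndexedCat.{t} W) {X Y : E} (f : X ⟶ Y) {x y z : (B.fib Y).Ob}
    (a : 𝟙_ (W.fib Y) ⟶ (B.fib Y).hom x y) (b : 𝟙_ (W.fib Y) ⟶ (B.fib Y).hom y z) :
    B.rePt f ((B.fib Y).vcomp a b) = (B.fib X).vcomp (B.rePt f a) (B.rePt f b) := by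
  simp only [rePt, VCat.bcPt_vcomp, VFunctor.map_vcomp]

theorem rePt_id (B : IndexedCat.{t} W) {X Y : E} (f : X ⟶ Y) (x : (B.fib Y).Ob) :
    B.rePt f ((B.fib Y).id x) = (B.fib X).id ((B.re f).obj x) := by
  rw [rePt, VCat.bcPt_id, VFunctor.map_id]

theorem rePt_ofEq (B : IndexedCat.{t} W) {X Y : E} (f : X ⟶ Y) {x y : (B.fib Y).Ob} (h : x = y) :
    B.rePt f ((B.fib Y).ofEq h) = (B.fib X).ofEq (congrArg (B.re f).obj h) := by
  subst h; exact B.rePt_id f x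

end IndexedCat

/-- A functor of indexed `W`-categories: enriched functors between the fibres, commuting with
reindexing up to coherent isomorphisms. -/
structure IndexedFunctor (B C : IndexedCat.{t} W) where
  fn (X : E) : VFunctor (B.fib X) (C.fib X)
  reIso {X Y : E} (f : X ⟶ Y) :
    (B.re f).comp (fn X) ≅ ((fn Y).bc (W.re f)).comp (C.re f)
  reIso_comp {X Y Z : E} (f : X ⟶ Y) (g : Y ⟶ Z) (k : X ⟶ Z) (e : f ≫ g = k) (z : (B.fib Z).Ob) :
    (C.fib X).vcomp ((reIso k).hom.app z) ((C.reComp f g k e).hom.app ((fn Z).obj z)) =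
      (C.fib X).vcomp ((B.reComp f g k e).hom.app z ≫ (fn X).map _ _)
        ((C.fib X).vcomp ((reIso f).hom.app ((B.re g).obj z)) (C.rePt f ((reIso g).hom.app z)))
  reIso_id (X : E) (x : (B.fib X).Ob) :
    (C.fib X).vcomp ((reIso (𝟙 X)).hom.app x) ((C.reId X).hom.app ((fn X).obj x)) =
      (B.reId X).hom.app x ≫ (fn X).map _ _

/-- A natural transformation of functors of indexed `W`-categories. -/
@[ext]
structure IndexedNat {B C : IndexedCat.{t} W} (F G : IndexedFunctor B C) where
  app (X : E) : VNat (F.fn X) (G.fn X)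
  naturality {X Y : E} (f : X ⟶ Y) (y : (B.fib Y).Ob) :
    (C.fib X).vcomp ((F.reIso f).hom.app y) (C.rePt f ((app Y).app y)) =
      (C.fib X).vcomp ((app X).app ((B.re f).obj y)) ((G.reIso f).hom.app y)

namespace IndexedNat

variable {B C D : IndexedCat.{t} W}

theorem ext' {F G : IndexedFunctor B C} {α β : IndexedNat F G}
    (h : ∀ X x, (α.app X).app x = (β.app X).app x) : α = β :=
  IndexedNat.ext (funext fun X => VNat.ext (funext fun x => h X x))

/-- The identity transformation. -/
abbrev id (F : IndexedFunctor B C) : IndexedNat F F where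
  app X := VNat.id (F.fn X)
  naturality f y := by
    simp only [VNat.id, C.rePt_id]
    rw [VCat.id_vcomp]
    exact VCat.vcomp_id _ _

/-- Vertical composition. -/
abbrev vcomp {F G H : IndexedFunctor B C} (α : IndexedNat F G) (β : IndexedNat G H) :
    IndexedNat F H where
  app X := VNat.vcomp (α.app X) (β.app X)
  naturality f y := by
    simp only [VNat.vcomp, C.rePt_vcomp]
    rw [← VCat.vcomp_assoc, α.naturality, VCat.vcomp_assoc, β.naturality, VCat.vcomp_assoc]

instance : Category (IndexedFunctor B C) where
  Hom F G := IndexedNat F G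
  id F := IndexedNat.id F
  comp α β := IndexedNat.vcomp α β
  id_comp _ := IndexedNat.ext' fun _ _ => VCat.id_vcomp _ _
  comp_id _ := IndexedNat.ext' fun _ _ => VCat.vcomp_id _ _
  assoc _ _ _ := IndexedNat.ext' fun _ _ => VCat.vcomp_assoc _ _ _ _

theorem comp_app_app {F G H : IndexedFunctor B C} (α : F ⟶ G) (β : G ⟶ H) (X : E)
    (x : (B.fib X).Ob) :
    (IndexedNat.app (α ≫ β) X).app x = (C.fib X).vcomp ((α.app X).app x) ((β.app X).app x) := rfl

theorem id_app_app (F : IndexedFunctor B C) (X : E) (x : (B.fib X).Ob) :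
    (IndexedNat.app (𝟙 F) X).app x = (C.fib X).id ((F.fn X).obj x) := rfl

theorem eqToHom_app_app {F G : IndexedFunctor B C} (h : F = G) (X : E) (x : (B.fib X).Ob) :
    (IndexedNat.app (eqToHom h) X).app x = (C.fib X).ofEq (by rw [h]) := by
  subst h; rfl

end IndexedNat

namespace IndexedFunctor

variable {B C D K : IndexedCat.{t} W}

/-- The naturality of the comparison of a functor, on morphisms of underlying categories. -/
theorem reIso_pt (F : IndexedFunctor B C) {X Y : E} (f : X ⟶ Y) {x y : (B.fib Y).Ob}
    (a : 𝟙_ (W.fib Y) ⟶ (B.fib Y).hom x y) :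
    (C.fib X).vcomp (B.rePt f a ≫ (F.fn X).map _ _) ((F.reIso f).hom.app y) =
      (C.fib X).vcomp ((F.reIso f).hom.app x) (C.rePt f (a ≫ (F.fn Y).map _ _)) := by
  have := (F.reIso f).hom.nat_pt ((B.fib Y).bcPt (W.re f) a)
  simpa only [IndexedCat.rePt, VCat.bcPt, Category.assoc, Functor.map_comp] using this

/-- The identity functor. -/
abbrev id (B : IndexedCat.{t} W) : IndexedFunctor B B where
  fn X := VFunctor.id (B.fib X)
  reIso f := VFunctor.isoMk
    { app := fun x => (B.fib _).id ((B.re f).obj x)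
      naturality := fun x y => by
        rw [VNat.naturality_iff (F := (B.re f).comp (VFunctor.id _))
          (G := ((VFunctor.id _).bc (W.re f)).comp (B.re f))
          (fun x => (B.fib _).id ((B.re f).obj x)) x y]
        simp only [VCat.post_id, VCat.pre_id, Category.comp_id]
        erw [CategoryTheory.Functor.map_id, Category.id_comp] }
    (fun x => (B.fib _).id ((B.re f).obj x)) (fun _ => VCat.id_vcomp _ _)
    (fun _ => VCat.id_vcomp _ _)
  reIso_comp f g k e z := by
    simp only [VFunctor.isoMk, B.rePt_id, Category.comp_id]
    erw [VCat.id_vcomp, VCat.id_vcomp, VCat.vcomp_id]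
  reIso_id X x := by
    simp only [VFunctor.isoMk, Category.comp_id]
    erw [VCat.id_vcomp]

/-- Composition of functors, in diagrammatic order. -/
abbrev comp (F : IndexedFunctor B C) (G : IndexedFunctor C D) : IndexedFunctor B D where
  fn X := (F.fn X).comp (G.fn X)
  reIso {X Y} f := VFunctor.isoMk
    { app := fun x => (D.fib X).vcomp ((F.reIso f).hom.app x ≫ (G.fn X).map _ _)
        ((G.reIso f).hom.app ((F.fn Y).obj x))
      naturality := fun x y => by
        rw [VNat.naturality_iff (F := (B.re f).comp ((F.fn X).comp (G.fn X)))
          (G := (((F.fn Y).comp (G.fn Y)).bc (W.re f)).comp (D.re f))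
          (fun x => (D.fib X).vcomp ((F.reIso f).hom.app x ≫ (G.fn X).map _ _)
            ((G.reIso f).hom.app ((F.fn Y).obj x))) x y]
        have h₁ := (VNat.whiskerRight (F.reIso f).hom (G.fn X)).nat x y
        have h₂ := (VNat.whiskerLeft ((F.fn Y).bc (W.re f)) (G.reIso f).hom).nat x y
        simp only [VNat.whiskerRight, VNat.whiskerLeft, Category.assoc] at h₁ h₂
        simp only [VCat.post_vcomp, VCat.pre_vcomp, Functor.map_comp, Category.assoc]
        rw [reassoc_of% h₁, ← VCat.post_pre, reassoc_of% h₂] }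
    (fun x => (D.fib X).vcomp ((G.reIso f).inv.app ((F.fn Y).obj x))
      ((F.reIso f).inv.app x ≫ (G.fn X).map _ _))
    (fun x => by
      rw [VCat.vcomp_assoc, ← VCat.vcomp_assoc _ ((G.reIso f).hom.app ((F.fn Y).obj x)),
        VNat.iso_hom_inv, VCat.id_vcomp, ← VFunctor.map_vcomp, VNat.iso_hom_inv,
        VFunctor.map_id])
    (fun x => by
      rw [VCat.vcomp_assoc, ← VCat.vcomp_assoc _ ((F.reIso f).inv.app x ≫ _),
        ← VFunctor.map_vcomp, VNat.iso_inv_hom, VFunctor.map_id, VCat.id_vcomp,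
        VNat.iso_inv_hom])
  reIso_comp {X Y Z} f g k e z := by
    have hF := congrArg (· ≫ (G.fn X).map _ _) (F.reIso_comp f g k e z)
    have hG := G.reIso_comp f g k e ((F.fn Z).obj z)
    have hp := G.reIso_pt f ((F.reIso g).hom.app z)
    simp only [VFunctor.map_vcomp, Category.assoc] at hF
    simp only [VFunctor.isoMk, IndexedCat.rePt_vcomp, VCat.vcomp_assoc]
    rw [hG, ← VCat.vcomp_assoc, hF]
    simp only [VCat.vcomp_assoc, Category.assoc]
    congr 2
    rw [← VCat.vcomp_assoc, hp, VCat.vcomp_assoc]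
  reIso_id X x := by
    have hF := congrArg (· ≫ (G.fn X).map _ _) (F.reIso_id X x)
    simp only [VFunctor.map_vcomp, Category.assoc] at hF
    simp only [VFunctor.isoMk, VCat.vcomp_assoc]
    rw [G.reIso_id, hF]

theorem ext' {F G : IndexedFunctor B C} (h : ∀ X, F.fn X = G.fn X)
    (h' : ∀ {X Y : E} (f : X ⟶ Y) (y : (B.fib Y).Ob),
      (C.fib X).vcomp ((F.reIso f).hom.app y) ((C.fib X).ofEq (by rw [h])) =
        (C.fib X).vcomp ((C.fib X).ofEq (by rw [h])) ((G.reIso f).hom.app y)) : F = G := by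
  obtain ⟨ff, fr, _, _⟩ := F
  obtain ⟨gf, gr, _, _⟩ := G
  obtain rfl : ff = gf := funext h
  have : @fr = @gr := by
    funext X Y f
    apply Iso.ext
    apply VNat.hom_ext
    intro y
    have := @h' X Y f y
    simp only [VCat.ofEq_rfl] at this
    erw [VCat.vcomp_id, VCat.id_vcomp] at this
    exact this
  subst this
  rfl

theorem id_comp (F : IndexedFunctor B C) : (id B).comp F = F := by
  refine ext' (fun X => VFunctor.ext' (fun _ => rfl) fun x y => ?_) fun {X Y} f y => ?_
  · simp
  · simp only [VCat.ofEq_rfl, VFunctor.isoMk]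
    rw [VCat.vcomp_id, VCat.id_vcomp, VFunctor.map_id, VCat.id_vcomp]

theorem comp_id (F : IndexedFunctor B C) : F.comp (id C) = F := by
  refine ext' (fun X => VFunctor.ext' (fun _ => rfl) fun x y => ?_) fun {X Y} f y => ?_
  · simp
  · simp only [VCat.ofEq_rfl, VFunctor.isoMk]
    rw [VCat.vcomp_id, VCat.id_vcomp, Category.comp_id, VCat.vcomp_id]

theorem assoc (F : IndexedFunctor B C) (G : IndexedFunctor C D) (H : IndexedFunctor D K) :
    (F.comp G).comp H = F.comp (G.comp H) := by
  refine ext' (fun X => VFunctor.ext' (fun _ => rfl) fun x y => ?_) fun {X Y} f y => ?_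
  · simp
  · simp only [VCat.ofEq_rfl, VFunctor.isoMk]
    rw [VCat.vcomp_id, VCat.id_vcomp, VFunctor.map_vcomp, VCat.vcomp_assoc, Category.assoc]

end IndexedFunctor

namespace IndexedNat

variable {B C D : IndexedCat.{t} W}

/-- Whiskering with a functor on the source side. -/
abbrev whiskerLeft (L : IndexedFunctor B C) {F G : IndexedFunctor C D} (α : IndexedNat F G) :
    IndexedNat (L.comp F) (L.comp G) where
  app X := VNat.whiskerLeft (L.fn X) (α.app X)
  naturality {X Y} f y := by
    simp only [VFunctor.isoMk, VNat.whiskerLeft]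
    rw [VCat.vcomp_assoc, α.naturality, ← VCat.vcomp_assoc, (α.app X).nat_pt, VCat.vcomp_assoc]

/-- Whiskering with a functor on the target side. -/
abbrev whiskerRight {F G : IndexedFunctor B C} (α : IndexedNat F G) (R : IndexedFunctor C D) :
    IndexedNat (F.comp R) (G.comp R) where
  app X := VNat.whiskerRight (α.app X) (R.fn X)
  naturality {X Y} f y := by
    simp only [VFunctor.isoMk, VNat.whiskerRight]
    rw [VCat.vcomp_assoc, ← R.reIso_pt, ← VCat.vcomp_assoc, ← VFunctor.map_vcomp, α.naturality,
      VFunctor.map_vcomp, VCat.vcomp_assoc]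

end IndexedNat

namespace IndexedNat

variable {B C D K : IndexedCat.{t} W}

theorem eq_conj {F F' G G' : IndexedFunctor B C} (h : F = F') (h' : G' = G) (α : F ⟶ G)
    (β : F' ⟶ G') (hF : ∀ X x, (F.fn X).obj x = (F'.fn X).obj x)
    (hG : ∀ X x, (G'.fn X).obj x = (G.fn X).obj x)
    (e : ∀ X x, (α.app X).app x =
      (C.fib X).vcomp ((C.fib X).ofEq (hF X x))
        ((C.fib X).vcomp ((β.app X).app x) ((C.fib X).ofEq (hG X x)))) :
    α = eqToHom h ≫ β ≫ eqToHom h' := by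
  apply IndexedNat.ext'
  intro X x
  rw [e, comp_app_app, comp_app_app, eqToHom_app_app, eqToHom_app_app]

theorem whiskerLeft_eqToHom (F : IndexedFunctor B C) {G H : IndexedFunctor C D} (h : G = H) :
    whiskerLeft F (eqToHom h) = eqToHom (congrArg (IndexedFunctor.comp F) h) := by
  subst h; rfl

theorem whiskerRight_eqToHom {F G : IndexedFunctor B C} (h : F = G) (H : IndexedFunctor C D) :
    whiskerRight (eqToHom h) H =
      eqToHom (congrArg (fun F => IndexedFunctor.comp F H) h) := by
  subst h
  exact IndexedNat.ext' fun X x => VFunctor.map_id _ _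

theorem pentagon {L : IndexedCat.{t} W} (F : IndexedFunctor B C) (G : IndexedFunctor C D)
    (H : IndexedFunctor D K) (I : IndexedFunctor K L) :
    (show ((F.comp G).comp H).comp I ⟶ F.comp (G.comp (H.comp I)) from
      whiskerRight (eqToHom (IndexedFunctor.assoc F G H)) I ≫
        eqToHom (IndexedFunctor.assoc F (G.comp H) I) ≫
          whiskerLeft F (eqToHom (IndexedFunctor.assoc G H I))) =
      eqToHom (IndexedFunctor.assoc (F.comp G) H I) ≫
        eqToHom (IndexedFunctor.assoc F G (H.comp I)) := by
  rw [whiskerRight_eqToHom, whiskerLeft_eqToHom]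
  simp

theorem triangle (F : IndexedFunctor B C) (G : IndexedFunctor C D) :
    (show (F.comp (IndexedFunctor.id C)).comp G ⟶ F.comp G from
      eqToHom (IndexedFunctor.assoc F (IndexedFunctor.id C) G) ≫
        whiskerLeft F (eqToHom (IndexedFunctor.id_comp G))) =
      whiskerRight (eqToHom (IndexedFunctor.comp_id F)) G := by
  rw [whiskerRight_eqToHom, whiskerLeft_eqToHom]
  simp

end IndexedNat

/-- Indexed `W`-categories, their functors and the natural transformations between them form a
2-category. -/
instance : Bicategory (IndexedCat.{t} W) where
  Hom B C := IndexedFunctor B C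
  id B := IndexedFunctor.id B
  comp F G := F.comp G
  homCategory B C := inferInstanceAs (Category (IndexedFunctor B C))
  whiskerLeft F _ _ α := IndexedNat.whiskerLeft F α
  whiskerRight α G := IndexedNat.whiskerRight α G
  associator F G H := eqToIso (IndexedFunctor.assoc F G H)
  leftUnitor F := eqToIso (IndexedFunctor.id_comp F)
  rightUnitor F := eqToIso (IndexedFunctor.comp_id F)
  whiskerLeft_id F G := IndexedNat.ext' fun X x => rfl
  whiskerLeft_comp F _ _ _ α β := IndexedNat.ext' fun X x => rfl
  id_whiskerLeft {_ _ F G} α :=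
    IndexedNat.eq_conj (IndexedFunctor.id_comp F) (IndexedFunctor.id_comp G).symm _ _ (fun _ _ => rfl) (fun _ _ => rfl) fun _ _ =>
    (VCat.ofEq_conj _ _ _ _).symm
  comp_whiskerLeft F G H H' α :=
    IndexedNat.eq_conj (IndexedFunctor.assoc F G H) (IndexedFunctor.assoc F G H').symm _ _ (fun _ _ => rfl) (fun _ _ => rfl) fun _ _ =>
      (VCat.ofEq_conj _ _ _ _).symm
  id_whiskerRight F G := IndexedNat.ext' fun X x => VFunctor.map_id _ _
  comp_whiskerRight α β G := IndexedNat.ext' fun X x => VFunctor.map_vcomp _ _ _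
  whiskerRight_id {_ _ F G} α :=
    IndexedNat.eq_conj (IndexedFunctor.comp_id F) (IndexedFunctor.comp_id G).symm _ _ (fun _ _ => rfl) (fun _ _ => rfl) fun _ _ =>
    (Category.comp_id _).trans (VCat.ofEq_conj _ _ _ _).symm
  whiskerRight_comp {_ _ _ _ F F'} α G H :=
    IndexedNat.eq_conj (IndexedFunctor.assoc F G H).symm (IndexedFunctor.assoc F' G H) _ _ (fun _ _ => rfl) (fun _ _ => rfl) fun _ _ =>
      (Category.assoc _ _ _).symm.trans (VCat.ofEq_conj _ _ _ _).symm
  whisker_assoc F H H' α G :=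
    IndexedNat.eq_conj (IndexedFunctor.assoc F H G) (IndexedFunctor.assoc F H' G).symm _ _ (fun _ _ => rfl) (fun _ _ => rfl) fun _ _ =>
      (VCat.ofEq_conj _ _ _ _).symm
  whisker_exchange {_ _ _ _ _ _ _} _ β := IndexedNat.ext' fun X _ =>
    ((IndexedNat.app β X).nat_pt _).symm
  pentagon F G H K := IndexedNat.pentagon F G H K
  triangle F G := IndexedNat.triangle F G

instance : Bicategory.Strict (IndexedCat.{t} W) where
  id_comp {B C} F := @IndexedFunctor.id_comp E _ W B C F
  comp_id {B C} F := @IndexedFunctor.comp_id E _ W B C F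
  assoc {B C D K} F G H := @IndexedFunctor.assoc E _ W B C D K F G H
  leftUnitor_eqToIso _ := rfl
  rightUnitor_eqToIso _ := rfl
  associator_eqToIso _ _ _ := rfl

end IndexedEnrichment

namespace IndexedEnrichment


section Transfer

/-! Equations between morphisms of `V` are carried to `V'` by a lax monoidal functor. -/

variable {V : Type w} [Category.{w'} V] [MonoidalCategory V]
variable {V' : Type w} [Category.{w'} V'] [MonoidalCategory V']
variable (T : V ⥤ V') [T.LaxMonoidal]

open Functor.LaxMonoidal

/-- The action of `T` on a morphism `𝟙_ V ⟶ P`, up to an isomorphism `Q ≅ T P`. -/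
def transfer₀ {P : V} {Q : V'} (q : Q ≅ T.obj P) (f : 𝟙_ V ⟶ P) : 𝟙_ V' ⟶ Q :=
  ε T ≫ T.map f ≫ q.inv

/-- The action of `T` on a morphism `P₁ ⟶ P`, up to isomorphisms. -/
def transfer₁ {P₁ P : V} {Q₁ Q : V'} (q₁ : Q₁ ≅ T.obj P₁) (q : Q ≅ T.obj P) (f : P₁ ⟶ P) :
    Q₁ ⟶ Q :=
  q₁.hom ≫ T.map f ≫ q.inv

/-- The action of `T` on a morphism `P₁ ⊗ P₂ ⟶ P`, up to isomorphisms. -/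
def transfer₂ {P₁ P₂ P : V} {Q₁ Q₂ Q : V'} (q₁ : Q₁ ≅ T.obj P₁) (q₂ : Q₂ ≅ T.obj P₂)
    (q : Q ≅ T.obj P) (f : P₁ ⊗ P₂ ⟶ P) : Q₁ ⊗ Q₂ ⟶ Q :=
  (q₁.hom ⊗ₘ q₂.hom) ≫ μ T P₁ P₂ ≫ T.map f ≫ q.inv

theorem transfer_assoc {P₁ P₂ P₃ P₁₂ P₂₃ P : V} {Q₁ Q₂ Q₃ Q₁₂ Q₂₃ Q : V'}
    (q₁ : Q₁ ≅ T.obj P₁) (q₂ : Q₂ ≅ T.obj P₂) (q₃ : Q₃ ≅ T.obj P₃)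
    (q₁₂ : Q₁₂ ≅ T.obj P₁₂) (q₂₃ : Q₂₃ ≅ T.obj P₂₃) (q : Q ≅ T.obj P)
    (f : P₁ ⊗ P₂ ⟶ P₁₂) (g : P₁₂ ⊗ P₃ ⟶ P) (f' : P₂ ⊗ P₃ ⟶ P₂₃) (g' : P₁ ⊗ P₂₃ ⟶ P)
    (h : f ▷ P₃ ≫ g = (α_ P₁ P₂ P₃).hom ≫ P₁ ◁ f' ≫ g') :
    transfer₂ T q₁ q₂ q₁₂ f ▷ Q₃ ≫ transfer₂ T q₁₂ q₃ q g =
      (α_ Q₁ Q₂ Q₃).hom ≫ Q₁ ◁ transfer₂ T q₂ q₃ q₂₃ f' ≫ transfer₂ T q₁ q₂₃ q g' := by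
  have h' := congrArg T.map h
  simp only [Functor.map_comp] at h'
  have hl : transfer₂ T q₁ q₂ q₁₂ f ▷ Q₃ ≫ transfer₂ T q₁₂ q₃ q g =
      ((q₁.hom ⊗ₘ q₂.hom) ⊗ₘ q₃.hom) ≫ μ T P₁ P₂ ▷ T.obj P₃ ≫ μ T (P₁ ⊗ P₂) P₃ ≫
        T.map (f ▷ P₃) ≫ T.map g ≫ q.inv := by
    rw [← μ_natural_left_assoc]
    simp only [transfer₂, ← tensorHom_id, tensorHom_comp_tensorHom_assoc, Category.assoc,
      Iso.inv_hom_id, Category.comp_id, Category.id_comp]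
  have hr : Q₁ ◁ transfer₂ T q₂ q₃ q₂₃ f' ≫ transfer₂ T q₁ q₂₃ q g' =
      (q₁.hom ⊗ₘ (q₂.hom ⊗ₘ q₃.hom)) ≫ T.obj P₁ ◁ μ T P₂ P₃ ≫ μ T P₁ (P₂ ⊗ P₃) ≫
        T.map (P₁ ◁ f') ≫ T.map g' ≫ q.inv := by
    rw [← μ_natural_right_assoc]
    simp only [transfer₂, ← id_tensorHom, tensorHom_comp_tensorHom_assoc, Category.assoc,
      Iso.inv_hom_id, Category.comp_id, Category.id_comp]
  rw [hl, hr, reassoc_of% h', associativity_assoc]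
  simp

theorem transfer_id_left {P P₀ : V} {Q Q₀ : V'} (q₀ : Q₀ ≅ T.obj P₀) (q : Q ≅ T.obj P)
    (i : 𝟙_ V ⟶ P₀) (c : P₀ ⊗ P ⟶ P) (h : i ▷ P ≫ c = (λ_ P).hom) :
    transfer₀ T q₀ i ▷ Q ≫ transfer₂ T q₀ q q c = (λ_ Q).hom := by
  have h' := congrArg T.map h
  simp only [Functor.map_comp] at h'
  simp only [transfer₀, transfer₂, MonoidalCategory.tensorHom_def, comp_whiskerRight,
    Category.assoc]
  simp only [hom_inv_whiskerRight_assoc, inv_hom_whiskerRight_assoc, ← whisker_exchange_assoc,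
    μ_natural_left_assoc, reassoc_of% h']
  have := left_unitality T P
  rw [← reassoc_of% this]
  simp

theorem transfer_id_right {P P₀ : V} {Q Q₀ : V'} (q₀ : Q₀ ≅ T.obj P₀) (q : Q ≅ T.obj P)
    (i : 𝟙_ V ⟶ P₀) (c : P ⊗ P₀ ⟶ P) (h : P ◁ i ≫ c = (ρ_ P).hom) :
    Q ◁ transfer₀ T q₀ i ≫ transfer₂ T q q₀ q c = (ρ_ Q).hom := by
  have h' := congrArg T.map h
  simp only [Functor.map_comp] at h'
  simp only [transfer₀, transfer₂, MonoidalCategory.tensorHom_def',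
    MonoidalCategory.whiskerLeft_comp, Category.assoc]
  simp only [whiskerLeft_inv_hom_assoc, whisker_exchange_assoc,
    μ_natural_right_assoc, reassoc_of% h']
  have := right_unitality T P
  rw [← reassoc_of% this]
  simp

theorem transfer_comp_map {P₁ P₂ P P₁' P₂' P' : V} {Q₁ Q₂ Q Q₁' Q₂' Q' : V'}
    (q₁ : Q₁ ≅ T.obj P₁) (q₂ : Q₂ ≅ T.obj P₂) (q : Q ≅ T.obj P)
    (q₁' : Q₁' ≅ T.obj P₁') (q₂' : Q₂' ≅ T.obj P₂') (q' : Q' ≅ T.obj P')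
    (c : P₁ ⊗ P₂ ⟶ P) (c' : P₁' ⊗ P₂' ⟶ P') (m₁ : P₁ ⟶ P₁') (m₂ : P₂ ⟶ P₂') (m : P ⟶ P')
    (h : c ≫ m = (m₁ ⊗ₘ m₂) ≫ c') :
    transfer₂ T q₁ q₂ q c ≫ transfer₁ T q q' m =
      (transfer₁ T q₁ q₁' m₁ ⊗ₘ transfer₁ T q₂ q₂' m₂) ≫ transfer₂ T q₁' q₂' q' c' := by
  have h' := congrArg T.map h
  simp only [Functor.map_comp] at h'
  simp only [transfer₂, transfer₁, Category.assoc, Iso.inv_hom_id_assoc, reassoc_of% h',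
    tensorHom_comp_tensorHom_assoc, Iso.inv_hom_id, Category.comp_id]
  rw [← tensorHom_comp_tensorHom_assoc, μ_natural_assoc]

theorem transfer_id_map {P P' : V} {Q Q' : V'} (q : Q ≅ T.obj P) (q' : Q' ≅ T.obj P')
    (i : 𝟙_ V ⟶ P) (i' : 𝟙_ V ⟶ P') (m : P ⟶ P') (h : i ≫ m = i') :
    transfer₀ T q i ≫ transfer₁ T q q' m = transfer₀ T q' i' := by
  subst h
  simp [transfer₀, transfer₁]

theorem transfer_naturality {P R₁ R₂ R₁' R₂' R : V} {Q S₁ S₂ S₁' S₂' S : V'}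
    (q : Q ≅ T.obj P) (s₁ : S₁ ≅ T.obj R₁) (s₂ : S₂ ≅ T.obj R₂) (s₁' : S₁' ≅ T.obj R₁')
    (s₂' : S₂' ≅ T.obj R₂') (s : S ≅ T.obj R) (a : 𝟙_ V ⟶ R₁) (m : P ⟶ R₂) (c : R₁ ⊗ R₂ ⟶ R)
    (m' : P ⟶ R₁') (a' : 𝟙_ V ⟶ R₂') (c' : R₁' ⊗ R₂' ⟶ R)
    (h : (λ_ P).inv ≫ (a ⊗ₘ m) ≫ c = (ρ_ P).inv ≫ (m' ⊗ₘ a') ≫ c') :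
    (λ_ Q).inv ≫ (transfer₀ T s₁ a ⊗ₘ transfer₁ T q s₂ m) ≫ transfer₂ T s₁ s₂ s c =
      (ρ_ Q).inv ≫ (transfer₁ T q s₁' m' ⊗ₘ transfer₀ T s₂' a') ≫ transfer₂ T s₁' s₂' s c' := by
  have h' := congrArg T.map h
  simp only [Functor.map_comp] at h'
  have hl : (λ_ Q).inv ≫ (transfer₀ T s₁ a ⊗ₘ transfer₁ T q s₂ m) ≫ transfer₂ T s₁ s₂ s c =
      q.hom ≫ T.map (λ_ P).inv ≫ T.map (a ⊗ₘ m) ≫ T.map c ≫ s.inv := by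
    have : (ε T ≫ T.map a) ⊗ₘ (q.hom ≫ T.map m) =
        (𝟙_ V' ◁ q.hom) ≫ (ε T ▷ T.obj P) ≫ (T.map a ⊗ₘ T.map m) := by
      simp only [← id_tensorHom, ← tensorHom_id, tensorHom_comp_tensorHom, Category.assoc,
        Category.comp_id, Category.id_comp]
    simp only [transfer₀, transfer₁, transfer₂, tensorHom_comp_tensorHom_assoc, Category.assoc,
      Iso.inv_hom_id, Category.comp_id]
    rw [this]
    simp only [Category.assoc, μ_natural_assoc]
    rw [← leftUnitor_inv_naturality_assoc, left_unitality_inv_assoc]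
  have hr : (ρ_ Q).inv ≫ (transfer₁ T q s₁' m' ⊗ₘ transfer₀ T s₂' a') ≫
      transfer₂ T s₁' s₂' s c' =
      q.hom ≫ T.map (ρ_ P).inv ≫ T.map (m' ⊗ₘ a') ≫ T.map c' ≫ s.inv := by
    have : (q.hom ≫ T.map m') ⊗ₘ (ε T ≫ T.map a') =
        (q.hom ▷ 𝟙_ V') ≫ (T.obj P ◁ ε T) ≫ (T.map m' ⊗ₘ T.map a') := by
      simp only [← id_tensorHom, ← tensorHom_id, tensorHom_comp_tensorHom, Category.assoc,
        Category.comp_id, Category.id_comp]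
    simp only [transfer₀, transfer₁, transfer₂, tensorHom_comp_tensorHom_assoc, Category.assoc,
      Iso.inv_hom_id, Category.comp_id]
    rw [this]
    simp only [Category.assoc, μ_natural_assoc]
    rw [← rightUnitor_inv_naturality_assoc, right_unitality_inv_assoc]
  rw [hl, hr, reassoc_of% h']

end Transfer

end IndexedEnrichment

namespace IndexedEnrichment


open Functor.LaxMonoidal

section TransferComp

variable {V : Type w} [Category.{w'} V] [MonoidalCategory V]
variable {V' : Type w} [Category.{w'} V'] [MonoidalCategory V']
variable {V'' : Type w} [Category.{w'} V''] [MonoidalCategory V'']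
variable {T : V ⥤ V'} {S : V' ⥤ V''} {K : V ⥤ V''} [T.LaxMonoidal] [S.LaxMonoidal]
  [K.LaxMonoidal] (κ : K ≅ T ⋙ S) [NatTrans.IsMonoidal κ.hom]

theorem transfer₀_transfer₀ {P : V} {Q : V'} {R : V''} (q : Q ≅ T.obj P) (r : R ≅ S.obj Q)
    (k : R ≅ K.obj P) (e : r.hom ≫ S.map q.hom = k.hom ≫ κ.hom.app P) (f : 𝟙_ V ⟶ P) :
    transfer₀ S r (transfer₀ T q f) = transfer₀ K k f := by
  have hε := NatTrans.IsMonoidal.unit (τ := κ.hom)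
  simp only [Functor.LaxMonoidal.comp_ε] at hε
  rw [← cancel_mono (k.hom ≫ κ.hom.app P)]
  conv_lhs => rw [← e]
  simp only [transfer₀, Category.assoc, Iso.inv_hom_id_assoc, ← Functor.map_comp,
    Iso.inv_hom_id, Category.comp_id, κ.hom.naturality]
  rw [reassoc_of% hε]
  simp

theorem transfer₁_transfer₁ {P P' : V} {Q Q' : V'} {R R' : V''} (q : Q ≅ T.obj P)
    (r : R ≅ S.obj Q) (k : R ≅ K.obj P) (e : r.hom ≫ S.map q.hom = k.hom ≫ κ.hom.app P)
    (q' : Q' ≅ T.obj P')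
    (r' : R' ≅ S.obj Q') (k' : R' ≅ K.obj P') (e' : r'.hom ≫ S.map q'.hom = k'.hom ≫ κ.hom.app P')
    (f : P ⟶ P') :
    transfer₁ S r r' (transfer₁ T q q' f) = transfer₁ K k k' f := by
  rw [← cancel_mono (k'.hom ≫ κ.hom.app P')]
  conv_lhs => rw [← e']
  simp only [transfer₁, Category.assoc, Iso.inv_hom_id_assoc, ← Functor.map_comp,
    Iso.inv_hom_id, Category.comp_id, κ.hom.naturality]
  simp only [Functor.map_comp, reassoc_of% e, Functor.comp_map]

theorem transfer₂_transfer₂ {P₁ P₂ P : V} {Q₁ Q₂ Q : V'} {R₁ R₂ R : V''}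
    (q₁ : Q₁ ≅ T.obj P₁) (r₁ : R₁ ≅ S.obj Q₁) (k₁ : R₁ ≅ K.obj P₁)
    (e₁ : r₁.hom ≫ S.map q₁.hom = k₁.hom ≫ κ.hom.app P₁)
    (q₂ : Q₂ ≅ T.obj P₂) (r₂ : R₂ ≅ S.obj Q₂) (k₂ : R₂ ≅ K.obj P₂)
    (e₂ : r₂.hom ≫ S.map q₂.hom = k₂.hom ≫ κ.hom.app P₂)
    (q : Q ≅ T.obj P) (r : R ≅ S.obj Q) (k : R ≅ K.obj P)
    (e : r.hom ≫ S.map q.hom = k.hom ≫ κ.hom.app P) (f : P₁ ⊗ P₂ ⟶ P) :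
    transfer₂ S r₁ r₂ r (transfer₂ T q₁ q₂ q f) = transfer₂ K k₁ k₂ k f := by
  have hμ := NatTrans.IsMonoidal.tensor (τ := κ.hom) P₁ P₂
  simp only [Functor.LaxMonoidal.comp_μ] at hμ
  rw [← cancel_mono (k.hom ≫ κ.hom.app P)]
  conv_lhs => rw [← e]
  simp only [transfer₂, Category.assoc, Iso.inv_hom_id_assoc, ← Functor.map_comp,
    Iso.inv_hom_id, Category.comp_id, κ.hom.naturality]
  rw [reassoc_of% hμ, tensorHom_comp_tensorHom_assoc, ← e₁, ← e₂]
  simp only [Functor.map_comp, Functor.comp_map, ← tensorHom_comp_tensorHom, Category.assoc,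
    μ_natural_assoc]

end TransferComp

variable {E : Type u} [Category.{v} E]

namespace IndexedMonoidalCategory

variable (W : IndexedMonoidalCategory.{w, w'} E)

/-- Reindexing along `u` of a generalized element `𝟙_ ⟶ H(p)`. -/
abbrev pull₀ {J I Z : E} (u : J ⟶ I) {p : I ⟶ Z} {p' : J ⟶ Z} (e : u ≫ p = p') {H : W.fib Z}
    (f : 𝟙_ (W.fib I) ⟶ (W.re p).obj H) : 𝟙_ (W.fib J) ⟶ (W.re p').obj H :=
  transfer₀ (W.re u) ((W.reComp u p p' e).app H) f

/-- Reindexing along `u` of a morphism `H₁(p₁) ⟶ H(p)`. -/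
abbrev pull₁ {J I Z₁ Z : E} (u : J ⟶ I) {p₁ : I ⟶ Z₁} {p₁' : J ⟶ Z₁} (e₁ : u ≫ p₁ = p₁')
    {p : I ⟶ Z} {p' : J ⟶ Z} (e : u ≫ p = p') {H₁ : W.fib Z₁} {H : W.fib Z}
    (f : (W.re p₁).obj H₁ ⟶ (W.re p).obj H) : (W.re p₁').obj H₁ ⟶ (W.re p').obj H :=
  transfer₁ (W.re u) ((W.reComp u p₁ p₁' e₁).app H₁) ((W.reComp u p p' e).app H) f

/-- Reindexing along `u` of a morphism `H₁(p₁) ⊗ H₂(p₂) ⟶ H(p)`. -/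
abbrev pull₂ {J I Z₁ Z₂ Z : E} (u : J ⟶ I) {p₁ : I ⟶ Z₁} {p₁' : J ⟶ Z₁} (e₁ : u ≫ p₁ = p₁')
    {p₂ : I ⟶ Z₂} {p₂' : J ⟶ Z₂} (e₂ : u ≫ p₂ = p₂')
    {p : I ⟶ Z} {p' : J ⟶ Z} (e : u ≫ p = p') {H₁ : W.fib Z₁} {H₂ : W.fib Z₂} {H : W.fib Z}
    (f : (W.re p₁).obj H₁ ⊗ (W.re p₂).obj H₂ ⟶ (W.re p).obj H) :
    (W.re p₁').obj H₁ ⊗ (W.re p₂').obj H₂ ⟶ (W.re p').obj H :=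
  transfer₂ (W.re u) ((W.reComp u p₁ p₁' e₁).app H₁) ((W.reComp u p₂ p₂' e₂).app H₂)
    ((W.reComp u p p' e).app H) f

theorem pull₀_pull₀ {K J I Z : E} (u : K ⟶ J) (s : J ⟶ I) {p : I ⟶ Z} {p' : J ⟶ Z} {p'' : K ⟶ Z}
    (e : s ≫ p = p') (e' : u ≫ p' = p'') {H : W.fib Z} (f : 𝟙_ (W.fib I) ⟶ (W.re p).obj H) :
    W.pull₀ u e' (W.pull₀ s e f) =
      W.pull₀ (u ≫ s) (show (u ≫ s) ≫ p = p'' by rw [Category.assoc, e, e']) f :=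
  transfer₀_transfer₀ (W.reComp u s _ rfl) _ _ _ (W.reComp_assoc _ _ _ _ _ _ _ _ _ _ _) f

theorem pull₁_pull₁ {K J I Z₁ Z : E} (u : K ⟶ J) (s : J ⟶ I)
    {p₁ : I ⟶ Z₁} {p₁' : J ⟶ Z₁} {p₁'' : K ⟶ Z₁} (e₁ : s ≫ p₁ = p₁') (e₁' : u ≫ p₁' = p₁'')
    {p : I ⟶ Z} {p' : J ⟶ Z} {p'' : K ⟶ Z} (e : s ≫ p = p') (e' : u ≫ p' = p'')
    {H₁ : W.fib Z₁} {H : W.fib Z} (f : (W.re p₁).obj H₁ ⟶ (W.re p).obj H) :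
    W.pull₁ u e₁' e' (W.pull₁ s e₁ e f) =
      W.pull₁ (u ≫ s) (show (u ≫ s) ≫ p₁ = p₁'' by rw [Category.assoc, e₁, e₁'])
        (show (u ≫ s) ≫ p = p'' by rw [Category.assoc, e, e']) f :=
  transfer₁_transfer₁ (W.reComp u s _ rfl) _ _ _ (W.reComp_assoc _ _ _ _ _ _ _ _ _ _ _)
    _ _ _ (W.reComp_assoc _ _ _ _ _ _ _ _ _ _ _) f

theorem pull₂_pull₂ {K J I Z₁ Z₂ Z : E} (u : K ⟶ J) (s : J ⟶ I)
    {p₁ : I ⟶ Z₁} {p₁' : J ⟶ Z₁} {p₁'' : K ⟶ Z₁} (e₁ : s ≫ p₁ = p₁') (e₁' : u ≫ p₁' = p₁'')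
    {p₂ : I ⟶ Z₂} {p₂' : J ⟶ Z₂} {p₂'' : K ⟶ Z₂} (e₂ : s ≫ p₂ = p₂') (e₂' : u ≫ p₂' = p₂'')
    {p : I ⟶ Z} {p' : J ⟶ Z} {p'' : K ⟶ Z} (e : s ≫ p = p') (e' : u ≫ p' = p'')
    {H₁ : W.fib Z₁} {H₂ : W.fib Z₂} {H : W.fib Z}
    (f : (W.re p₁).obj H₁ ⊗ (W.re p₂).obj H₂ ⟶ (W.re p).obj H) :
    W.pull₂ u e₁' e₂' e' (W.pull₂ s e₁ e₂ e f) =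
      W.pull₂ (u ≫ s) (show (u ≫ s) ≫ p₁ = p₁'' by rw [Category.assoc, e₁, e₁'])
        (show (u ≫ s) ≫ p₂ = p₂'' by rw [Category.assoc, e₂, e₂'])
        (show (u ≫ s) ≫ p = p'' by rw [Category.assoc, e, e']) f :=
  transfer₂_transfer₂ (W.reComp u s _ rfl) _ _ _ (W.reComp_assoc _ _ _ _ _ _ _ _ _ _ _)
    _ _ _ (W.reComp_assoc _ _ _ _ _ _ _ _ _ _ _) _ _ _ (W.reComp_assoc _ _ _ _ _ _ _ _ _ _ _) f

end IndexedMonoidalCategory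

end IndexedEnrichment

namespace IndexedEnrichment


section

open Functor.LaxMonoidal

variable {V : Type w} [Category.{w'} V] [MonoidalCategory V]
variable {V' : Type w} [Category.{w'} V'] [MonoidalCategory V']
variable (T : V ⥤ V') [T.LaxMonoidal]

theorem transfer_vcomp {R₁ R₂ R : V} {S₁ S₂ S : V'} (s₁ : S₁ ≅ T.obj R₁) (s₂ : S₂ ≅ T.obj R₂)
    (s : S ≅ T.obj R) (a : 𝟙_ V ⟶ R₁) (b : 𝟙_ V ⟶ R₂) (c : R₁ ⊗ R₂ ⟶ R) :
    transfer₀ T s ((λ_ (𝟙_ V)).inv ≫ (a ⊗ₘ b) ≫ c) =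
      (λ_ (𝟙_ V')).inv ≫ (transfer₀ T s₁ a ⊗ₘ transfer₀ T s₂ b) ≫ transfer₂ T s₁ s₂ s c := by
  have : (ε T ≫ T.map a) ⊗ₘ (ε T ≫ T.map b) =
      (𝟙_ V' ◁ ε T) ≫ (ε T ▷ T.obj (𝟙_ V)) ≫ (T.map a ⊗ₘ T.map b) := by
    simp only [← id_tensorHom, ← tensorHom_id, tensorHom_comp_tensorHom,
      Category.id_comp]
  simp only [transfer₀, transfer₂, tensorHom_comp_tensorHom_assoc, Category.assoc,
    Iso.inv_hom_id, Category.comp_id, Functor.map_comp]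
  rw [this]
  simp only [Category.assoc, μ_natural_assoc]
  rw [← leftUnitor_inv_naturality_assoc, left_unitality_inv_assoc]

theorem transfer₀_comp_map {P P' : V} {Q Q' : V'} (q : Q ≅ T.obj P) (q' : Q' ≅ T.obj P')
    (i : 𝟙_ V ⟶ P) (m : P ⟶ P') :
    transfer₀ T q' (i ≫ m) = transfer₀ T q i ≫ transfer₁ T q q' m :=
  (transfer_id_map T q q' i _ m rfl).symm

end

variable {E : Type u} [Category.{v} E] [CartesianMonoidalCategory E]

/-! ### Small enriched categories -/

/-- The projections of a triple product. -/
abbrev tri₀ (A : E) : A ⊗ (A ⊗ A) ⟶ A := fst A (A ⊗ A)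

abbrev tri₁ (A : E) : A ⊗ (A ⊗ A) ⟶ A := snd A (A ⊗ A) ≫ fst A A

abbrev tri₂ (A : E) : A ⊗ (A ⊗ A) ⟶ A := snd A (A ⊗ A) ≫ snd A A

/-- The projections of a fourfold product. -/
abbrev quad₀ (A : E) : A ⊗ (A ⊗ (A ⊗ A)) ⟶ A := fst A (A ⊗ (A ⊗ A))

abbrev quad₁ (A : E) : A ⊗ (A ⊗ (A ⊗ A)) ⟶ A := snd A (A ⊗ (A ⊗ A)) ≫ tri₀ A

abbrev quad₂ (A : E) : A ⊗ (A ⊗ (A ⊗ A)) ⟶ A := snd A (A ⊗ (A ⊗ A)) ≫ tri₁ A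

abbrev quad₃ (A : E) : A ⊗ (A ⊗ (A ⊗ A)) ⟶ A := snd A (A ⊗ (A ⊗ A)) ≫ tri₂ A

/-- The data of a small `W`-category: composition and identities are morphisms of `W` over the
triple product of `ob` and over `ob`. -/
structure SmallCatData (W : IndexedMonoidalCategory.{w, w'} E) where
  ob : E
  hom : W.fib (ob ⊗ ob)
  id : 𝟙_ (W.fib ob) ⟶ (W.re (lift (𝟙 ob) (𝟙 ob))).obj hom
  comp :
    (W.re (lift (tri₁ ob) (tri₂ ob))).obj hom ⊗ (W.re (lift (tri₀ ob) (tri₁ ob))).obj hom ⟶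
      (W.re (lift (tri₀ ob) (tri₂ ob))).obj hom

variable {W : IndexedMonoidalCategory.{w, w'} E}

namespace SmallCatData

variable (A : SmallCatData W)

/-- The object of morphisms between two generalized objects. -/
abbrev H {I : E} (x y : I ⟶ A.ob) : W.fib I := (W.re (lift x y)).obj A.hom

/-- The identity of a generalized object. -/
def idAt {I : E} (x : I ⟶ A.ob) : 𝟙_ (W.fib I) ⟶ A.H x x :=
  W.pull₀ x (by simp) A.id

/-- The composition for three generalized objects. -/
def compAt {I : E} (x y z : I ⟶ A.ob) : A.H y z ⊗ A.H x y ⟶ A.H x z :=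
  W.pull₂ (lift x (lift y z)) (by simp) (by simp) (by simp) A.comp

theorem idAt_pull {J I : E} (u : J ⟶ I) {x : I ⟶ A.ob} {x' : J ⟶ A.ob} (h : u ≫ x = x') :
    W.pull₀ u (show u ≫ lift x x = lift x' x' by simp [h]) (A.idAt x) = A.idAt x' := by
  subst h
  exact W.pull₀_pull₀ _ _ _ _ _

theorem compAt_pull {J I : E} (u : J ⟶ I) {x y z : I ⟶ A.ob} {x' y' z' : J ⟶ A.ob}
    (hx : u ≫ x = x') (hy : u ≫ y = y') (hz : u ≫ z = z') :
    W.pull₂ u (show u ≫ lift y z = lift y' z' by simp [hy, hz])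
      (show u ≫ lift x y = lift x' y' by simp [hx, hy])
      (show u ≫ lift x z = lift x' z' by simp [hx, hz]) (A.compAt x y z) = A.compAt x' y' z' := by
  subst hx hy hz
  refine (W.pull₂_pull₂ _ _ _ _ _ _ _ _ _).trans ?_
  have : u ≫ lift x (lift y z) = lift (u ≫ x) (lift (u ≫ y) (u ≫ z)) := by simp
  simp only [this, compAt]

end SmallCatData

/-- A small `W`-category.  The associativity law lives over the fourfold product of `ob` and the
unit laws over its square; they are stated at the product projections. -/
structure SmallCat (W : IndexedMonoidalCategory.{w, w'} E) extends SmallCatData W where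
  assoc_generic :
    toSmallCatData.compAt (quad₁ ob) (quad₂ ob) (quad₃ ob) ▷
          toSmallCatData.H (quad₀ ob) (quad₁ ob) ≫
        toSmallCatData.compAt (quad₀ ob) (quad₁ ob) (quad₃ ob) =
      (α_ (toSmallCatData.H (quad₂ ob) (quad₃ ob)) (toSmallCatData.H (quad₁ ob) (quad₂ ob))
          (toSmallCatData.H (quad₀ ob) (quad₁ ob))).hom ≫
        toSmallCatData.H (quad₂ ob) (quad₃ ob) ◁
            toSmallCatData.compAt (quad₀ ob) (quad₁ ob) (quad₂ ob) ≫
          toSmallCatData.compAt (quad₀ ob) (quad₂ ob) (quad₃ ob)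
  id_comp_generic :
    toSmallCatData.idAt (snd ob ob) ▷ toSmallCatData.H (fst ob ob) (snd ob ob) ≫
      toSmallCatData.compAt (fst ob ob) (snd ob ob) (snd ob ob) = (λ_ _).hom
  comp_id_generic :
    toSmallCatData.H (fst ob ob) (snd ob ob) ◁ toSmallCatData.idAt (fst ob ob) ≫
      toSmallCatData.compAt (fst ob ob) (fst ob ob) (snd ob ob) = (ρ_ _).hom

namespace SmallCat

variable (A : SmallCat W)

theorem assocAt {I : E} (x₀ x₁ x₂ x₃ : I ⟶ A.ob) :
    A.compAt x₁ x₂ x₃ ▷ A.H x₀ x₁ ≫ A.compAt x₀ x₁ x₃ =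
      (α_ (A.H x₂ x₃) (A.H x₁ x₂) (A.H x₀ x₁)).hom ≫
        A.H x₂ x₃ ◁ A.compAt x₀ x₁ x₂ ≫ A.compAt x₀ x₂ x₃ := by
  have h := A.assoc_generic
  set u := lift x₀ (lift x₁ (lift x₂ x₃)) with hu
  have e₀ : u ≫ quad₀ _ = x₀ := by simp [hu]
  have e₁ : u ≫ quad₁ _ = x₁ := by simp [hu]
  have e₂ : u ≫ quad₂ _ = x₂ := by simp [hu]
  have e₃ : u ≫ quad₃ _ = x₃ := by simp [hu]
  have := transfer_assoc (W.re u)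
    ((W.reComp u _ (lift x₂ x₃) (by simp [e₂, e₃])).app A.hom)
    ((W.reComp u _ (lift x₁ x₂) (by simp [e₁, e₂])).app A.hom)
    ((W.reComp u _ (lift x₀ x₁) (by simp [e₀, e₁])).app A.hom)
    ((W.reComp u _ (lift x₁ x₃) (by simp [e₁, e₃])).app A.hom)
    ((W.reComp u _ (lift x₀ x₂) (by simp [e₀, e₂])).app A.hom)
    ((W.reComp u _ (lift x₀ x₃) (by simp [e₀, e₃])).app A.hom) _ _ _ _ h
  have c₁ := A.compAt_pull u e₁ e₂ e₃
  have c₂ := A.compAt_pull u e₀ e₁ e₃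
  have c₃ := A.compAt_pull u e₀ e₁ e₂
  have c₄ := A.compAt_pull u e₀ e₂ e₃
  rw [← c₁, ← c₂, ← c₃, ← c₄]
  exact this

theorem id_compAt {I : E} (x y : I ⟶ A.ob) :
    A.idAt y ▷ A.H x y ≫ A.compAt x y y = (λ_ (A.H x y)).hom := by
  have e₀ : lift x y ≫ fst _ _ = x := by simp
  have e₁ : lift x y ≫ snd _ _ = y := by simp
  rw [← A.idAt_pull (lift x y) e₁, ← A.compAt_pull (lift x y) e₀ e₁ e₁]
  exact transfer_id_left _ _ _ _ _ A.id_comp_generic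

theorem comp_idAt {I : E} (x y : I ⟶ A.ob) :
    A.H x y ◁ A.idAt x ≫ A.compAt x x y = (ρ_ (A.H x y)).hom := by
  have e₀ : lift x y ≫ fst _ _ = x := by simp
  have e₁ : lift x y ≫ snd _ _ = y := by simp
  rw [← A.idAt_pull (lift x y) e₀, ← A.compAt_pull (lift x y) e₀ e₀ e₁]
  exact transfer_id_right _ _ _ _ _ A.comp_id_generic

/-- The enriched category of generalized objects `I ⟶ A.ob` of a small `W`-category. -/
abbrev ctx (I : E) : VCat.{max t v} (W.fib I) where
  Ob := ULift.{t} (I ⟶ A.ob)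
  hom x y := A.H x.down y.down
  id x := A.idAt x.down
  comp x y z := A.compAt x.down y.down z.down
  assoc x₀ x₁ x₂ x₃ := A.assocAt x₀.down x₁.down x₂.down x₃.down
  id_comp x y := A.id_compAt x.down y.down
  comp_id x y := A.comp_idAt x.down y.down

end SmallCat

/-- The data of a functor of small `W`-categories. -/
structure SmallFunctorData (A B : SmallCat W) where
  ob : A.ob ⟶ B.ob
  mor : A.hom ⟶ (W.re (ob ⊗ₘ ob)).obj B.hom

namespace SmallFunctorData

variable {A B C : SmallCat W} (F : SmallFunctorData A B)

/-- The action of a functor on the morphisms between two generalized objects. -/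
def mapAt {I : E} (x y : I ⟶ A.ob) {x' y' : I ⟶ B.ob} (hx : x ≫ F.ob = x') (hy : y ≫ F.ob = y') :
    A.H x y ⟶ B.H x' y' :=
  (W.re (lift x y)).map F.mor ≫
    (W.reComp (lift x y) (F.ob ⊗ₘ F.ob) (lift x' y') (by simp [hx, hy])).inv.app B.hom

theorem mapAt_pull {J I : E} (u : J ⟶ I) {x y : I ⟶ A.ob} {x' y' : I ⟶ B.ob}
    (hx : x ≫ F.ob = x') (hy : y ≫ F.ob = y') {ux uy : J ⟶ A.ob} {ux' uy' : J ⟶ B.ob}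
    (e₁ : u ≫ x = ux) (e₂ : u ≫ y = uy) (e₃ : u ≫ x' = ux') (e₄ : u ≫ y' = uy') :
    W.pull₁ u (show u ≫ lift x y = lift ux uy by simp [e₁, e₂])
      (show u ≫ lift x' y' = lift ux' uy' by simp [e₃, e₄]) (F.mapAt x y hx hy) =
      F.mapAt ux uy (by rw [← e₁, ← e₃, ← hx, Category.assoc])
        (by rw [← e₂, ← e₄, ← hy, Category.assoc]) := by
  have key := W.reComp_assoc u (lift x y) (F.ob ⊗ₘ F.ob) (lift ux uy) (lift x' y') (lift ux' uy')
    (by simp [e₁, e₂]) (by simp [hx, hy]) (by simp [e₃, e₄])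
    (by simp [← e₁, ← e₂, ← e₃, ← e₄, ← hx, ← hy]) B.hom
  have nat := (W.reComp u (lift x y) (lift ux uy) (by simp [e₁, e₂])).hom.naturality F.mor
  simp only [IndexedMonoidalCategory.pull₁, transfer₁, mapAt, Functor.map_comp, Iso.app_hom,
    Iso.app_inv, Category.assoc]
  simp only [Functor.comp_map] at nat
  rw [← reassoc_of% nat]
  congr 1
  rw [← cancel_mono ((W.reComp (lift ux uy) (F.ob ⊗ₘ F.ob) (lift ux' uy') (by
    simp [← e₁, ← e₂, ← e₃, ← e₄, ← hx, ← hy])).hom.app B.hom ≫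
      (W.reComp u (lift x y) (lift ux uy) (by simp [e₁, e₂])).hom.app _)]
  rw [Iso.inv_hom_id_app_assoc]
  rw [← key]
  simp only [Category.assoc, Iso.inv_hom_id_app_assoc]
  rw [← Functor.map_comp, Iso.inv_hom_id_app]
  simp

end SmallFunctorData

end IndexedEnrichment

namespace IndexedEnrichment


variable {E : Type u} [Category.{v} E] [CartesianMonoidalCategory E]
variable {W : IndexedMonoidalCategory.{w, w'} E}

/-- A functor of small `W`-categories.  Compatibility with composition and identities is stated
over the triple product of `A.ob` and over `A.ob`. -/
structure SmallFunctor (A B : SmallCat W) extends SmallFunctorData A B where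
  map_comp_generic :
    A.compAt (tri₀ A.ob) (tri₁ A.ob) (tri₂ A.ob) ≫
        toSmallFunctorData.mapAt (tri₀ A.ob) (tri₂ A.ob) rfl rfl =
      (toSmallFunctorData.mapAt (tri₁ A.ob) (tri₂ A.ob) rfl rfl ⊗ₘ
          toSmallFunctorData.mapAt (tri₀ A.ob) (tri₁ A.ob) rfl rfl) ≫
        B.compAt (tri₀ A.ob ≫ ob) (tri₁ A.ob ≫ ob) (tri₂ A.ob ≫ ob)
  map_id_generic :
    A.idAt (𝟙 A.ob) ≫
        toSmallFunctorData.mapAt (𝟙 A.ob) (𝟙 A.ob) (Category.id_comp ob) (Category.id_comp ob) =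
      B.idAt ob

namespace SmallFunctor

variable {A B C D : SmallCat W}

theorem compAt_mapAt (F : SmallFunctor A B) {I : E} (x y z : I ⟶ A.ob) {x' y' z' : I ⟶ B.ob}
    (hx : x ≫ F.ob = x') (hy : y ≫ F.ob = y') (hz : z ≫ F.ob = z') :
    A.compAt x y z ≫ F.mapAt x z hx hz =
      (F.mapAt y z hy hz ⊗ₘ F.mapAt x y hx hy) ≫ B.compAt x' y' z' := by
  set s := lift x (lift y z) with hs
  have e₀ : s ≫ tri₀ _ = x := by simp [hs]
  have e₁ : s ≫ tri₁ _ = y := by simp [hs]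
  have e₂ : s ≫ tri₂ _ = z := by simp [hs]
  have e₀' : s ≫ tri₀ _ ≫ F.ob = x' := by rw [← hx, ← e₀, Category.assoc]
  have e₁' : s ≫ tri₁ _ ≫ F.ob = y' := by rw [← hy, ← e₁]; simp
  have e₂' : s ≫ tri₂ _ ≫ F.ob = z' := by rw [← hz, ← e₂]; simp
  rw [← A.compAt_pull s e₀ e₁ e₂, ← B.compAt_pull s e₀' e₁' e₂',
    ← F.mapAt_pull s rfl rfl e₀ e₂ e₀' e₂', ← F.mapAt_pull s rfl rfl e₁ e₂ e₁' e₂',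
    ← F.mapAt_pull s rfl rfl e₀ e₁ e₀' e₁']
  exact transfer_comp_map _ _ _ _ _ _ _ _ _ _ _ _ F.map_comp_generic

theorem idAt_mapAt (F : SmallFunctor A B) {I : E} (x : I ⟶ A.ob) {x' : I ⟶ B.ob}
    (hx : x ≫ F.ob = x') : A.idAt x ≫ F.mapAt x x hx hx = B.idAt x' := by
  have e : x ≫ 𝟙 A.ob = x := Category.comp_id x
  rw [← A.idAt_pull x e, ← B.idAt_pull x hx,
    ← F.mapAt_pull x (Category.id_comp F.ob) (Category.id_comp F.ob) e e hx hx]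
  exact transfer_id_map _ _ _ _ _ _ F.map_id_generic

/-- The functor of enriched categories of generalized objects given by a functor of small
`W`-categories. -/
abbrev ctx (F : SmallFunctor A B) (I : E) : VFunctor (SmallCat.ctx.{t} A I) (SmallCat.ctx.{t} B I) where
  obj x := ⟨x.down ≫ F.ob⟩
  map x y := F.mapAt x.down y.down rfl rfl
  map_comp x y z := F.compAt_mapAt x.down y.down z.down rfl rfl rfl
  map_id x := F.idAt_mapAt x.down rfl

theorem re_map_injective {Z : E} {m : Z ⟶ Z} (h : m = 𝟙 Z) {P Q : W.fib Z} {f g : P ⟶ Q}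
    (e : (W.re m).map f = (W.re m).map g) : f = g := by
  subst h
  have hf := (W.reId Z).hom.naturality f
  have hg := (W.reId Z).hom.naturality g
  rw [e, hg] at hf
  exact ((cancel_epi _).1 hf).symm

theorem ext' {F G : SmallFunctor A B} (h : F.ob = G.ob)
    (h' : ∀ (I : E) (x y : I ⟶ A.ob) (x' y' : I ⟶ B.ob) (hx : x ≫ F.ob = x') (hy : y ≫ F.ob = y')
      (hx' : x ≫ G.ob = x') (hy' : y ≫ G.ob = y'), F.mapAt x y hx hy = G.mapAt x y hx' hy') :
    F = G := by
  obtain ⟨⟨fo, fm⟩, _, _⟩ := F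
  obtain ⟨⟨go, gm⟩, _, _⟩ := G
  obtain rfl : fo = go := h
  have := h' _ (fst A.ob A.ob) (snd A.ob A.ob) _ _ rfl rfl rfl rfl
  simp only [SmallFunctorData.mapAt, cancel_mono] at this
  obtain rfl : fm = gm := re_map_injective (by simp) this
  rfl

theorem mapAt_of_id {Z : E} (m : Z ⟶ Z) (h : m = 𝟙 Z) (P : W.fib Z) {I : E} (l : I ⟶ Z)
    (e : l ≫ m = l) (q : P ⟶ (W.re m).obj P)
    (hq : q = (W.reId Z).inv.app P ≫ eqToHom (by rw [h])) :
    (W.re l).map q ≫ (W.reComp l m l e).inv.app P = 𝟙 _ := by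
  subst h hq
  have := W.reComp_id_right l P
  rw [eqToHom_refl, Category.comp_id, ← Category.id_comp ((W.re l).map _ ≫ _), ← this,
    Category.assoc, ← Functor.map_comp_assoc, Iso.hom_inv_id_app]
  simp [this]

/-- The data of the identity functor. -/
abbrev idData (A : SmallCat W) : SmallFunctorData A A where
  ob := 𝟙 A.ob
  mor := (W.reId (A.ob ⊗ A.ob)).inv.app A.hom ≫ eqToHom (by simp)

theorem idData_mapAt (A : SmallCat W) {I : E} (x y : I ⟶ A.ob) (hx : x ≫ 𝟙 A.ob = x)
    (hy : y ≫ 𝟙 A.ob = y) : (idData A).mapAt x y hx hy = 𝟙 _ :=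
  mapAt_of_id _ (by simp) _ _ _ _ rfl

theorem idData_mapAt' (A : SmallCat W) {I : E} (x y : I ⟶ A.ob) {x' y' : I ⟶ A.ob}
    (hx : x ≫ 𝟙 A.ob = x') (hy : y ≫ 𝟙 A.ob = y') :
    (idData A).mapAt x y hx hy =
      eqToHom (by rw [← hx, ← hy, Category.comp_id, Category.comp_id]) := by
  obtain rfl : x = x' := by rw [← hx, Category.comp_id]
  obtain rfl : y = y' := by rw [← hy, Category.comp_id]
  exact idData_mapAt A x y hx hy

/-- The identity functor. -/
abbrev id (A : SmallCat W) : SmallFunctor A A where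
  toSmallFunctorData := idData A
  map_comp_generic := by
    have (x y z x' y' z') (hx : x ≫ 𝟙 A.ob = x') (hy : y ≫ 𝟙 A.ob = y')
        (hz : z ≫ 𝟙 A.ob = z') :
        A.compAt x y z ≫ (idData A).mapAt (I := A.ob ⊗ (A.ob ⊗ A.ob)) x z hx hz =
          ((idData A).mapAt y z hy hz ⊗ₘ (idData A).mapAt x y hx hy) ≫ A.compAt x' y' z' := by
      obtain rfl : x = x' := by rw [← hx, Category.comp_id]
      obtain rfl : y = y' := by rw [← hy, Category.comp_id]
      obtain rfl : z = z' := by rw [← hz, Category.comp_id]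
      simp [idData_mapAt]
    exact this _ _ _ _ _ _ rfl rfl rfl
  map_id_generic := by
    rw [idData_mapAt, Category.comp_id]

/-- The data of the composite of two functors. -/
abbrev compData (F : SmallFunctorData A B) (G : SmallFunctorData B C) : SmallFunctorData A C where
  ob := F.ob ≫ G.ob
  mor := F.mor ≫ (W.re (F.ob ⊗ₘ F.ob)).map G.mor ≫
    (W.reComp (F.ob ⊗ₘ F.ob) (G.ob ⊗ₘ G.ob) ((F.ob ≫ G.ob) ⊗ₘ (F.ob ≫ G.ob))
      (by simp)).inv.app C.hom

theorem compData_mapAt (F : SmallFunctorData A B) (G : SmallFunctorData B C) {I : E}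
    (x y : I ⟶ A.ob) {x' y' : I ⟶ B.ob} {x'' y'' : I ⟶ C.ob} (hx : x ≫ F.ob = x')
    (hy : y ≫ F.ob = y') (hx' : x' ≫ G.ob = x'') (hy' : y' ≫ G.ob = y'')
    (hx'' : x ≫ F.ob ≫ G.ob = x'') (hy'' : y ≫ F.ob ≫ G.ob = y'') :
    (compData F G).mapAt x y hx'' hy'' = F.mapAt x y hx hy ≫ G.mapAt x' y' hx' hy' := by
  have key := W.reComp_assoc (lift x y) (F.ob ⊗ₘ F.ob) (G.ob ⊗ₘ G.ob) (lift x' y')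
    ((F.ob ≫ G.ob) ⊗ₘ (F.ob ≫ G.ob)) (lift x'' y'') (by simp [hx, hy]) (by simp)
    (by simp [← hx'', ← hy'']) (by simp [← hx', ← hy']) C.hom
  have nat := (W.reComp (lift x y) (F.ob ⊗ₘ F.ob) (lift x' y')
    (by simp [hx, hy])).inv.naturality G.mor
  simp only [Functor.comp_map] at nat
  simp only [SmallFunctorData.mapAt, Functor.map_comp, Category.assoc]
  congr 1
  rw [← reassoc_of% nat]
  congr 1
  rw [← cancel_mono ((W.reComp (lift x y) ((F.ob ≫ G.ob) ⊗ₘ (F.ob ≫ G.ob)) (lift x'' y'')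
    (by simp [← hx'', ← hy''])).hom.app C.hom ≫
      (W.re (lift x y)).map ((W.reComp (F.ob ⊗ₘ F.ob) (G.ob ⊗ₘ G.ob)
        ((F.ob ≫ G.ob) ⊗ₘ (F.ob ≫ G.ob)) (by simp)).hom.app C.hom))]
  conv_rhs => rw [key]
  simp only [Category.assoc, Iso.inv_hom_id_app_assoc]
  rw [← Functor.map_comp, Iso.inv_hom_id_app]
  simp

/-- Composition of functors, in diagrammatic order. -/
abbrev comp (F : SmallFunctor A B) (G : SmallFunctor B C) : SmallFunctor A C where
  toSmallFunctorData := compData F.toSmallFunctorData G.toSmallFunctorData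
  map_comp_generic := by
    have (x y z x' y' z') (hx : x ≫ F.ob ≫ G.ob = x') (hy : y ≫ F.ob ≫ G.ob = y')
        (hz : z ≫ F.ob ≫ G.ob = z') :
        A.compAt x y z ≫ (compData F.toSmallFunctorData G.toSmallFunctorData).mapAt
            (I := A.ob ⊗ (A.ob ⊗ A.ob)) x z hx hz =
          ((compData F.toSmallFunctorData G.toSmallFunctorData).mapAt y z hy hz ⊗ₘ
            (compData F.toSmallFunctorData G.toSmallFunctorData).mapAt x y hx hy) ≫
              C.compAt x' y' z' := by
      have hx' : (x ≫ F.ob) ≫ G.ob = x' := by rw [← hx, Category.assoc]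
      have hy' : (y ≫ F.ob) ≫ G.ob = y' := by rw [← hy, Category.assoc]
      have hz' : (z ≫ F.ob) ≫ G.ob = z' := by rw [← hz, Category.assoc]
      rw [compData_mapAt _ _ _ _ rfl rfl hx' hz', compData_mapAt _ _ _ _ rfl rfl hy' hz',
        compData_mapAt _ _ _ _ rfl rfl hx' hy', ← Category.assoc,
        F.compAt_mapAt _ _ _ rfl rfl rfl, Category.assoc, G.compAt_mapAt _ _ _ hx' hy' hz',
        tensorHom_comp_tensorHom_assoc]
    exact this _ _ _ _ _ _ rfl rfl rfl
  map_id_generic := by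
    rw [compData_mapAt _ _ _ _ (Category.id_comp _) (Category.id_comp _) rfl rfl,
      ← Category.assoc, F.idAt_mapAt, G.idAt_mapAt]

theorem comp_mapAt (F : SmallFunctor A B) (G : SmallFunctor B C) {I : E}
    (x y : I ⟶ A.ob) {x' y' : I ⟶ B.ob} {x'' y'' : I ⟶ C.ob} (hx : x ≫ F.ob = x')
    (hy : y ≫ F.ob = y') (hx' : x' ≫ G.ob = x'') (hy' : y' ≫ G.ob = y'')
    (hx'' : x ≫ F.ob ≫ G.ob = x'') (hy'' : y ≫ F.ob ≫ G.ob = y'') :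
    (F.comp G).mapAt x y hx'' hy'' = F.mapAt x y hx hy ≫ G.mapAt x' y' hx' hy' :=
  compData_mapAt _ _ _ _ _ _ _ _ _ _

theorem id_comp (F : SmallFunctor A B) : (id A).comp F = F :=
  ext' (Category.id_comp _) fun _ x y _ _ hx hy hx' hy' =>
    (comp_mapAt (id A) F x y (Category.comp_id x) (Category.comp_id y) hx' hy' hx hy).trans
      (by rw [idData_mapAt, Category.id_comp])

theorem comp_id (F : SmallFunctor A B) : F.comp (id B) = F :=
  ext' (Category.comp_id _) fun _ x y _ _ hx hy hx' hy' =>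
    (comp_mapAt F (id B) x y hx' hy' (Category.comp_id _) (Category.comp_id _) hx hy).trans
      (by rw [idData_mapAt, Category.comp_id])

theorem assoc (F : SmallFunctor A B) (G : SmallFunctor B C) (H : SmallFunctor C D) :
    (F.comp G).comp H = F.comp (G.comp H) :=
  ext' (Category.assoc _ _ _) fun _ x y _ _ hx hy hx' hy' => by
    rw [comp_mapAt (F.comp G) H x y (x' := (x ≫ F.ob) ≫ G.ob) (y' := (y ≫ F.ob) ≫ G.ob)
        (Category.assoc _ _ _).symm (Category.assoc _ _ _).symm (by simpa using hx)
        (by simpa using hy),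
      comp_mapAt F G x y rfl rfl rfl rfl,
      comp_mapAt F (G.comp H) x y rfl rfl (by simpa using hx) (by simpa using hy),
      comp_mapAt G H _ _ rfl rfl (by simpa using hx) (by simpa using hy), Category.assoc]

end SmallFunctor

end IndexedEnrichment

namespace IndexedEnrichment


variable {E : Type u} [Category.{v} E] [CartesianMonoidalCategory E]
variable {W : IndexedMonoidalCategory.{w, w'} E}

theorem IndexedMonoidalCategory.pull₀_id (W : IndexedMonoidalCategory.{w, w'} E) {I Z : E}
    {p : I ⟶ Z} (e : 𝟙 I ≫ p = p) {H : W.fib Z} (f : 𝟙_ (W.fib I) ⟶ (W.re p).obj H) :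
    W.pull₀ (𝟙 I) e f = f := by
  have hε := NatTrans.IsMonoidal.unit (τ := (W.reId I).hom)
  simp only [Functor.LaxMonoidal.id_ε] at hε
  have nat := (W.reId I).hom.naturality f
  have key := W.reComp_id_left p H
  rw [← cancel_mono ((W.reComp (𝟙 I) p p e).hom.app H ≫ (W.reId I).hom.app _)]
  simp only [IndexedMonoidalCategory.pull₀, transfer₀, Iso.app_inv, Category.assoc,
    Iso.inv_hom_id_app_assoc, nat]
  rw [reassoc_of% hε, key]
  simp

namespace SmallCat

variable (B : SmallCat W)

/-- The reindexing of a generalized element `𝟙_ ⟶ B(p, q)`. -/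
def elAt {I Z : E} {p q : Z ⟶ B.ob} (f : 𝟙_ (W.fib Z) ⟶ B.H p q) (x : I ⟶ Z) {a b : I ⟶ B.ob}
    (ha : x ≫ p = a) (hb : x ≫ q = b) : 𝟙_ (W.fib I) ⟶ B.H a b :=
  W.pull₀ x (by rw [comp_lift, ha, hb]) f

/-- Composition of generalized elements. -/
abbrev vc {I : E} {p q r : I ⟶ B.ob} (f : 𝟙_ (W.fib I) ⟶ B.H p q)
    (g : 𝟙_ (W.fib I) ⟶ B.H q r) : 𝟙_ (W.fib I) ⟶ B.H p r :=
  (SmallCat.ctx.{0} B I).vcomp (x := ⟨p⟩) (y := ⟨q⟩) (z := ⟨r⟩) f g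

/-- The identity, transported along an equality of generalized objects. -/
abbrev eqEl {I : E} {p q : I ⟶ B.ob} (h : p = q) : 𝟙_ (W.fib I) ⟶ B.H p q :=
  (SmallCat.ctx.{0} B I).ofEq (x := ⟨p⟩) (y := ⟨q⟩) (congrArg _ h)

theorem eqEl_rfl {I : E} {p : I ⟶ B.ob} (h : p = p) : B.eqEl h = B.idAt p := rfl

theorem vc_assoc {I : E} {p q r s : I ⟶ B.ob} (f : 𝟙_ (W.fib I) ⟶ B.H p q)
    (g : 𝟙_ (W.fib I) ⟶ B.H q r) (h : 𝟙_ (W.fib I) ⟶ B.H r s) :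
    B.vc (B.vc f g) h = B.vc f (B.vc g h) :=
  VCat.vcomp_assoc (SmallCat.ctx.{0} B I) (x := ⟨p⟩) (y := ⟨q⟩) (z := ⟨r⟩) (w := ⟨s⟩) f g h

theorem idAt_vc {I : E} {p q : I ⟶ B.ob} (f : 𝟙_ (W.fib I) ⟶ B.H p q) : B.vc (B.idAt p) f = f :=
  VCat.id_vcomp (SmallCat.ctx.{0} B I) (x := ⟨p⟩) (y := ⟨q⟩) f

theorem vc_idAt {I : E} {p q : I ⟶ B.ob} (f : 𝟙_ (W.fib I) ⟶ B.H p q) : B.vc f (B.idAt q) = f :=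
  VCat.vcomp_id (SmallCat.ctx.{0} B I) (x := ⟨p⟩) (y := ⟨q⟩) f

theorem elAt_elAt {J I Z : E} {p q : Z ⟶ B.ob} (f : 𝟙_ (W.fib Z) ⟶ B.H p q) (x : I ⟶ Z)
    {a b : I ⟶ B.ob} (ha : x ≫ p = a) (hb : x ≫ q = b) (y : J ⟶ I) {a' b' : J ⟶ B.ob}
    (ha' : y ≫ a = a') (hb' : y ≫ b = b') :
    B.elAt (B.elAt f x ha hb) y ha' hb' =
      B.elAt f (y ≫ x) (by rw [Category.assoc, ha, ha']) (by rw [Category.assoc, hb, hb']) :=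
  W.pull₀_pull₀ _ _ _ _ _

theorem elAt_id {Z : E} {p q : Z ⟶ B.ob} (f : 𝟙_ (W.fib Z) ⟶ B.H p q) (h : 𝟙 Z ≫ p = p)
    (h' : 𝟙 Z ≫ q = q) : B.elAt f (𝟙 Z) h h' = f :=
  W.pull₀_id _ _

theorem elAt_idAt {I Z : E} {p : Z ⟶ B.ob} (x : I ⟶ Z) {a : I ⟶ B.ob} (h : x ≫ p = a) :
    B.elAt (B.idAt p) x h h = B.idAt a :=
  B.idAt_pull x h

theorem elAt_eqEl {I Z : E} {p q : Z ⟶ B.ob} (e : p = q) (x : I ⟶ Z) {a b : I ⟶ B.ob}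
    (h : x ≫ p = a) (h' : x ≫ q = b) :
    B.elAt (B.eqEl e) x h h' = B.eqEl (by rw [← h, ← h', e]) := by
  subst e h h'
  exact B.elAt_idAt x rfl

theorem elAt_vc {I Z : E} {p q r : Z ⟶ B.ob} (f : 𝟙_ (W.fib Z) ⟶ B.H p q)
    (g : 𝟙_ (W.fib Z) ⟶ B.H q r) (x : I ⟶ Z) {a b c : I ⟶ B.ob} (ha : x ≫ p = a)
    (hb : x ≫ q = b) (hc : x ≫ r = c) :
    B.elAt (B.vc f g) x ha hc = B.vc (B.elAt f x ha hb) (B.elAt g x hb hc) := by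
  simp only [vc, VCat.vcomp, elAt]
  rw [← B.compAt_pull x ha hb hc]
  exact transfer_vcomp _ _ _ _ _ _ _

theorem elAt_cast {I Z : E} {p q : Z ⟶ B.ob} (f : 𝟙_ (W.fib Z) ⟶ B.H p q) (x : I ⟶ Z)
    {a b a' b' : I ⟶ B.ob} (ha : x ≫ p = a) (hb : x ≫ q = b) (ha' : x ≫ p = a')
    (hb' : x ≫ q = b') (e : a = a') (e' : b' = b) :
    B.elAt f x ha hb = B.vc (B.eqEl e) (B.vc (B.elAt f x ha' hb') (B.eqEl e')) := by
  subst e e'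
  rw [eqEl_rfl, eqEl_rfl, idAt_vc, vc_idAt]

end SmallCat

theorem SmallFunctor.elAt_mapAt {A B : SmallCat W} (F : SmallFunctor A B) {I Z : E}
    {p q : Z ⟶ A.ob} (f : 𝟙_ (W.fib Z) ⟶ A.H p q) (x : I ⟶ Z) {a b : I ⟶ A.ob} (ha : x ≫ p = a)
    (hb : x ≫ q = b) {p' q' : Z ⟶ B.ob} (hp : p ≫ F.ob = p') (hq : q ≫ F.ob = q')
    {a' b' : I ⟶ B.ob} (ha' : a ≫ F.ob = a') (hb' : b ≫ F.ob = b') :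
    A.elAt f x ha hb ≫ F.mapAt a b ha' hb' =
      B.elAt (f ≫ F.mapAt p q hp hq) x (by rw [← hp, ← ha', ← ha, Category.assoc])
        (by rw [← hq, ← hb', ← hb, Category.assoc]) := by
  rw [← F.mapAt_pull x hp hq ha hb (by rw [← hp, ← ha', ← ha, Category.assoc])
    (by rw [← hq, ← hb', ← hb, Category.assoc])]
  exact (transfer₀_comp_map _ _ _ _ _).symm

theorem SmallFunctor.vc_mapAt {A B : SmallCat W} (F : SmallFunctor A B) {I : E}
    {p q r : I ⟶ A.ob} (f : 𝟙_ (W.fib I) ⟶ A.H p q) (g : 𝟙_ (W.fib I) ⟶ A.H q r)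
    {p' q' r' : I ⟶ B.ob} (hp : p ≫ F.ob = p') (hq : q ≫ F.ob = q') (hr : r ≫ F.ob = r') :
    A.vc f g ≫ F.mapAt p r hp hr = B.vc (f ≫ F.mapAt p q hp hq) (g ≫ F.mapAt q r hq hr) := by
  subst hp hq hr
  exact (SmallFunctor.ctx.{0} F I).map_vcomp (x := ⟨p⟩) (y := ⟨q⟩) (z := ⟨r⟩) f g

theorem SmallFunctor.mapAt_cast {A B : SmallCat W} (F : SmallFunctor A B) {I : E}
    {p q : I ⟶ A.ob} (f : 𝟙_ (W.fib I) ⟶ A.H p q) {a b a' b' : I ⟶ B.ob} (ha : p ≫ F.ob = a)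
    (hb : q ≫ F.ob = b) (ha' : p ≫ F.ob = a') (hb' : q ≫ F.ob = b') (e : a = a') (e' : b' = b) :
    f ≫ F.mapAt p q ha hb = B.vc (B.eqEl e) (B.vc (f ≫ F.mapAt p q ha' hb') (B.eqEl e')) := by
  subst e e'
  rw [B.eqEl_rfl, B.eqEl_rfl, B.idAt_vc, B.vc_idAt]

/-- A natural transformation of functors of small `W`-categories: a morphism `hom` of `W` over
`A.ob`, with a naturality square over the square of `A.ob`. -/
@[ext]
structure SmallNat {A B : SmallCat W} (F G : SmallFunctor A B) where
  hom : 𝟙_ (W.fib A.ob) ⟶ B.H F.ob G.ob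
  naturality_generic :
    (λ_ (A.H (fst A.ob A.ob) (snd A.ob A.ob))).inv ≫
        (B.elAt hom (snd A.ob A.ob) rfl rfl ⊗ₘ
          F.mapAt (fst A.ob A.ob) (snd A.ob A.ob) rfl rfl) ≫
        B.compAt (fst A.ob A.ob ≫ F.ob) (snd A.ob A.ob ≫ F.ob) (snd A.ob A.ob ≫ G.ob) =
      (ρ_ (A.H (fst A.ob A.ob) (snd A.ob A.ob))).inv ≫
        (G.mapAt (fst A.ob A.ob) (snd A.ob A.ob) rfl rfl ⊗ₘ
          B.elAt hom (fst A.ob A.ob) rfl rfl) ≫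
        B.compAt (fst A.ob A.ob ≫ F.ob) (fst A.ob A.ob ≫ G.ob) (snd A.ob A.ob ≫ G.ob)

namespace SmallNat

variable {A B C D : SmallCat W}

theorem naturalityAt {F G : SmallFunctor A B} (α : SmallNat F G) {I : E} (x y : I ⟶ A.ob)
    {a b a' b' : I ⟶ B.ob} (ha : x ≫ F.ob = a) (hb : y ≫ F.ob = b) (ha' : x ≫ G.ob = a')
    (hb' : y ≫ G.ob = b') :
    (λ_ (A.H x y)).inv ≫ (B.elAt α.hom y hb hb' ⊗ₘ F.mapAt x y ha hb) ≫ B.compAt a b b' =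
      (ρ_ (A.H x y)).inv ≫ (G.mapAt x y ha' hb' ⊗ₘ B.elAt α.hom x ha ha') ≫
        B.compAt a a' b' := by
  have e₀ : lift x y ≫ fst _ _ = x := by simp
  have e₁ : lift x y ≫ snd _ _ = y := by simp
  have ea : lift x y ≫ fst _ _ ≫ F.ob = a := by simp [ha]
  have eb : lift x y ≫ snd _ _ ≫ F.ob = b := by simp [hb]
  have ea' : lift x y ≫ fst _ _ ≫ G.ob = a' := by simp [ha']
  have eb' : lift x y ≫ snd _ _ ≫ G.ob = b' := by simp [hb']
  have h₀ : B.elAt α.hom x ha ha' =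
      B.elAt (B.elAt α.hom (fst A.ob A.ob) rfl rfl) (lift x y) ea ea' := by
    rw [B.elAt_elAt]; simp only [e₀]
  have h₁ : B.elAt α.hom y hb hb' =
      B.elAt (B.elAt α.hom (snd A.ob A.ob) rfl rfl) (lift x y) eb eb' := by
    rw [B.elAt_elAt]; simp only [e₁]
  rw [h₀, h₁, ← B.compAt_pull (lift x y) ea eb eb', ← B.compAt_pull (lift x y) ea ea' eb',
    ← F.mapAt_pull (lift x y) rfl rfl e₀ e₁ ea eb, ← G.mapAt_pull (lift x y) rfl rfl e₀ e₁ ea' eb']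
  exact transfer_naturality _ _ _ _ _ _ _ _ _ _ _ _ _ α.naturality_generic

/-- The natural transformation of enriched functors on generalized objects. -/
abbrev ctx {F G : SmallFunctor A B} (α : SmallNat F G) (I : E) :
    VNat (SmallFunctor.ctx.{t} F I) (SmallFunctor.ctx.{t} G I) where
  app x := B.elAt α.hom x.down rfl rfl
  naturality x y := α.naturalityAt x.down y.down rfl rfl rfl rfl

/-- A morphism satisfying the naturality condition at every context gives a transformation. -/
theorem generic_of_ctx {F G : SmallFunctor A B} {f : 𝟙_ (W.fib A.ob) ⟶ B.H F.ob G.ob}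
    (α : VNat (SmallFunctor.ctx.{0} F (A.ob ⊗ A.ob)) (SmallFunctor.ctx.{0} G (A.ob ⊗ A.ob)))
    (h : ∀ x, α.app x = B.elAt f x.down rfl rfl) :
    (λ_ (A.H (fst A.ob A.ob) (snd A.ob A.ob))).inv ≫
        (B.elAt f (snd A.ob A.ob) rfl rfl ⊗ₘ
          F.mapAt (fst A.ob A.ob) (snd A.ob A.ob) rfl rfl) ≫
        B.compAt (fst A.ob A.ob ≫ F.ob) (snd A.ob A.ob ≫ F.ob) (snd A.ob A.ob ≫ G.ob) =
      (ρ_ (A.H (fst A.ob A.ob) (snd A.ob A.ob))).inv ≫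
        (G.mapAt (fst A.ob A.ob) (snd A.ob A.ob) rfl rfl ⊗ₘ
          B.elAt f (fst A.ob A.ob) rfl rfl) ≫
        B.compAt (fst A.ob A.ob ≫ F.ob) (fst A.ob A.ob ≫ G.ob) (snd A.ob A.ob ≫ G.ob) := by
  have := α.naturality ⟨fst A.ob A.ob⟩ ⟨snd A.ob A.ob⟩
  rw [h, h] at this
  exact this

/-- The identity transformation. -/
abbrev id (F : SmallFunctor A B) : SmallNat F F where
  hom := B.idAt F.ob
  naturality_generic := generic_of_ctx (VNat.id _) fun x => (B.elAt_idAt x.down rfl).symm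

/-- Vertical composition. -/
abbrev vcomp {F G H : SmallFunctor A B} (α : SmallNat F G) (β : SmallNat G H) : SmallNat F H where
  hom := B.vc α.hom β.hom
  naturality_generic := generic_of_ctx (VNat.vcomp (α.ctx _) (β.ctx _)) fun x =>
    (B.elAt_vc α.hom β.hom x.down rfl rfl rfl).symm

instance : Category (SmallFunctor A B) where
  Hom F G := SmallNat F G
  id F := SmallNat.id F
  comp α β := SmallNat.vcomp α β
  id_comp _ := SmallNat.ext (B.idAt_vc _)
  comp_id _ := SmallNat.ext (B.vc_idAt _)
  assoc _ _ _ := SmallNat.ext (B.vc_assoc _ _ _)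

theorem comp_hom {F G H : SmallFunctor A B} (α : F ⟶ G) (β : G ⟶ H) :
    (α ≫ β).hom = B.vc α.hom β.hom := rfl

theorem id_hom (F : SmallFunctor A B) : SmallNat.hom (𝟙 F) = B.idAt F.ob := rfl

theorem eqToHom_hom {F G : SmallFunctor A B} (h : F = G) :
    SmallNat.hom (eqToHom h) = B.eqEl (by rw [h]) := by
  subst h; rfl

/-- Whiskering with a functor on the source side. -/
abbrev whiskerLeft (L : SmallFunctor A B) {F G : SmallFunctor B C} (α : SmallNat F G) :
    SmallNat (L.comp F) (L.comp G) where
  hom := C.elAt α.hom L.ob rfl rfl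
  naturality_generic := by
    have (x y : A.ob ⊗ A.ob ⟶ A.ob) {a b a' b' : A.ob ⊗ A.ob ⟶ C.ob}
        (ha : x ≫ L.ob ≫ F.ob = a) (hb : y ≫ L.ob ≫ F.ob = b) (ha' : x ≫ L.ob ≫ G.ob = a')
        (hb' : y ≫ L.ob ≫ G.ob = b') :
        (λ_ (A.H x y)).inv ≫ (C.elAt (C.elAt α.hom L.ob rfl rfl) y hb hb' ⊗ₘ
            (L.comp F).mapAt x y ha hb) ≫ C.compAt a b b' =
          (ρ_ (A.H x y)).inv ≫ ((L.comp G).mapAt x y ha' hb' ⊗ₘ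
            C.elAt (C.elAt α.hom L.ob rfl rfl) x ha ha') ≫ C.compAt a a' b' := by
      have ea : (x ≫ L.ob) ≫ F.ob = a := by rw [← ha, Category.assoc]
      have eb : (y ≫ L.ob) ≫ F.ob = b := by rw [← hb, Category.assoc]
      have ea' : (x ≫ L.ob) ≫ G.ob = a' := by rw [← ha', Category.assoc]
      have eb' : (y ≫ L.ob) ≫ G.ob = b' := by rw [← hb', Category.assoc]
      have := α.naturalityAt (x ≫ L.ob) (y ≫ L.ob) ea eb ea' eb'
      rw [SmallFunctor.comp_mapAt L F x y rfl rfl ea eb ha hb,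
        SmallFunctor.comp_mapAt L G x y rfl rfl ea' eb' ha' hb', C.elAt_elAt, C.elAt_elAt]
      have e₁ : ∀ {P Q : W.fib (A.ob ⊗ A.ob)} (m : A.H x y ⟶ P) (n : P ⟶ Q) {R}
          (k : 𝟙_ _ ⟶ R), (k ⊗ₘ (m ≫ n)) = 𝟙_ _ ◁ m ≫ (k ⊗ₘ n) := by
        intro P Q m n R k
        rw [← id_tensorHom, tensorHom_comp_tensorHom, Category.id_comp]
      have e₂ : ∀ {P Q : W.fib (A.ob ⊗ A.ob)} (m : A.H x y ⟶ P) (n : P ⟶ Q) {R}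
          (k : 𝟙_ _ ⟶ R), ((m ≫ n) ⊗ₘ k) = m ▷ 𝟙_ _ ≫ (n ⊗ₘ k) := by
        intro P Q m n R k
        rw [← tensorHom_id, tensorHom_comp_tensorHom, Category.id_comp]
      rw [e₁, e₂, Category.assoc (𝟙_ (W.fib (A.ob ⊗ A.ob)) ◁ _),
        Category.assoc (_ ▷ 𝟙_ (W.fib (A.ob ⊗ A.ob))), ← leftUnitor_inv_naturality_assoc,
        ← rightUnitor_inv_naturality_assoc, this]
    exact this _ _ rfl rfl rfl rfl

/-- Whiskering with a functor on the target side. -/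
abbrev whiskerRight {F G : SmallFunctor A B} (α : SmallNat F G) (R : SmallFunctor B C) :
    SmallNat (F.comp R) (G.comp R) where
  hom := α.hom ≫ R.mapAt F.ob G.ob rfl rfl
  naturality_generic := by
    have (x y : A.ob ⊗ A.ob ⟶ A.ob) {a b a' b' : A.ob ⊗ A.ob ⟶ C.ob}
        (ha : x ≫ F.ob ≫ R.ob = a) (hb : y ≫ F.ob ≫ R.ob = b) (ha' : x ≫ G.ob ≫ R.ob = a')
        (hb' : y ≫ G.ob ≫ R.ob = b') :
        (λ_ (A.H x y)).inv ≫ (C.elAt (α.hom ≫ R.mapAt F.ob G.ob rfl rfl) y hb hb' ⊗ₘ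
            (F.comp R).mapAt x y ha hb) ≫ C.compAt a b b' =
          (ρ_ (A.H x y)).inv ≫ ((G.comp R).mapAt x y ha' hb' ⊗ₘ
            C.elAt (α.hom ≫ R.mapAt F.ob G.ob rfl rfl) x ha ha') ≫ C.compAt a a' b' := by
      have ea : (x ≫ F.ob) ≫ R.ob = a := by rw [← ha, Category.assoc]
      have eb : (y ≫ F.ob) ≫ R.ob = b := by rw [← hb, Category.assoc]
      have ea' : (x ≫ G.ob) ≫ R.ob = a' := by rw [← ha', Category.assoc]
      have eb' : (y ≫ G.ob) ≫ R.ob = b' := by rw [← hb', Category.assoc]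
      have := α.naturalityAt x y rfl rfl rfl rfl
      rw [SmallFunctor.comp_mapAt F R x y rfl rfl ea eb ha hb,
        SmallFunctor.comp_mapAt G R x y rfl rfl ea' eb' ha' hb',
        ← R.elAt_mapAt α.hom y rfl rfl rfl rfl eb eb',
        ← R.elAt_mapAt α.hom x rfl rfl rfl rfl ea ea', ← tensorHom_comp_tensorHom_assoc,
        ← tensorHom_comp_tensorHom_assoc, ← R.compAt_mapAt _ _ _ ea eb eb',
        ← R.compAt_mapAt _ _ _ ea ea' eb', reassoc_of% this]
    exact this _ _ rfl rfl rfl rfl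

theorem eq_conj {F F' G G' : SmallFunctor A B} (h : F = F') (h' : G' = G) (α : F ⟶ G)
    (β : F' ⟶ G') (hF : F.ob = F'.ob) (hG : G'.ob = G.ob)
    (e : α.hom = B.vc (B.eqEl hF) (B.vc β.hom (B.eqEl hG))) :
    α = eqToHom h ≫ β ≫ eqToHom h' := by
  apply SmallNat.ext
  rw [e, comp_hom, comp_hom, eqToHom_hom, eqToHom_hom]

theorem whiskerLeft_eqToHom (F : SmallFunctor A B) {G H : SmallFunctor B C} (h : G = H) :
    whiskerLeft F (eqToHom h) = eqToHom (congrArg (SmallFunctor.comp F) h) := by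
  subst h
  exact SmallNat.ext (C.elAt_idAt F.ob rfl)

theorem whiskerRight_eqToHom {F G : SmallFunctor A B} (h : F = G) (H : SmallFunctor B C) :
    whiskerRight (eqToHom h) H = eqToHom (congrArg (fun F => SmallFunctor.comp F H) h) := by
  subst h
  exact SmallNat.ext (H.idAt_mapAt F.ob rfl)

theorem pentagon {L : SmallCat W} (F : SmallFunctor A B) (G : SmallFunctor B C)
    (H : SmallFunctor C D) (I : SmallFunctor D L) :
    (show ((F.comp G).comp H).comp I ⟶ F.comp (G.comp (H.comp I)) from
      whiskerRight (eqToHom (SmallFunctor.assoc F G H)) I ≫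
        eqToHom (SmallFunctor.assoc F (G.comp H) I) ≫
          whiskerLeft F (eqToHom (SmallFunctor.assoc G H I))) =
      eqToHom (SmallFunctor.assoc (F.comp G) H I) ≫
        eqToHom (SmallFunctor.assoc F G (H.comp I)) := by
  rw [whiskerRight_eqToHom, whiskerLeft_eqToHom]
  simp

theorem triangle (F : SmallFunctor A B) (G : SmallFunctor B C) :
    (show (F.comp (SmallFunctor.id B)).comp G ⟶ F.comp G from
      eqToHom (SmallFunctor.assoc F (SmallFunctor.id B) G) ≫
        whiskerLeft F (eqToHom (SmallFunctor.id_comp G))) =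
      whiskerRight (eqToHom (SmallFunctor.comp_id F)) G := by
  rw [whiskerRight_eqToHom, whiskerLeft_eqToHom]
  simp

end SmallNat

/-- Small `W`-categories, their functors and the natural transformations between them form a
2-category. -/
instance : Bicategory (SmallCat W) where
  Hom A B := SmallFunctor A B
  id A := SmallFunctor.id A
  comp F G := F.comp G
  homCategory A B := inferInstanceAs (Category (SmallFunctor A B))
  whiskerLeft F _ _ α := SmallNat.whiskerLeft F α
  whiskerRight α G := SmallNat.whiskerRight α G
  associator F G H := eqToIso (SmallFunctor.assoc F G H)
  leftUnitor F := eqToIso (SmallFunctor.id_comp F)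
  rightUnitor F := eqToIso (SmallFunctor.comp_id F)
  whiskerLeft_id {_ _ C} F _ := SmallNat.ext (C.elAt_idAt F.ob rfl)
  whiskerLeft_comp {_ _ C} F _ _ _ α β :=
    SmallNat.ext (C.elAt_vc (SmallNat.hom α) (SmallNat.hom β) F.ob rfl rfl rfl)
  id_whiskerLeft {A B F G} α :=
    SmallNat.eq_conj (SmallFunctor.id_comp F) (SmallFunctor.id_comp G).symm _ _
      (Category.id_comp _) (Category.id_comp _).symm
      ((B.elAt_cast (SmallNat.hom α) (𝟙 A.ob) rfl rfl (Category.id_comp _) (Category.id_comp _)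
        (Category.id_comp _) (Category.id_comp _).symm).trans (by rw [B.elAt_id]))
  comp_whiskerLeft {A B C D} F G H H' α :=
    SmallNat.eq_conj (SmallFunctor.assoc F G H) (SmallFunctor.assoc F G H').symm _ _
      (Category.assoc _ _ _) (Category.assoc _ _ _).symm
      ((D.elAt_cast (SmallNat.hom α) (F.ob ≫ G.ob) rfl rfl (Category.assoc _ _ _)
        (Category.assoc _ _ _) (Category.assoc _ _ _) (Category.assoc _ _ _).symm).trans
        (by rw [← D.elAt_elAt (SmallNat.hom α) G.ob rfl rfl F.ob rfl rfl]))
  id_whiskerRight F G := SmallNat.ext (G.idAt_mapAt F.ob rfl)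
  comp_whiskerRight α β G :=
    SmallNat.ext (G.vc_mapAt (SmallNat.hom α) (SmallNat.hom β) rfl rfl rfl)
  whiskerRight_id {A B F G} α :=
    SmallNat.eq_conj (SmallFunctor.comp_id F) (SmallFunctor.comp_id G).symm _ _
      (Category.comp_id _) (Category.comp_id _).symm
      (((SmallFunctor.id B).mapAt_cast (SmallNat.hom α) rfl rfl (Category.comp_id _)
        (Category.comp_id _) (Category.comp_id _) (Category.comp_id _).symm).trans
          (by rw [SmallFunctor.idData_mapAt, Category.comp_id (SmallNat.hom α)]))
  whiskerRight_comp {A B C D F F'} α G H :=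
    SmallNat.eq_conj (SmallFunctor.assoc F G H).symm (SmallFunctor.assoc F' G H) _ _
      (Category.assoc _ _ _).symm (Category.assoc _ _ _)
      (((G.comp H).mapAt_cast (SmallNat.hom α) rfl rfl (Category.assoc _ _ _).symm
        (Category.assoc _ _ _).symm (Category.assoc _ _ _).symm (Category.assoc _ _ _)).trans
          (by rw [SmallFunctor.comp_mapAt G H F.ob F'.ob rfl rfl rfl rfl,
            ← Category.assoc (SmallNat.hom α)]))
  whisker_assoc {A B C D} F H H' α G :=
    SmallNat.eq_conj (SmallFunctor.assoc F H G) (SmallFunctor.assoc F H' G).symm _ _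
      (Category.assoc _ _ _) (Category.assoc _ _ _).symm
      ((G.mapAt_cast (C.elAt (SmallNat.hom α) F.ob rfl rfl) rfl rfl (Category.assoc _ _ _)
        (Category.assoc _ _ _) (Category.assoc _ _ _) (Category.assoc _ _ _).symm).trans
          (by rw [G.elAt_mapAt (SmallNat.hom α) F.ob rfl rfl rfl rfl]))
  whisker_exchange {A B C F G H K} α β := SmallNat.ext
    ((SmallNat.ctx.{0} β A.ob).nat_pt (x := ⟨F.ob⟩) (y := ⟨G.ob⟩) (SmallNat.hom α)).symm
  pentagon F G H K := SmallNat.pentagon F G H K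
  triangle F G := SmallNat.triangle F G

instance : Bicategory.Strict (SmallCat W) where
  id_comp {A B} F := @SmallFunctor.id_comp E _ _ W A B F
  comp_id {A B} F := @SmallFunctor.comp_id E _ _ W A B F
  assoc {A B C D} F G H := @SmallFunctor.assoc E _ _ W A B C D F G H
  leftUnitor_eqToIso _ := rfl
  rightUnitor_eqToIso _ := rfl
  associator_eqToIso _ _ _ := rfl

end IndexedEnrichment

namespace IndexedEnrichment


variable {E : Type u} [Category.{v} E] [CartesianMonoidalCategory E]
variable {W : IndexedMonoidalCategory.{w, w'} E}

/-! ### The inclusion of small enriched categories into indexed enriched categories -/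

theorem IndexedMonoidalCategory.reComp_inv_eqToHom {X Y Z : E} (f : X ⟶ Y) (g : Y ⟶ Z)
    {k k' : X ⟶ Z} (e : f ≫ g = k) (e' : f ≫ g = k') (H : W.fib Z)
    (h : (W.re k).obj H = (W.re k').obj H) :
    (W.reComp f g k e).inv.app H ≫ eqToHom h = (W.reComp f g k' e').inv.app H := by
  subst e e'
  simp

theorem IndexedMonoidalCategory.reComp_inv_assoc {X Y Z T : E} (f : X ⟶ Y) (g : Y ⟶ Z)
    (h : Z ⟶ T) (fg : X ⟶ Z) (gh : Y ⟶ T)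
    (k : X ⟶ T) (e₁ : f ≫ g = fg) (e₂ : g ≫ h = gh) (e₃ : f ≫ gh = k) (e₄ : fg ≫ h = k)
    (A : W.fib T) :
    (W.reComp fg h k e₄).inv.app A =
      (W.reComp f g fg e₁).hom.app ((W.re h).obj A) ≫
        (W.re f).map ((W.reComp g h gh e₂).inv.app A) ≫ (W.reComp f gh k e₃).inv.app A := by
  have key := W.reComp_assoc f g h fg gh k e₁ e₂ e₃ e₄ A
  rw [← cancel_epi ((W.reComp fg h k e₄).hom.app A), Iso.hom_inv_id_app, ← reassoc_of% key,
    ← Functor.map_comp_assoc]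
  simp

namespace SmallCat

variable (A : SmallCat W)

/-- Reindexing of generalized objects by precomposition. -/
abbrev ctxRe {X Y : E} (f : X ⟶ Y) :
    VFunctor ((SmallCat.ctx.{t} A Y).bc (W.re f)) (SmallCat.ctx.{t} A X) where
  obj x := ⟨f ≫ x.down⟩
  map x y := (W.reComp f (lift x.down y.down) (lift (f ≫ x.down) (f ≫ y.down))
    (comp_lift _ _ _)).inv.app A.hom
  map_comp x y z := by
    simp only
    rw [← A.compAt_pull f rfl rfl rfl]
    simp only [IndexedMonoidalCategory.pull₂, transfer₂, tensorHom_comp_tensorHom_assoc,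
      Iso.app_hom, Iso.app_inv, Iso.inv_hom_id_app, Category.assoc]
    simp
  map_id x := by
    simp only
    rw [← A.idAt_pull f rfl]
    simp only [IndexedMonoidalCategory.pull₀, transfer₀, Iso.app_inv, Category.assoc]

theorem ctxRe_comp {X Y Z : E} (f : X ⟶ Y) (g : Y ⟶ Z) (k : X ⟶ Z) (e : f ≫ g = k) :
    A.ctxRe k = ((SmallCat.ctx.{t} A Z).bcComp (W.reComp f g k e).hom).comp
      (((A.ctxRe g).bc (W.re f)).comp (A.ctxRe f)) := by
  refine VFunctor.ext' (fun x => ?_) fun x y => ?_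
  · simp [← e]
  · refine (W.reComp_inv_eqToHom _ _ _ ?_ _ _).trans
      (W.reComp_inv_assoc f g _ k _ _ e (comp_lift _ _ _) (comp_lift _ _ _) ?_ _)
    · simp [← e]
    · simp [← e]

theorem ctxRe_id (X : E) : A.ctxRe (𝟙 X) = (SmallCat.ctx.{t} A X).bcId (W.reId X).hom := by
  refine VFunctor.ext' (fun x => ?_) fun x y => ?_
  · simp
  · refine (W.reComp_inv_eqToHom _ _ _ (Category.id_comp _) _ _).trans ?_
    rw [← cancel_epi ((W.reComp (𝟙 X) (lift x.down y.down) _ (Category.id_comp _)).hom.app A.hom),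
      Iso.hom_inv_id_app]
    exact (W.reComp_id_left _ _).symm

theorem ctxRe_ofEq {X Y : E} (f : X ⟶ Y) {x y : (SmallCat.ctx.{t} A Y).Ob} (h : x = y) :
    (SmallCat.ctx.{t} A Y).bcPt (W.re f) ((SmallCat.ctx.{t} A Y).ofEq h) ≫ (A.ctxRe f).map x y =
      (SmallCat.ctx.{t} A X).ofEq (congrArg (A.ctxRe f).obj h) := by
  subst h
  exact (A.ctxRe f).map_id x

/-- The indexed `W`-category of a small `W`-category: the objects of the fibre over `X` are the
morphisms `X ⟶ A.ob`. -/
abbrev toIndexed : IndexedCat.{max t v} W where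
  fib X := SmallCat.ctx.{t} A X
  re f := A.ctxRe f
  re_ff f x y := by
    simp only
    infer_instance
  reComp f g k e := eqToIso (A.ctxRe_comp f g k e)
  reId X := eqToIso (A.ctxRe_id X)
  reComp_assoc f g h fg gh k e₁ e₂ e₃ e₄ x := by
    simp only [eqToIso.hom, VNat.eqToHom_app]
    rw [A.ctxRe_ofEq, VCat.ofEq_vcomp_ofEq, VCat.ofEq_vcomp_ofEq]
  reComp_id_left f x := by
    simp only [eqToIso.hom, VNat.eqToHom_app]
    rw [VCat.ofEq_vcomp_ofEq, VCat.ofEq_rfl]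
  reComp_id_right f x := by
    simp only [eqToIso.hom, VNat.eqToHom_app]
    rw [A.ctxRe_ofEq, VCat.ofEq_vcomp_ofEq, VCat.ofEq_rfl]

end SmallCat

namespace SmallFunctor

variable {A B : SmallCat W} (F : SmallFunctor A B)

theorem mapAt_eqToHom {I : E} (x y : I ⟶ A.ob) {a b a' b' : I ⟶ B.ob} (ha : x ≫ F.ob = a)
    (hb : y ≫ F.ob = b) (ha' : x ≫ F.ob = a') (hb' : y ≫ F.ob = b') (h : B.H a b = B.H a' b') :
    F.mapAt x y ha hb ≫ eqToHom h = F.mapAt x y ha' hb' := by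
  subst ha hb ha' hb'
  simp

theorem ctx_re {X Y : E} (f : X ⟶ Y) :
    (SmallCat.ctxRe.{t} A f).comp (F.ctx X) = ((F.ctx Y).bc (W.re f)).comp (B.ctxRe f) := by
  refine VFunctor.ext' (fun x => ?_) fun x y => ?_
  · simp
  · simp only [Category.assoc]
    rw [F.mapAt_eqToHom _ _ _ _ (Category.assoc _ _ _) (Category.assoc _ _ _),
      ← F.mapAt_pull f rfl rfl rfl rfl rfl rfl]
    simp only [IndexedMonoidalCategory.pull₁, transfer₁, Iso.app_hom, Iso.app_inv,
      Iso.inv_hom_id_app_assoc]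

/-- The indexed functor of a functor of small `W`-categories. -/
abbrev toIndexed : IndexedFunctor (SmallCat.toIndexed.{t} A) (SmallCat.toIndexed.{t} B) where
  fn X := F.ctx X
  reIso f := eqToIso (F.ctx_re f)
  reIso_comp f g k e z := by
    simp only [eqToIso.hom, VNat.eqToHom_app]
    rw [IndexedCat.rePt_ofEq, (F.ctx _).ofEq_map]
    erw [VCat.ofEq_vcomp_ofEq, VCat.ofEq_vcomp_ofEq, VCat.ofEq_vcomp_ofEq]
  reIso_id X x := by
    simp only [eqToIso.hom, VNat.eqToHom_app]
    rw [(F.ctx _).ofEq_map]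
    erw [VCat.ofEq_vcomp_ofEq]

end SmallFunctor

namespace SmallNat

variable {A B : SmallCat W} {F G : SmallFunctor A B} (α : SmallNat F G)

theorem elAt_comm {I Z : E} {p q : Z ⟶ B.ob} (f : 𝟙_ (W.fib Z) ⟶ B.H p q) (x : I ⟶ Z)
    {a b a' b' : I ⟶ B.ob} (ha : x ≫ p = a) (hb : x ≫ q = b) (ha' : x ≫ p = a')
    (hb' : x ≫ q = b')
    (e : (⟨a'⟩ : (SmallCat.ctx.{t} B I).Ob) = ⟨a⟩) (e' : (⟨b'⟩ : (SmallCat.ctx.{t} B I).Ob) = ⟨b⟩) :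
    (SmallCat.ctx.{t} B I).vcomp (x := ⟨a'⟩) (y := ⟨a⟩) (z := ⟨b⟩)
        ((SmallCat.ctx.{t} B I).ofEq e) (B.elAt f x ha hb) =
      (SmallCat.ctx.{t} B I).vcomp (x := ⟨a'⟩) (y := ⟨b'⟩) (z := ⟨b⟩) (B.elAt f x ha' hb')
        ((SmallCat.ctx.{t} B I).ofEq e') := by
  subst ha hb ha' hb'
  rw [VCat.ofEq_rfl, VCat.ofEq_rfl, VCat.vcomp_id, VCat.id_vcomp]

/-- The indexed natural transformation of a transformation of functors of small
`W`-categories. -/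
abbrev toIndexed : IndexedNat (SmallFunctor.toIndexed.{t} F) (SmallFunctor.toIndexed.{t} G) where
  app X := α.ctx X
  naturality {X Y} f y := by
    simp only [eqToIso.hom, VNat.eqToHom_app]
    have : IndexedCat.rePt (SmallCat.toIndexed.{t} B) f (x := ⟨y.down ≫ F.ob⟩)
        (y := ⟨y.down ≫ G.ob⟩) (B.elAt α.hom y.down rfl rfl) =
        B.elAt α.hom (f ≫ y.down) (Category.assoc _ _ _) (Category.assoc _ _ _) := by
      rw [← B.elAt_elAt α.hom y.down rfl rfl f rfl rfl]
      simp only [IndexedCat.rePt, VCat.bcPt, SmallCat.elAt, IndexedMonoidalCategory.pull₀,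
        transfer₀, Iso.app_inv, Category.assoc]
    rw [this]
    exact elAt_comm α.hom (f ≫ y.down) _ _ _ _ _ _

end SmallNat

/-- The inclusion of small `W`-categories into indexed `W`-categories, on objects, functors and
natural transformations. -/
abbrev SmallCat.inclusion (W : IndexedMonoidalCategory.{w, w'} E) :
    PrelaxFunctorStruct (SmallCat W) (IndexedCat.{max t v} W) where
  obj A := SmallCat.toIndexed.{t} A
  map F := SmallFunctor.toIndexed.{t} F
  map₂ α := SmallNat.toIndexed.{t} α

end IndexedEnrichment

namespace IndexedEnrichment


/-! ### Internal categories and families of their objects and morphisms -/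

section InternalCategory

variable (E : Type u) [Category.{v} E] [Limits.HasFiniteLimits E]

/-- The structure maps of an internal category; `comp` sends `(g, f)` with `src g = tgt f` to the
composite of `f` followed by `g`. -/
structure InternalCategoryData where
  Ob : E
  Mor : E
  src : Mor ⟶ Ob
  tgt : Mor ⟶ Ob
  id : Ob ⟶ Mor
  comp : Limits.pullback src tgt ⟶ Mor

variable {E}

/-- The composite of two generalized morphisms, `f` followed by `g`. -/
abbrev InternalCategoryData.cmp (V : InternalCategoryData E) {I : E} (f g : I ⟶ V.Mor)
    (h : f ≫ V.tgt = g ≫ V.src) : I ⟶ V.Mor :=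
  Limits.pullback.lift g f h.symm ≫ V.comp

variable (E) in
/-- An internal category; the unit and associativity laws are stated for generalized elements. -/
structure InternalCategory extends InternalCategoryData E where
  id_src : id ≫ src = 𝟙 Ob
  id_tgt : id ≫ tgt = 𝟙 Ob
  comp_src : comp ≫ src = Limits.pullback.snd src tgt ≫ src
  comp_tgt : comp ≫ tgt = Limits.pullback.fst src tgt ≫ tgt
  id_cmp {I : E} (f : I ⟶ Mor) (h : (f ≫ src ≫ id) ≫ tgt = f ≫ src) :
    toInternalCategoryData.cmp (f ≫ src ≫ id) f h = f
  cmp_id {I : E} (f : I ⟶ Mor) (h : f ≫ tgt = (f ≫ tgt ≫ id) ≫ src) :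
    toInternalCategoryData.cmp f (f ≫ tgt ≫ id) h = f
  cmp_assoc {I : E} (f g k : I ⟶ Mor) (h : f ≫ tgt = g ≫ src) (h' : g ≫ tgt = k ≫ src)
    (e : toInternalCategoryData.cmp f g h ≫ tgt = k ≫ src)
    (e' : f ≫ tgt = toInternalCategoryData.cmp g k h' ≫ src) :
    toInternalCategoryData.cmp (toInternalCategoryData.cmp f g h) k e =
      toInternalCategoryData.cmp f (toInternalCategoryData.cmp g k h') e'

variable (V : InternalCategory E)

theorem InternalCategoryData.comp_cmp (V : InternalCategoryData E) {I J : E} (u : J ⟶ I)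
    (f g : I ⟶ V.Mor) (h : f ≫ V.tgt = g ≫ V.src) :
    u ≫ V.cmp f g h =
      V.cmp (u ≫ f) (u ≫ g) (by rw [Category.assoc, Category.assoc, h]) := by
  rw [InternalCategoryData.cmp, InternalCategoryData.cmp, ← Category.assoc]
  congr 1
  apply Limits.pullback.hom_ext
  · rw [Category.assoc, Limits.pullback.lift_fst, Limits.pullback.lift_fst]
  · rw [Category.assoc, Limits.pullback.lift_snd, Limits.pullback.lift_snd]

theorem InternalCategory.cmp_src {I : E} (f g : I ⟶ V.Mor) (h : f ≫ V.tgt = g ≫ V.src) :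
    V.cmp f g h ≫ V.src = f ≫ V.src := by
  rw [InternalCategoryData.cmp, Category.assoc, V.comp_src, Limits.pullback.lift_snd_assoc]

theorem InternalCategory.cmp_tgt {I : E} (f g : I ⟶ V.Mor) (h : f ≫ V.tgt = g ≫ V.src) :
    V.cmp f g h ≫ V.tgt = g ≫ V.tgt := by
  rw [InternalCategoryData.cmp, Category.assoc, V.comp_tgt, Limits.pullback.lift_fst_assoc]

/-- A family of objects of `V` indexed by `I`. -/
structure Fam (I : E) where
  el : I ⟶ V.Ob

/-- A family of morphisms of `V` between two families of objects. -/
@[ext]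
structure FamHom {V : InternalCategory E} {I : E} (x y : Fam V I) where
  arr : I ⟶ V.Mor
  arr_src : arr ≫ V.src = x.el
  arr_tgt : arr ≫ V.tgt = y.el

/-- The category of families indexed by `I`. -/
instance (I : E) : Category (Fam V I) where
  Hom x y := FamHom x y
  id x := ⟨x.el ≫ V.id, by simp [V.id_src], by simp [V.id_tgt]⟩
  comp f g := ⟨V.cmp f.arr g.arr (f.arr_tgt.trans g.arr_src.symm),
    (V.cmp_src _ _ _).trans f.arr_src, (V.cmp_tgt _ _ _).trans g.arr_tgt⟩
  id_comp {x y} f := by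
    apply FamHom.ext
    refine Eq.trans ?_ (V.id_cmp f.arr (by simp [V.id_tgt]))
    simp only [← f.arr_src, Category.assoc]
  comp_id {x y} f := by
    apply FamHom.ext
    refine Eq.trans ?_ (V.cmp_id f.arr (by simp [V.id_src]))
    simp only [← f.arr_tgt, Category.assoc]
  assoc f g k := by
    apply FamHom.ext
    exact V.cmp_assoc f.arr g.arr k.arr (f.arr_tgt.trans g.arr_src.symm)
      (g.arr_tgt.trans k.arr_src.symm)
      ((V.cmp_tgt _ _ _).trans (g.arr_tgt.trans k.arr_src.symm))
      ((f.arr_tgt.trans g.arr_src.symm).trans (V.cmp_src _ _ _).symm)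

variable {V}

namespace Fam

variable {I J : E}

theorem hom_ext {x y : Fam V I} {f g : x ⟶ y} (h : f.arr = g.arr) : f = g := FamHom.ext h

theorem id_arr (x : Fam V I) : FamHom.arr (𝟙 x) = x.el ≫ V.id := rfl

theorem comp_arr {x y z : Fam V I} (f : x ⟶ y) (g : y ⟶ z) :
    (f ≫ g).arr = V.cmp f.arr g.arr (f.arr_tgt.trans g.arr_src.symm) := rfl

/-- The identity morphism between two equal families. -/
def ofEq {x y : Fam V I} (h : x.el = y.el) : x ⟶ y where
  arr := x.el ≫ V.id
  arr_src := by simp [V.id_src]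
  arr_tgt := by simp [V.id_tgt, h]

theorem ofEq_arr {x y : Fam V I} (h : x.el = y.el) : (ofEq h).arr = x.el ≫ V.id := rfl

theorem ext' {x y : Fam V I} (h : x.el = y.el) : x = y := by
  obtain ⟨x⟩ := x
  obtain ⟨y⟩ := y
  exact congrArg Fam.mk h

theorem el_eq {x y : Fam V I} {p : x ⟶ y} (hp : p.arr = x.el ≫ V.id) : x.el = y.el := by
  rw [← p.arr_tgt, hp, Category.assoc, V.id_tgt, Category.comp_id]

theorem comp_arr_left {x y z : Fam V I} {p : x ⟶ y} (hp : p.arr = x.el ≫ V.id) (f : y ⟶ z) :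
    (p ≫ f).arr = f.arr := by
  obtain rfl := ext' (el_eq hp)
  obtain rfl : p = 𝟙 x := hom_ext hp
  exact congrArg FamHom.arr (Category.id_comp f)

theorem comp_arr_right {x y z : Fam V I} (f : x ⟶ y) {p : y ⟶ z} (hp : p.arr = y.el ≫ V.id) :
    (f ≫ p).arr = f.arr := by
  obtain rfl := ext' (el_eq hp)
  obtain rfl : p = 𝟙 y := hom_ext hp
  exact congrArg FamHom.arr (Category.comp_id f)

theorem comp_arr_id {x y z : Fam V I} {p : x ⟶ y} {q : y ⟶ z} (hp : p.arr = x.el ≫ V.id)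
    (hq : q.arr = y.el ≫ V.id) : (p ≫ q).arr = x.el ≫ V.id :=
  (comp_arr_right p hq).trans hp

theorem eq_of_arr {x y : Fam V I} {p q : x ⟶ y} (hp : p.arr = x.el ≫ V.id)
    (hq : q.arr = x.el ≫ V.id) : p = q :=
  hom_ext (hp.trans hq.symm)

/-- The identity isomorphism between two equal families. -/
abbrev isoOfEq {x y : Fam V I} (h : x.el = y.el) : x ≅ y where
  hom := ofEq h
  inv := ofEq h.symm
  hom_inv_id := hom_ext (comp_arr_left rfl _ |>.trans (congrArg (· ≫ V.id) h.symm))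
  inv_hom_id := hom_ext (comp_arr_left rfl _ |>.trans (congrArg (· ≫ V.id) h))

variable (V) in
/-- Reindexing of families by precomposition. -/
abbrev re (f : J ⟶ I) : Fam V I ⥤ Fam V J where
  obj x := ⟨f ≫ x.el⟩
  map a := ⟨f ≫ a.arr, by rw [Category.assoc, a.arr_src], by rw [Category.assoc, a.arr_tgt]⟩
  map_id x := hom_ext (Category.assoc _ _ _).symm
  map_comp a b := hom_ext (V.comp_cmp f a.arr b.arr (a.arr_tgt.trans b.arr_src.symm))

end Fam

end InternalCategory

/-! ### Internal monoidal categories -/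

section InternalMonoidal

variable {E : Type u} [Category.{v} E] [CartesianMonoidalCategory E] [Limits.HasFiniteLimits E]

/-- The structure maps of an internal monoidal category: the action of the tensor product on
objects and on morphisms, the unit object, and the families of morphisms given by the associator,
the unitors and their inverses. -/
structure InternalTensor (V : InternalCategory E) where
  tensorOb : V.Ob ⊗ V.Ob ⟶ V.Ob
  tensorMor : V.Mor ⊗ V.Mor ⟶ V.Mor
  tensor_src : tensorMor ≫ V.src = (V.src ⊗ₘ V.src) ≫ tensorOb
  tensor_tgt : tensorMor ≫ V.tgt = (V.tgt ⊗ₘ V.tgt) ≫ tensorOb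
  unit : 𝟙_ E ⟶ V.Ob
  assoc : V.Ob ⊗ (V.Ob ⊗ V.Ob) ⟶ V.Mor
  assoc_src : assoc ≫ V.src = lift (lift (tri₀ V.Ob) (tri₁ V.Ob) ≫ tensorOb) (tri₂ V.Ob) ≫ tensorOb
  assoc_tgt : assoc ≫ V.tgt = lift (tri₀ V.Ob) (lift (tri₁ V.Ob) (tri₂ V.Ob) ≫ tensorOb) ≫ tensorOb
  assocInv : V.Ob ⊗ (V.Ob ⊗ V.Ob) ⟶ V.Mor
  assocInv_src : assocInv ≫ V.src = assoc ≫ V.tgt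
  assocInv_tgt : assocInv ≫ V.tgt = assoc ≫ V.src
  left : V.Ob ⟶ V.Mor
  left_src : left ≫ V.src = lift (toUnit V.Ob ≫ unit) (𝟙 V.Ob) ≫ tensorOb
  left_tgt : left ≫ V.tgt = 𝟙 V.Ob
  leftInv : V.Ob ⟶ V.Mor
  leftInv_src : leftInv ≫ V.src = left ≫ V.tgt
  leftInv_tgt : leftInv ≫ V.tgt = left ≫ V.src
  right : V.Ob ⟶ V.Mor
  right_src : right ≫ V.src = lift (𝟙 V.Ob) (toUnit V.Ob ≫ unit) ≫ tensorOb
  right_tgt : right ≫ V.tgt = 𝟙 V.Ob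
  rightInv : V.Ob ⟶ V.Mor
  rightInv_src : rightInv ≫ V.src = right ≫ V.tgt
  rightInv_tgt : rightInv ≫ V.tgt = right ≫ V.src

namespace InternalTensor

variable {V : InternalCategory E} (T : InternalTensor V) {I : E}

/-- The pointwise tensor product of families of objects. -/
abbrev ten (x y : Fam V I) : Fam V I := ⟨lift x.el y.el ≫ T.tensorOb⟩

/-- The pointwise tensor product of families of morphisms. -/
abbrev tenHom {x y x' y' : Fam V I} (f : x ⟶ y) (g : x' ⟶ y') : T.ten x x' ⟶ T.ten y y' where
  arr := lift f.arr g.arr ≫ T.tensorMor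
  arr_src := by simp [T.tensor_src, f.arr_src, g.arr_src]
  arr_tgt := by simp [T.tensor_tgt, f.arr_tgt, g.arr_tgt]

variable (I) in
/-- The constant family on the unit object. -/
abbrev one : Fam V I := ⟨toUnit I ≫ T.unit⟩

/-- The associator on families. -/
abbrev assocHom (x y z : Fam V I) : T.ten (T.ten x y) z ⟶ T.ten x (T.ten y z) where
  arr := lift x.el (lift y.el z.el) ≫ T.assoc
  arr_src := by simp [T.assoc_src, comp_lift_assoc]
  arr_tgt := by simp [T.assoc_tgt, comp_lift_assoc]

/-- The inverse associator on families. -/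
abbrev assocInvHom (x y z : Fam V I) : T.ten x (T.ten y z) ⟶ T.ten (T.ten x y) z where
  arr := lift x.el (lift y.el z.el) ≫ T.assocInv
  arr_src := by simp [T.assocInv_src, T.assoc_tgt, comp_lift_assoc]
  arr_tgt := by simp [T.assocInv_tgt, T.assoc_src, comp_lift_assoc]

/-- The left unitor on families. -/
abbrev leftHom (x : Fam V I) : T.ten (T.one I) x ⟶ x where
  arr := x.el ≫ T.left
  arr_src := by simp [T.left_src, comp_lift_assoc]
  arr_tgt := by simp [T.left_tgt]

/-- The inverse left unitor on families. -/
abbrev leftInvHom (x : Fam V I) : x ⟶ T.ten (T.one I) x where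
  arr := x.el ≫ T.leftInv
  arr_src := by simp [T.leftInv_src, T.left_tgt]
  arr_tgt := by simp [T.leftInv_tgt, T.left_src, comp_lift_assoc]

/-- The right unitor on families. -/
abbrev rightHom (x : Fam V I) : T.ten x (T.one I) ⟶ x where
  arr := x.el ≫ T.right
  arr_src := by simp [T.right_src, comp_lift_assoc]
  arr_tgt := by simp [T.right_tgt]

/-- The inverse right unitor on families. -/
abbrev rightInvHom (x : Fam V I) : x ⟶ T.ten x (T.one I) where
  arr := x.el ≫ T.rightInv
  arr_src := by simp [T.rightInv_src, T.right_tgt]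
  arr_tgt := by simp [T.rightInv_tgt, T.right_src, comp_lift_assoc]

end InternalTensor

variable (E) in
/-- An internal monoidal category.  The axioms (functoriality of the tensor product, naturality
and invertibility of the associator and the unitors, pentagon and triangle) are stated for
generalized elements in every context `I`. -/
structure InternalMonoidalCategory where
  cat : InternalCategory E
  ten : InternalTensor cat
  tensor_id {I : E} (x y : Fam cat I) : ten.tenHom (𝟙 x) (𝟙 y) = 𝟙 (ten.ten x y)
  tensor_comp {I : E} {x y z x' y' z' : Fam cat I} (f : x ⟶ y) (g : y ⟶ z) (f' : x' ⟶ y')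
    (g' : y' ⟶ z') : ten.tenHom f f' ≫ ten.tenHom g g' = ten.tenHom (f ≫ g) (f' ≫ g')
  assoc_hom_inv {I : E} (x y z : Fam cat I) :
    ten.assocHom x y z ≫ ten.assocInvHom x y z = 𝟙 _
  assoc_inv_hom {I : E} (x y z : Fam cat I) :
    ten.assocInvHom x y z ≫ ten.assocHom x y z = 𝟙 _
  left_hom_inv {I : E} (x : Fam cat I) : ten.leftHom x ≫ ten.leftInvHom x = 𝟙 _
  left_inv_hom {I : E} (x : Fam cat I) : ten.leftInvHom x ≫ ten.leftHom x = 𝟙 _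
  right_hom_inv {I : E} (x : Fam cat I) : ten.rightHom x ≫ ten.rightInvHom x = 𝟙 _
  right_inv_hom {I : E} (x : Fam cat I) : ten.rightInvHom x ≫ ten.rightHom x = 𝟙 _
  assoc_naturality {I : E} {x y z x' y' z' : Fam cat I} (f : x ⟶ x') (g : y ⟶ y') (h : z ⟶ z') :
    ten.tenHom (ten.tenHom f g) h ≫ ten.assocHom x' y' z' =
      ten.assocHom x y z ≫ ten.tenHom f (ten.tenHom g h)
  left_naturality {I : E} {x x' : Fam cat I} (f : x ⟶ x') :
    ten.tenHom (𝟙 (ten.one I)) f ≫ ten.leftHom x' = ten.leftHom x ≫ f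
  right_naturality {I : E} {x x' : Fam cat I} (f : x ⟶ x') :
    ten.tenHom f (𝟙 (ten.one I)) ≫ ten.rightHom x' = ten.rightHom x ≫ f
  pentagon {I : E} (a b c d : Fam cat I) :
    ten.tenHom (ten.assocHom a b c) (𝟙 d) ≫ ten.assocHom a (ten.ten b c) d ≫
        ten.tenHom (𝟙 a) (ten.assocHom b c d) =
      ten.assocHom (ten.ten a b) c d ≫ ten.assocHom a b (ten.ten c d)
  triangle {I : E} (a b : Fam cat I) :
    ten.assocHom a (ten.one I) b ≫ ten.tenHom (𝟙 a) (ten.leftHom b) =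
      ten.tenHom (ten.rightHom a) (𝟙 b)

namespace InternalMonoidalCategory

variable (V : InternalMonoidalCategory E)

/-- The pointwise monoidal structure on the category of families. -/
abbrev famStruct (I : E) : MonoidalCategoryStruct (Fam V.cat I) where
  tensorObj x y := V.ten.ten x y
  tensorHom f g := V.ten.tenHom f g
  whiskerLeft x _ _ f := V.ten.tenHom (𝟙 x) f
  whiskerRight f x := V.ten.tenHom f (𝟙 x)
  tensorUnit := V.ten.one I
  associator x y z :=
    ⟨V.ten.assocHom x y z, V.ten.assocInvHom x y z, V.assoc_hom_inv x y z, V.assoc_inv_hom x y z⟩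
  leftUnitor x := ⟨V.ten.leftHom x, V.ten.leftInvHom x, V.left_hom_inv x, V.left_inv_hom x⟩
  rightUnitor x := ⟨V.ten.rightHom x, V.ten.rightInvHom x, V.right_hom_inv x, V.right_inv_hom x⟩

/-- The monoidal category of families indexed by `I`. -/
instance famMonoidal (I : E) : MonoidalCategory (Fam V.cat I) :=
  letI := V.famStruct I
  MonoidalCategory.ofTensorHom
    (id_tensorHom_id := fun x y => V.tensor_id x y)
    (id_tensorHom := fun _ _ _ _ => rfl)
    (tensorHom_id := fun _ _ => rfl)
    (tensorHom_comp_tensorHom := fun f f' g g' => V.tensor_comp f g f' g')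
    (associator_naturality := fun f g h => V.assoc_naturality f g h)
    (leftUnitor_naturality := fun f => V.left_naturality f)
    (rightUnitor_naturality := fun f => V.right_naturality f)
    (pentagon := fun a b c d => V.pentagon a b c d)
    (triangle := fun a b => V.triangle a b)

theorem tenHom_arr {I : E} {x y x' y' : Fam V.cat I} {p : x ⟶ y} {q : x' ⟶ y'}
    (hp : p.arr = x.el ≫ V.cat.id) (hq : q.arr = x'.el ≫ V.cat.id) :
    (V.ten.tenHom p q).arr = (lift x.el x'.el ≫ V.ten.tensorOb) ≫ V.cat.id := by
  obtain rfl := Fam.ext' (Fam.el_eq hp)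
  obtain rfl := Fam.ext' (Fam.el_eq hq)
  obtain rfl : p = 𝟙 x := Fam.hom_ext hp
  obtain rfl : q = 𝟙 x' := Fam.hom_ext hq
  exact congrArg FamHom.arr (V.tensor_id x x')

/-- Reindexing is a strict monoidal functor. -/
instance reMonoidal {I J : E} (f : J ⟶ I) : (Fam.re V.cat f).Monoidal :=
  Functor.CoreMonoidal.toMonoidal
    { εIso := Fam.isoOfEq (show toUnit J ≫ V.ten.unit = f ≫ toUnit I ≫ V.ten.unit by simp)
      μIso := fun x y => Fam.isoOfEq
        (show lift (f ≫ x.el) (f ≫ y.el) ≫ V.ten.tensorOb = f ≫ lift x.el y.el ≫ V.ten.tensorOb by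
          simp only [comp_lift_assoc])
      μIso_hom_natural_left := fun g x =>
        Fam.hom_ext ((Fam.comp_arr_right _ rfl).trans (Eq.trans (by
          change lift (f ≫ g.arr) ((f ≫ x.el) ≫ V.cat.id) ≫ V.ten.tensorMor =
            f ≫ lift g.arr (x.el ≫ V.cat.id) ≫ V.ten.tensorMor
          simp [comp_lift_assoc]) (Fam.comp_arr_left rfl _).symm))
      μIso_hom_natural_right := fun x g =>
        Fam.hom_ext ((Fam.comp_arr_right _ rfl).trans (Eq.trans (by
          change lift ((f ≫ x.el) ≫ V.cat.id) (f ≫ g.arr) ≫ V.ten.tensorMor =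
            f ≫ lift (x.el ≫ V.cat.id) g.arr ≫ V.ten.tensorMor
          simp [comp_lift_assoc]) (Fam.comp_arr_left rfl _).symm))
      associativity := fun x y z =>
        Fam.hom_ext ((Fam.comp_arr_left (V.tenHom_arr rfl rfl) _).trans
          ((Fam.comp_arr_left rfl _).trans (Eq.trans (by
            change f ≫ lift x.el (lift y.el z.el) ≫ V.ten.assoc =
              lift (f ≫ x.el) (lift (f ≫ y.el) (f ≫ z.el)) ≫ V.ten.assoc
            simp [comp_lift_assoc]) (Fam.comp_arr_right _
              ((Fam.comp_arr_right _ rfl).trans (V.tenHom_arr rfl rfl))).symm)))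
      left_unitality := fun x =>
        Fam.hom_ext (Eq.trans (by
          change (f ≫ x.el) ≫ V.ten.left = f ≫ x.el ≫ V.ten.left
          simp) ((Fam.comp_arr_left (V.tenHom_arr rfl rfl) _).trans
            (Fam.comp_arr_left rfl _)).symm)
      right_unitality := fun x =>
        Fam.hom_ext (Eq.trans (by
          change (f ≫ x.el) ≫ V.ten.right = f ≫ x.el ≫ V.ten.right
          simp) ((Fam.comp_arr_left (V.tenHom_arr rfl rfl) _).trans
            (Fam.comp_arr_left rfl _)).symm) }

/-- The comparison of the reindexing along an identity with the identity. -/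
abbrev reId (I : E) : Fam.re V.cat (𝟙 I) ≅ 𝟭 (Fam V.cat I) :=
  NatIso.ofComponents (fun x => Fam.isoOfEq (Category.id_comp x.el)) (fun a => Fam.hom_ext
    ((Fam.comp_arr_right _ rfl).trans ((Category.id_comp _).trans (Fam.comp_arr_left rfl _).symm)))

/-- The comparison of the reindexing along a composite with the composite of reindexings. -/
abbrev reComp {I J K : E} (f : I ⟶ J) (g : J ⟶ K) (k : I ⟶ K) (e : f ≫ g = k) :
    Fam.re V.cat k ≅ Fam.re V.cat g ⋙ Fam.re V.cat f :=
  NatIso.ofComponents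
    (fun x => Fam.isoOfEq (show k ≫ x.el = f ≫ g ≫ x.el by rw [← e, Category.assoc]))
    (fun a => Fam.hom_ext ((Fam.comp_arr_right _ rfl).trans
      ((show k ≫ a.arr = f ≫ g ≫ a.arr by rw [← e, Category.assoc]).trans
        (Fam.comp_arr_left rfl ((Fam.re V.cat g ⋙ Fam.re V.cat f).map a)).symm)))

open Functor.LaxMonoidal

theorem ε_arr {I J : E} (f : J ⟶ I) :
    FamHom.arr (ε (Fam.re V.cat f)) = (toUnit J ≫ V.ten.unit) ≫ V.cat.id := rfl

theorem μ_arr {I J : E} (f : J ⟶ I) (x y : Fam V.cat I) :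
    FamHom.arr (μ (Fam.re V.cat f) x y) =
      (lift (f ≫ x.el) (f ≫ y.el) ≫ V.ten.tensorOb) ≫ V.cat.id := rfl

theorem re_map_arr {I J : E} (f : J ⟶ I) {x y : Fam V.cat I} {p : x ⟶ y}
    (hp : p.arr = x.el ≫ V.cat.id) :
    FamHom.arr ((Fam.re V.cat f).map p) = ((Fam.re V.cat f).obj x).el ≫ V.cat.id :=
  (congrArg (f ≫ ·) hp).trans (Category.assoc _ _ _).symm

theorem reId_monoidal (I : E) : NatTrans.IsMonoidal (V.reId I).hom where
  unit := Fam.eq_of_arr (Fam.comp_arr_id (V.ε_arr _) rfl) rfl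
  tensor x y := Fam.eq_of_arr (Fam.comp_arr_id (V.μ_arr _ _ _) rfl)
    (Fam.comp_arr_id (V.tenHom_arr rfl rfl) rfl)

theorem reComp_monoidal {I J K : E} (f : I ⟶ J) (g : J ⟶ K) (k : I ⟶ K) (e : f ≫ g = k) :
    NatTrans.IsMonoidal (V.reComp f g k e).hom where
  unit := Fam.eq_of_arr (Fam.comp_arr_id (V.ε_arr _) rfl)
    (Fam.comp_arr_id (V.ε_arr _) (V.re_map_arr _ (V.ε_arr _)))
  tensor x y := Fam.eq_of_arr (Fam.comp_arr_id (V.μ_arr _ _ _) rfl)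
    (Fam.comp_arr_id (V.tenHom_arr rfl rfl)
      (Fam.comp_arr_id (V.μ_arr _ _ _) (V.re_map_arr _ (V.μ_arr _ _ _))))

/-- The externalization of an internal monoidal category: the indexed monoidal category of
families of its objects and morphisms. -/
abbrev externalization : IndexedMonoidalCategory.{v, v} E where
  fib I := Fam V.cat I
  cat I := inferInstance
  mon I := V.famMonoidal I
  re f := Fam.re V.cat f
  reMonoidal f := V.reMonoidal f
  reId I := V.reId I
  reComp f g k e := V.reComp f g k e
  reId_monoidal I := V.reId_monoidal I
  reComp_monoidal f g k e := V.reComp_monoidal f g k e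
  reComp_assoc _ _ _ _ _ _ _ _ _ _ _ :=
    Fam.eq_of_arr (Fam.comp_arr_id rfl (V.re_map_arr _ rfl)) (Fam.comp_arr_id rfl rfl)
  reComp_id_left _ _ := Fam.eq_of_arr (Fam.comp_arr_id rfl rfl) rfl
  reComp_id_right _ _ := Fam.eq_of_arr (Fam.comp_arr_id rfl (V.re_map_arr _ rfl)) rfl

end InternalMonoidalCategory

end InternalMonoidal

end IndexedEnrichment

end

noncomputable section

namespace IndexedEnrichment

variable {E : Type u} [Category.{v} E] [CartesianMonoidalCategory E]
variable {W : IndexedMonoidalCategory.{w, w'} E}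

/-! ### The inclusion is a strict 2-functor -/

namespace SmallFunctor

variable {A B C : SmallCat W}

/-! The result is a Yoneda lemma for generalized objects. It uses nothing special about
$\mathrm{Ext}\,V$ and is proved for an arbitrary indexed monoidal category `W`. An object $x\colon
X\to A_0$ of a fibre of $\Phi A$ is the reindexing along $x$ of the universal object `𝟙 A.ob` over
$A_0$, and a pair $(x,y)$ is the reindexing along `lift x y` of the pair of projections of
$A_0\times A_0$. Data compatible with reindexing are therefore determined by their value at the
universal object or at the generic pair.

Transformations: the comparisons of $\Phi F$ and $\Phi G$ with reindexing are identities, so the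
naturality of an indexed transformation $\gamma$ along $x$ says that $\gamma_x$ is the reindexing of
$\gamma_{\mathbb 1}$. Hence $\gamma$ comes from exactly one small transformation
(`exists_toIndexed_map₂_eq`, `toIndexed_map₂_injective`).

Functors: for an indexed functor $J$ put $F_0=J(\mathrm{id}_{A_0})$. The comparison of $J$ along $x$
is an isomorphism $J(x)\cong F_0x$. Transporting $J$ along these isomorphisms gives a functor with
object part exactly $x\mapsto F_0x$, and the coherence of $J$ for composites turns its comparisons
into identities (`exists_toIndexed_iso`). A family that commutes strictly with reindexing is then
read off from its action on the generic pair (`SmallFunctor.exists_ctx_eq`). This gives essential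
surjectivity. Injectivity on functors holds because the value at the universal object and the action
on the generic pair are all of the data.

Equality of images: if $\Phi A=\Phi B$, the functor `eqToHom` between them commutes strictly with
reindexing, so it lies in the image of $\Phi$ on the nose. The same holds for its inverse, and
injectivity on functors makes the two preimages mutually inverse.

Most of the remaining work concerns objects that are equal but not definitionally so, such as `x ≫ 𝟙
A.ob` and `x`. All comparisons involved are identities transported along such equalities
(`VCat.ofEq`), and these compose to one another. -/

theorem toIndexed_id (A : SmallCat W) :
    toIndexed.{t} (SmallFunctor.id A) = IndexedFunctor.id (SmallCat.toIndexed.{t} A) := by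
  refine IndexedFunctor.ext' (fun X => VFunctor.ext' (fun x => ?_) fun x y => ?_)
    fun {X Y} f y => ?_
  · exact congrArg ULift.up (Category.comp_id _)
  · simp only [idData_mapAt', eqToHom_trans, eqToHom_refl]
  · simp only [eqToIso.hom, VNat.eqToHom_app, VFunctor.isoMk]
    -- The comparison of the identity functor has the components `id`, which are `ofEq` of a
    -- reflexivity proof. Both sides are thus composites of transported identities with the same
    -- endpoints.
    exact (VCat.ofEq_vcomp_ofEq _ _ _).trans (VCat.ofEq_vcomp_ofEq _ _ (rfl)).symm

/-- The objects `x ≫ F.ob ≫ G.ob` and `(x ≫ F.ob) ≫ G.ob` differ by associativity only, and `mapAt`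
accepts any names for its target objects, so the transport is absorbed into the choice of these
names. -/
theorem toIndexed_comp (F : SmallFunctor A B) (G : SmallFunctor B C) :
    toIndexed.{t} (F.comp G) = IndexedFunctor.comp (toIndexed.{t} F) (toIndexed.{t} G) := by
  refine IndexedFunctor.ext' (fun X => VFunctor.ext' (fun x => ?_) fun x y => ?_)
    fun {X Y} f y => ?_
  · exact congrArg ULift.up (Category.assoc _ _ _).symm
  · exact ((F.comp G).mapAt_eqToHom _ _ rfl rfl (Category.assoc _ _ _).symm
      (Category.assoc _ _ _).symm _).trans
        (comp_mapAt F G x.down y.down rfl rfl rfl rfl _ _)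
  · simp only [eqToIso.hom, VNat.eqToHom_app, VFunctor.isoMk]
    rw [(G.ctx X).ofEq_map]
    erw [VCat.ofEq_vcomp_ofEq, VCat.ofEq_vcomp_ofEq, VCat.ofEq_vcomp_ofEq]

end SmallFunctor

/-- This has the shape that `IndexedNat.eq_conj` asks for, at an arbitrary universe level `t`. It
serves to check the whiskering axioms of the 2-functor. -/
theorem SmallNat.elAt_conj {B : SmallCat W} {I Z : E} {p q : Z ⟶ B.ob}
    (f : 𝟙_ (W.fib Z) ⟶ B.H p q) (x : I ⟶ Z)
    {a b a' b' : I ⟶ B.ob} (ha : x ≫ p = a) (hb : x ≫ q = b) (ha' : x ≫ p = a')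
    (hb' : x ≫ q = b')
    (e : (⟨a⟩ : (SmallCat.ctx.{t} B I).Ob) = ⟨a'⟩) (e' : (⟨b'⟩ : (SmallCat.ctx.{t} B I).Ob) = ⟨b⟩) :
    B.elAt f x ha hb = (SmallCat.ctx.{t} B I).vcomp (x := ⟨a⟩) (y := ⟨a'⟩) (z := ⟨b⟩)
      ((SmallCat.ctx.{t} B I).ofEq e)
      ((SmallCat.ctx.{t} B I).vcomp (x := ⟨a'⟩) (y := ⟨b'⟩) (z := ⟨b⟩) (B.elAt f x ha' hb')
        ((SmallCat.ctx.{t} B I).ofEq e')) := by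
  subst ha hb ha' hb'
  rw [VCat.ofEq_conj]

/-- The inclusion of small `W`-categories into indexed `W`-categories as a strict 2-functor. -/
def SmallCat.inclusionPseudofunctor (W : IndexedMonoidalCategory.{w, w'} E) :
    StrictPseudofunctor (SmallCat W) (IndexedCat.{max t v} W) :=
  -- Both bicategories are strict, so identities, composites and whiskerings are all that has to be
  -- checked. The associators and unitors are equalities.
  StrictPseudofunctor.mk''
    { SmallCat.inclusion.{t} W with
      map₂_id := fun {A B} F => IndexedNat.ext' fun X x => B.elAt_idAt x.down rfl
      map₂_comp := fun {A B F G H} α β => IndexedNat.ext' fun X x =>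
        B.elAt_vc (SmallNat.hom α) (SmallNat.hom β) x.down rfl rfl rfl
      map_id := SmallFunctor.toIndexed_id
      map_comp := SmallFunctor.toIndexed_comp
      -- Reindexing a component along `F.ob` and then along `x` is reindexing it along `x ≫ F.ob`.
      map₂_whisker_left := fun {A B C} F {G H} α =>
        IndexedNat.eq_conj (SmallFunctor.toIndexed_comp F G)
          (SmallFunctor.toIndexed_comp F H).symm _ _
          (fun _ _ => congrArg ULift.up (Category.assoc _ _ _).symm)
          (fun _ _ => congrArg ULift.up (Category.assoc _ _ _)) fun X x =>
          (C.elAt_elAt (SmallNat.hom α) F.ob rfl rfl x.down rfl rfl).trans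
            (SmallNat.elAt_conj _ _ _ _ rfl rfl _ _)
      -- Here the content is that the action of `H` on generalized elements commutes with
      -- reindexing.
      map₂_whisker_right := fun {A B C F G} α H =>
        IndexedNat.eq_conj (SmallFunctor.toIndexed_comp F H)
          (SmallFunctor.toIndexed_comp G H).symm _ _
          (fun _ _ => congrArg ULift.up (Category.assoc _ _ _).symm)
          (fun _ _ => congrArg ULift.up (Category.assoc _ _ _)) fun X x =>
          (SmallNat.elAt_conj (SmallNat.hom α ≫ H.mapAt F.ob G.ob rfl rfl) x.down rfl rfl
            (Category.assoc _ _ _).symm (Category.assoc _ _ _).symm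
            (congrArg ULift.up (Category.assoc _ _ _).symm)
            (congrArg ULift.up (Category.assoc _ _ _))).trans
              (by rw [← SmallFunctor.elAt_mapAt H (SmallNat.hom α) x.down rfl rfl rfl rfl rfl rfl]; rfl) }

end IndexedEnrichment

end

noncomputable section

namespace IndexedEnrichment

/-! ### Transport of enriched functors along objectwise isomorphisms -/

section Transport

variable {V : Type w} [Category.{w'} V] [MonoidalCategory V] {A B : VCat.{t} V}

/-- Extracts the actions on hom-objects from an equality of functors without heterogeneous equality.
-/
theorem VFunctor.map_of_eq {F G : VFunctor A B} (h : F = G) (x y : A.Ob) :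
    F.map x y = G.map x y ≫ eqToHom (by rw [h]) := by
  subst h
  simp

/-- Two enriched functors related by a transformation with identity components are equal. -/
theorem VFunctor.eq_of_nat {F G : VFunctor A B} (α : VNat F G) (h : ∀ x, F.obj x = G.obj x)
    (hα : ∀ x, α.app x = B.ofEq (h x)) : F = G := by
  refine VFunctor.ext' h fun x y => ?_
  have := α.nat x y
  rw [hα, hα, VCat.post_ofEq, VCat.pre_ofEq] at this
  -- Naturality compares the two actions inside `B.hom (F.obj x) (G.obj y)`, so the goal is moved
  -- there.
  rw [← cancel_mono (eqToHom (congrArg (fun a => B.hom a (G.obj y)) (h x).symm))]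
  simpa using this

/-- Needed because an object `x` equals the reindexing of the universal object along `x`, but not
definitionally. -/
theorem VNat.app_congr {F G : VFunctor A B} (α : VNat F G) {x y : A.Ob} (h : x = y) :
    B.vcomp (B.ofEq (congrArg F.obj h)) (α.app y) =
      B.vcomp (α.app x) (B.ofEq (congrArg G.obj h)) := by
  subst h
  rw [VCat.ofEq_rfl, VCat.ofEq_rfl, VCat.id_vcomp, VCat.vcomp_id]

/-- Transported identities are invertible, so a square with two such sides can be solved for either
of the others. The primed version solves for the opposite side. -/
theorem VCat.eq_conj_of_vcomp_ofEq {x x' y y' : B.Ob} (h : x = x') (h' : y = y')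
    {f : 𝟙_ V ⟶ B.hom x' y'} {g : 𝟙_ V ⟶ B.hom x y}
    (e : B.vcomp (B.ofEq h) f = B.vcomp g (B.ofEq h')) :
    f = B.vcomp (B.ofEq h.symm) (B.vcomp g (B.ofEq h')) := by
  rw [← e, ← VCat.vcomp_assoc, VCat.ofEq_vcomp_ofEq, VCat.ofEq_rfl, VCat.id_vcomp]

theorem VCat.eq_conj_of_vcomp_ofEq' {x x' y y' : B.Ob} (h : x = x') (h' : y = y')
    {f : 𝟙_ V ⟶ B.hom x' y'} {g : 𝟙_ V ⟶ B.hom x y}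
    (e : B.vcomp (B.ofEq h) f = B.vcomp g (B.ofEq h')) :
    g = B.vcomp (B.ofEq h) (B.vcomp f (B.ofEq h'.symm)) := by
  rw [← VCat.vcomp_assoc, e, VCat.vcomp_assoc, VCat.ofEq_vcomp_ofEq, VCat.ofEq_rfl, VCat.vcomp_id]

/-- The enriched functor with prescribed values on objects, isomorphic to those of `F`. -/
abbrev VFunctor.conj (F : VFunctor A B) (d : A.Ob → B.Ob)
    (θ : ∀ x, 𝟙_ V ⟶ B.hom (F.obj x) (d x)) (θ' : ∀ x, 𝟙_ V ⟶ B.hom (d x) (F.obj x))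
    (h : ∀ x, B.vcomp (θ x) (θ' x) = B.id _) (h' : ∀ x, B.vcomp (θ' x) (θ x) = B.id _) :
    VFunctor A B where
  obj := d
  map x y := F.map x y ≫ B.post (F.obj x) (θ y) ≫ B.pre (θ' x) (d y)
  map_comp x y z := by
    -- Composition is dinatural in the middle object: `θ' y` may be moved from the second factor to
    -- the first.
    have e : B.pre (θ' y) (d z) ▷ B.hom (d x) (d y) ≫ B.comp (d x) (d y) (d z) =
        B.hom (F.obj y) (d z) ◁ B.post (d x) (θ' y) ≫ B.comp (d x) (F.obj y) (d z) :=
      B.pre_post _ _ _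
    calc A.comp x y z ≫ F.map x z ≫ B.post (F.obj x) (θ z) ≫ B.pre (θ' x) (d z)
        = (F.map y z ⊗ₘ F.map x y) ≫ (B.post (F.obj y) (θ z) ⊗ₘ B.pre (θ' x) (F.obj y)) ≫
            B.comp (d x) (F.obj y) (d z) := by
          rw [← Category.assoc, F.map_comp, Category.assoc, ← Category.assoc (B.comp _ _ _),
            B.comp_post, Category.assoc, B.comp_pre, MonoidalCategory.tensorHom_def (B.post _ _),
            Category.assoc]
      _ = (F.map y z ⊗ₘ F.map x y) ≫ (B.post (F.obj y) (θ z) ⊗ₘ B.pre (θ' x) (F.obj y)) ≫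
            B.hom (F.obj y) (d z) ◁ B.post (d x) (θ y) ≫
            B.pre (θ' y) (d z) ▷ B.hom (d x) (d y) ≫ B.comp (d x) (d y) (d z) := by
          -- The composite of `θ y` and `θ' y` is the identity of `F.obj y`, so it can be inserted
          -- at the middle object. The first half then goes to one factor and the second half to the
          -- other.
          rw [e, ← MonoidalCategory.whiskerLeft_comp_assoc, ← VCat.post_vcomp, h, VCat.post_id,
            MonoidalCategory.whiskerLeft_id, Category.id_comp]
      _ = _ := by
          rw [B.post_pre (θ' x) (θ y), ← tensorHom_comp_tensorHom_assoc,
            ← tensorHom_comp_tensorHom_assoc,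
            MonoidalCategory.tensorHom_def' (B.pre (θ' y) (d z)) (B.post (d x) (θ y)),
            Category.assoc]
  map_id x := by
    rw [← Category.assoc, F.map_id, ← Category.assoc, ← VCat.vcomp_eq_post, VCat.id_vcomp,
      ← VCat.vcomp_eq_pre, h']

/-- The comparison of a functor with its transport. -/
def VFunctor.conjIso (F : VFunctor A B) (d : A.Ob → B.Ob)
    (θ : ∀ x, 𝟙_ V ⟶ B.hom (F.obj x) (d x)) (θ' : ∀ x, 𝟙_ V ⟶ B.hom (d x) (F.obj x))
    (h : ∀ x, B.vcomp (θ x) (θ' x) = B.id _) (h' : ∀ x, B.vcomp (θ' x) (θ x) = B.id _) :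
    F ≅ F.conj d θ θ' h h' :=
  VFunctor.isoMk
    { app := θ
      naturality := fun x y => by
        rw [VNat.naturality_iff (G := F.conj d θ θ' h h') θ]
        simp only [Category.assoc]
        rw [← VCat.pre_vcomp, h, VCat.pre_id, Category.comp_id] }
    θ' h h'

end Transport

/-! ### Invertible and strict indexed functors, and reindexing of transported morphisms. -/

variable {E : Type u} [Category.{v} E]
variable {W : IndexedMonoidalCategory.{w, w'} E}

/-- An indexed transformation with invertible components is invertible. -/
def IndexedFunctor.isoMk {B C : IndexedCat.{t} W} {F G : IndexedFunctor B C} (α : IndexedNat F G)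
    (β : ∀ X, VNat (G.fn X) (F.fn X))
    (h : ∀ X x, (C.fib X).vcomp ((α.app X).app x) ((β X).app x) = (C.fib X).id _)
    (h' : ∀ X x, (C.fib X).vcomp ((β X).app x) ((α.app X).app x) = (C.fib X).id _) : F ≅ G where
  hom := α
  inv :=
    { app := β
      naturality := fun {X Y} f y => by
        have e : (C.fib X).vcomp (C.rePt f ((α.app Y).app y)) (C.rePt f ((β Y).app y)) =
            (C.fib X).id _ := by rw [← C.rePt_vcomp, h, C.rePt_id]
        -- Composing the naturality square of `α` with the inverse component before it and the
        -- reindexed inverse component after it gives the square for the inverse.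
        have key := congrArg (fun z => (C.fib X).vcomp ((β X).app ((B.re f).obj y))
          ((C.fib X).vcomp z (C.rePt f ((β Y).app y)))) (α.naturality f y)
        simp only [VCat.vcomp_assoc] at key
        rw [e, ← VCat.vcomp_assoc _ ((β X).app ((B.re f).obj y)) ((α.app X).app ((B.re f).obj y)),
          h', VCat.id_vcomp] at key
        exact key.symm.trans (congrArg _ (VCat.vcomp_id _ _)) }
  hom_inv_id := IndexedNat.ext' h
  inv_hom_id := IndexedNat.ext' h'

/-- Shows that `eqToHom` meets the strictness hypothesis of `exists_toIndexed_eq`. The equality of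
objects is part of the conclusion, because without it the comparison could not be called an
identity. -/
theorem IndexedFunctor.eqToHom_obj {B C : IndexedCat.{t} W} (h : B = C) {X Y : E} (f : X ⟶ Y)
    (y : (B.fib Y).Ob) :
    ∃ e : (IndexedFunctor.fn (eqToHom h) X).obj ((B.re f).obj y) =
        (C.re f).obj ((IndexedFunctor.fn (eqToHom h) Y).obj y),
      (IndexedFunctor.reIso (eqToHom h) f).hom.app y = (C.fib X).ofEq e := by
  subst h
  exact ⟨rfl, rfl⟩

/-- Once the arrows of `E` are identified, every transport in the statement is an identity. The
lemma moves such a transport through the compositor. -/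
theorem IndexedMonoidalCategory.re_map_eqToHom_reComp (W : IndexedMonoidalCategory.{w, w'} E)
    {X Y Z : E} (f : X ⟶ Y) {g g' : Y ⟶ Z} {k k' : X ⟶ Z} (e : f ≫ g = k) (e' : f ≫ g' = k')
    (hg : g = g') (H : W.fib Z) :
    (W.re f).map (eqToHom (by rw [hg])) ≫ (W.reComp f g' k' e').inv.app H =
      (W.reComp f g k e).inv.app H ≫ eqToHom (by rw [← e, ← e', hg]) := by
  subst hg e e'
  simp

/-- A small functor acts on `A.hom` itself, whereas the family supplies a map out of `A.H fst snd`,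
the reindexing of `A.hom` along an arrow that only equals the identity. `reId` bridges the two; the
lemma says that the bridge disappears after reindexing along `l`. -/
theorem IndexedMonoidalCategory.re_map_eq_pull₁ (W : IndexedMonoidalCategory.{w, w'} E)
    {I Z Z' : E} {p : Z ⟶ Z} (hp : 𝟙 Z = p) {q r : Z ⟶ Z'} (hq : q = r) {H : W.fib Z}
    {H' : W.fib Z'} (m : (W.re p).obj H ⟶ (W.re q).obj H') (l : I ⟶ Z) (l' : I ⟶ Z')
    (e₁ : l ≫ p = l) (e : l ≫ q = l') (e' : l ≫ r = l') :
    (W.re l).map ((W.reId Z).inv.app H ≫ eqToHom (by rw [hp]) ≫ m ≫ eqToHom (by rw [hq])) ≫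
      (W.reComp l r l' e').inv.app H' = W.pull₁ l e₁ e m := by
  subst hp hq
  have := W.reComp_id_right l H
  simp only [eqToHom_refl, Category.comp_id, Category.id_comp, Functor.map_comp, Category.assoc,
    IndexedMonoidalCategory.pull₁, transfer₁, Iso.app_hom, Iso.app_inv]
  rw [← Category.assoc, ← Category.assoc]
  congr 2
  -- What remains is that the reindexed inverse of `reId` is the compositor of `l` with an identity;
  -- this is the right unit axiom `reComp_id_right`.
  rw [← cancel_mono ((W.re l).map ((W.reId Z).hom.app H)), this, ← Functor.map_comp]
  simp

/-! ### Small functors from strictly reindexing-stable families. -/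

variable [CartesianMonoidalCategory E]

/-- A family of enriched functors between the categories of generalized objects, given on objects
by composition with a fixed morphism and strictly stable under reindexing, comes from a functor
of small `W`-categories. -/
theorem SmallFunctor.exists_ctx_eq {A B : SmallCat W} (F₀ : A.ob ⟶ B.ob)
    (G : ∀ X : E, VFunctor (SmallCat.ctx.{t} A X) (SmallCat.ctx.{t} B X))
    (hG : ∀ X x, (G X).obj x = ⟨x.down ≫ F₀⟩)
    (hre : ∀ {X Y : E} (f : X ⟶ Y),
      (SmallCat.ctxRe.{t} A f).comp (G X) = ((G Y).bc (W.re f)).comp (B.ctxRe f)) :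
    ∃ F : SmallFunctor A B, ∀ X, F.ctx X = G X := by
  -- The action of `G` with freely named target objects, as in `mapAt`. One `eqToHom` absorbs both
  -- `hG` and the associativity of composition in `E`.
  let m {I : E} (x y : I ⟶ A.ob) {x' y' : I ⟶ B.ob} (hx : x ≫ F₀ = x') (hy : y ≫ F₀ = y') :
      A.H x y ⟶ B.H x' y' :=
    (G I).map ⟨x⟩ ⟨y⟩ ≫ eqToHom (by rw [hG, hG, hx, hy])
  have m_pull {J I : E} (u : J ⟶ I) {x y : I ⟶ A.ob} {x' y' : I ⟶ B.ob}
      (hx : x ≫ F₀ = x') (hy : y ≫ F₀ = y') {ux uy : J ⟶ A.ob} {ux' uy' : J ⟶ B.ob}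
      (e₁ : u ≫ x = ux) (e₂ : u ≫ y = uy) (e₃ : u ≫ x' = ux') (e₄ : u ≫ y' = uy') :
      W.pull₁ u (show u ≫ lift x y = lift ux uy by simp [e₁, e₂])
        (show u ≫ lift x' y' = lift ux' uy' by simp [e₃, e₄]) (m x y hx hy) =
        m ux uy (by rw [← e₁, ← e₃, ← hx, Category.assoc])
          (by rw [← e₂, ← e₄, ← hy, Category.assoc]) := by
    subst e₁ e₂ e₃ e₄
    -- Strict stability enters only here: it says that `m` commutes with reindexing.
    have := VFunctor.map_of_eq (hre u) ⟨x⟩ ⟨y⟩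
    simp only at this
    simp only [m, IndexedMonoidalCategory.pull₁, transfer₁, Iso.app_hom, Iso.app_inv,
      Functor.map_comp, Category.assoc]
    rw [W.re_map_eqToHom_reComp u (comp_lift _ _ _) (comp_lift _ _ _) (by rw [hG, hG, ← hx, ← hy]),
      ← cancel_epi ((W.reComp u (lift x y) (lift (u ≫ x) (u ≫ y)) (comp_lift _ _ _)).inv.app A.hom),
      Iso.inv_hom_id_app_assoc, reassoc_of% this]
    simp
  have hp : 𝟙 (A.ob ⊗ A.ob) = lift (fst A.ob A.ob) (snd A.ob A.ob) := lift_fst_snd.symm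
  have hq : lift (fst A.ob A.ob ≫ F₀) (snd A.ob A.ob ≫ F₀) = F₀ ⊗ₘ F₀ := by ext <;> simp
  -- The morphism part is the action on the generic pair of projections. The outer factors identify
  -- `A.hom` with its reindexing along `lift fst snd`, and rewrite the target as a reindexing along
  -- `F₀ ⊗ₘ F₀`.
  let D : SmallFunctorData A B :=
    { ob := F₀
      mor := (W.reId (A.ob ⊗ A.ob)).inv.app A.hom ≫
        eqToHom (congrArg (fun p => (W.re p).obj A.hom) hp) ≫
        m (fst A.ob A.ob) (snd A.ob A.ob) rfl rfl ≫
          eqToHom (congrArg (fun p => (W.re p).obj B.hom) hq) }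
  have D_mapAt {I : E} (x y : I ⟶ A.ob) {x' y' : I ⟶ B.ob} (hx : x ≫ F₀ = x')
      (hy : y ≫ F₀ = y') : D.mapAt x y hx hy = m x y hx hy := by
    -- Any pair `(x, y)` is the generic pair reindexed along `lift x y`, so agreement at the generic
    -- pair spreads to all pairs.
    rw [← m_pull (lift x y) rfl rfl (lift_fst x y) (lift_snd x y) (by simp [hx]) (by simp [hy])]
    exact W.re_map_eq_pull₁ hp hq _ _ _ _ _ _
  have m_comp {I : E} (x y z : I ⟶ A.ob) {x' y' z' : I ⟶ B.ob}
      (hx : x ≫ F₀ = x') (hy : y ≫ F₀ = y') (hz : z ≫ F₀ = z') :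
      A.compAt x y z ≫ m x z hx hz = (m y z hy hz ⊗ₘ m x y hx hy) ≫ B.compAt x' y' z' := by
    -- Moves the transports across composition. Its objects are variables, so that the equalities
    -- from `hG` can be substituted.
    have aux {a b c a' b' c' : (SmallCat.ctx.{t} B I).Ob} (ha : a = a') (hb : b = b')
        (hc : c = c') {P Q : W.fib I} (f : P ⟶ B.H b.down c.down) (g : Q ⟶ B.H a.down b.down) :
        (f ⊗ₘ g) ≫ B.compAt a.down b.down c.down ≫ eqToHom (by rw [ha, hc]) =
          ((f ≫ eqToHom (by rw [hb, hc])) ⊗ₘ (g ≫ eqToHom (by rw [ha, hb]))) ≫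
            B.compAt a'.down b'.down c'.down := by
      subst ha hb hc
      simp
    have e := (G I).map_comp ⟨x⟩ ⟨y⟩ ⟨z⟩
    have := aux (a' := ⟨x'⟩) (b' := ⟨y'⟩) (c' := ⟨z'⟩) ((hG I ⟨x⟩).trans (by rw [hx]))
      ((hG I ⟨y⟩).trans (by rw [hy])) ((hG I ⟨z⟩).trans (by rw [hz]))
      ((G I).map ⟨y⟩ ⟨z⟩) ((G I).map ⟨x⟩ ⟨y⟩)
    rw [← this]
    exact (Category.assoc _ _ _).symm.trans ((congrArg (· ≫ _) e).trans (Category.assoc _ _ _))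
  have m_id {I : E} (x : I ⟶ A.ob) {x' : I ⟶ B.ob} (hx : x ≫ F₀ = x') :
      A.idAt x ≫ m x x hx hx = B.idAt x' := by
    have aux {a a' : (SmallCat.ctx.{t} B I).Ob} (ha : a = a') :
        B.idAt a.down ≫ eqToHom (by rw [ha]) = B.idAt a'.down := by
      subst ha
      simp
    exact (Category.assoc _ _ _).symm.trans ((congrArg (· ≫ _) ((G I).map_id ⟨x⟩)).trans
      (aux (a' := ⟨x'⟩) ((hG I ⟨x⟩).trans (by rw [hx]))))
  refine ⟨{ toSmallFunctorData := D, map_comp_generic := ?_, map_id_generic := ?_ }, fun X => ?_⟩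
  · rw [D_mapAt, D_mapAt, D_mapAt]
    exact m_comp _ _ _ rfl rfl rfl
  · rw [D_mapAt]
    exact m_id _ (Category.id_comp _)
  · refine VFunctor.ext' (fun x => (hG X x).symm) fun x y => ?_
    simp only [D_mapAt, m, Category.assoc, eqToHom_trans, eqToHom_refl, Category.comp_id]

end IndexedEnrichment

end

noncomputable section

namespace IndexedEnrichment

variable {E : Type u} [Category.{v} E] [CartesianMonoidalCategory E]
variable {W : IndexedMonoidalCategory.{w, w'} E}

/-! ### Indexed functors between images: injectivity, strict functors and essential surjectivity. -/

namespace SmallFunctor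

variable {A B : SmallCat W}

/-- The underlying arrow is the value at the universal object, and the actions `mapAt` at all pairs
determine the morphism part by `ext'`. -/
theorem toIndexed_injective :
    Function.Injective (fun F : SmallFunctor A B => toIndexed.{t} F) := by
  intro F G h
  have hfn : ∀ X, F.ctx X = G.ctx X := fun X =>
    congrArg (fun K : IndexedFunctor (SmallCat.toIndexed.{t} A) (SmallCat.toIndexed.{t} B) =>
      K.fn X) h
  have hob : F.ob = G.ob := by
    have := congrArg (fun K : VFunctor (SmallCat.ctx.{t} A A.ob) (SmallCat.ctx.{t} B A.ob) =>
      (K.obj ⟨𝟙 A.ob⟩).down) (hfn A.ob)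
    simpa using this
  refine ext' hob fun I x y x' y' hx hy hx' hy' => ?_
  subst hx hy
  have := VFunctor.map_of_eq (hfn I) ⟨x⟩ ⟨y⟩
  exact this.trans (G.mapAt_eqToHom x y rfl rfl _ _ _)

/-- An indexed functor commuting strictly with reindexing comes from a functor of small
`W`-categories. -/
theorem exists_toIndexed_eq
    (J : IndexedFunctor (SmallCat.toIndexed.{t} A) (SmallCat.toIndexed.{t} B))
    (hJ : ∀ {X Y : E} (f : X ⟶ Y) (y : (SmallCat.ctx.{t} A Y).Ob),
      ∃ e : (J.fn X).obj ((A.ctxRe f).obj y) = (B.ctxRe f).obj ((J.fn Y).obj y),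
        (J.reIso f).hom.app y = (SmallCat.ctx.{t} B X).ofEq e) :
    ∃ F : SmallFunctor A B, F.toIndexed = J := by
  -- The object part is the value at the universal object. Strictness along `x.down` turns the value
  -- at `x` into `x.down` followed by that arrow.
  obtain ⟨F, hF⟩ := exists_ctx_eq.{t} ((J.fn A.ob).obj ⟨𝟙 A.ob⟩).down J.fn
    (fun X x => by
      obtain ⟨e, -⟩ := hJ x.down ⟨𝟙 A.ob⟩
      refine Eq.trans ?_ e
      simp)
    (fun f => VFunctor.eq_of_nat (J.reIso f).hom (fun y => (hJ f y).1) (fun y => (hJ f y).2))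
  refine ⟨F, IndexedFunctor.ext' hF fun {X Y} f y => ?_⟩
  -- The comparisons agree too, because on both sides they are transported identities.
  obtain ⟨e, he⟩ := hJ f y
  rw [he]
  simp only [eqToIso.hom, VNat.eqToHom_app]
  exact (VCat.ofEq_vcomp_ofEq _ _ _).trans (VCat.ofEq_vcomp_ofEq _ _ _).symm

/-- Every indexed functor between indexed categories of small `W`-categories is isomorphic to
one coming from a functor of small `W`-categories. -/
theorem exists_toIndexed_iso
    (J : IndexedFunctor (SmallCat.toIndexed.{t} A) (SmallCat.toIndexed.{t} B)) :
    ∃ F : SmallFunctor A B, Nonempty (J ≅ F.toIndexed) := by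
  let F₀ : A.ob ⟶ B.ob := ((J.fn A.ob).obj ⟨𝟙 A.ob⟩).down
  let d (X : E) (x : (SmallCat.ctx.{t} A X).Ob) : (SmallCat.ctx.{t} B X).Ob := ⟨x.down ≫ F₀⟩
  have hx {X : E} (x : (SmallCat.ctx.{t} A X).Ob) : x = (A.ctxRe x.down).obj ⟨𝟙 A.ob⟩ := by simp
  -- The isomorphism $J(x)=J(x^*\mathrm{id})\cong x^*J(\mathrm{id})=F_0x$, given by the comparison
  -- of `J` along `x` at the universal object.
  let θ (X : E) (x : (SmallCat.ctx.{t} A X).Ob) :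
      𝟙_ (W.fib X) ⟶ (SmallCat.ctx.{t} B X).hom ((J.fn X).obj x) (d X x) :=
    (SmallCat.ctx.{t} B X).vcomp
      ((SmallCat.ctx.{t} B X).ofEq (congrArg (J.fn X).obj (hx x)))
      ((J.reIso x.down).hom.app ⟨𝟙 A.ob⟩)
  let θ' (X : E) (x : (SmallCat.ctx.{t} A X).Ob) :
      𝟙_ (W.fib X) ⟶ (SmallCat.ctx.{t} B X).hom (d X x) ((J.fn X).obj x) :=
    (SmallCat.ctx.{t} B X).vcomp ((J.reIso x.down).inv.app ⟨𝟙 A.ob⟩)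
      ((SmallCat.ctx.{t} B X).ofEq (congrArg (J.fn X).obj (hx x).symm))
  have h (X x) : (SmallCat.ctx.{t} B X).vcomp (θ X x) (θ' X x) =
      (SmallCat.ctx.{t} B X).id ((J.fn X).obj x) := by
    have := VNat.iso_hom_inv (J.reIso x.down) ⟨𝟙 A.ob⟩
    simp only [θ, θ', VCat.vcomp_assoc]
    rw [← VCat.vcomp_assoc _ ((J.reIso x.down).hom.app ⟨𝟙 A.ob⟩)]
    erw [this, VCat.id_vcomp, VCat.ofEq_vcomp_ofEq]
    rfl
  have h' (X x) : (SmallCat.ctx.{t} B X).vcomp (θ' X x) (θ X x) =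
      (SmallCat.ctx.{t} B X).id (d X x) := by
    have := VNat.iso_inv_hom (J.reIso x.down) ⟨𝟙 A.ob⟩
    simp only [θ, θ', VCat.vcomp_assoc]
    rw [← VCat.vcomp_assoc _ (VCat.ofEq _ _), VCat.ofEq_vcomp_ofEq]
    erw [VCat.id_vcomp]
    exact this
  -- After conjugation by `θ` the comparisons of `J` become transported identities. This is
  -- `reIso_comp` for `f` followed by `y.down`, evaluated at the universal object, where the
  -- compositors of both indexed categories are themselves transported identities.
  have key {X Y : E} (f : X ⟶ Y) (y : (SmallCat.ctx.{t} A Y).Ob) :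
      (SmallCat.ctx.{t} B X).vcomp ((J.reIso f).hom.app y)
          ((SmallCat.toIndexed.{t} B).rePt f (θ Y y)) =
        (SmallCat.ctx.{t} B X).vcomp (θ X ((A.ctxRe f).obj y))
          ((SmallCat.ctx.{t} B X).ofEq (congrArg ULift.up (Category.assoc f y.down F₀))) := by
    have hc := J.reIso_comp f y.down (f ≫ y.down) rfl ⟨𝟙 A.ob⟩
    -- `hc` involves the comparison along `f` at the reindexed universal object, while the goal has
    -- it at `y`; this equation relates the two.
    have hn := (J.reIso f).hom.app_congr (hx y)
    simp only [eqToIso.hom, VNat.eqToHom_app] at hc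
    rw [(J.fn X).ofEq_map] at hc
    simp only [θ]
    rw [IndexedCat.rePt_vcomp, IndexedCat.rePt_ofEq, VCat.vcomp_assoc]
    refine (VCat.vcomp_assoc _ _ _ _).symm.trans ((congrArg
      (fun a => (SmallCat.ctx.{t} B X).vcomp a _) hn.symm).trans ?_)
    refine Eq.trans ?_ (congrArg ((SmallCat.ctx.{t} B X).vcomp _) hc.symm)
    rw [← VCat.vcomp_assoc]
    refine (VCat.vcomp_assoc _ _ _ _).trans (congrArg
      (fun a => (SmallCat.ctx.{t} B X).vcomp a _) (VCat.ofEq_vcomp_ofEq _ _ _).symm)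
  let G (X : E) := (J.fn X).conj (d X) (θ X) (θ' X) (h X) (h' X)
  let i (X : E) : J.fn X ≅ G X := (J.fn X).conjIso (d X) (θ X) (θ' X) (h X) (h' X)
  -- The transported family commutes strictly with reindexing: its comparison is that of `J`
  -- conjugated by `i`, and by `key` and `h'` the components of this conjugate are transported
  -- identities, so `eq_of_nat` applies.
  obtain ⟨F, hF⟩ := exists_ctx_eq.{t} F₀ G (fun _ _ => rfl) (fun {X Y} f =>
    VFunctor.eq_of_nat (VNat.vcomp (VNat.whiskerLeft (A.ctxRe f) (i X).inv)
      (VNat.vcomp (J.reIso f).hom (VNat.whiskerRight ((i Y).hom.bc (W.re f)) (B.ctxRe f))))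
      (fun y => congrArg ULift.up (Category.assoc f y.down F₀)) (fun y => by
        refine (congrArg ((SmallCat.ctx.{t} B X).vcomp (θ' X ((A.ctxRe f).obj y)))
          (key f y)).trans ?_
        rw [← VCat.vcomp_assoc, h']
        exact VCat.id_vcomp _ _))
  have hF' (X) : VFunctor.obj (F.ctx X) = d X := congrArg VFunctor.obj (hF X)
  -- The comparison of `J` with its transport, followed by the identification of the transport with
  -- `F.ctx X`.
  let α (X : E) : VNat (J.fn X) (F.ctx X) :=
    VNat.vcomp (i X).hom (eqToHom (hF X).symm : G X ⟶ F.ctx X)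
  let β (X : E) : VNat (F.ctx X) (J.fn X) :=
    VNat.vcomp (eqToHom (hF X) : F.ctx X ⟶ G X) (i X).inv
  have hαβ (X x) : (SmallCat.ctx.{t} B X).vcomp ((α X).app x) ((β X).app x) =
      (SmallCat.ctx.{t} B X).id _ := by
    have : (show J.fn X ⟶ F.ctx X from α X) ≫
        (show F.ctx X ⟶ J.fn X from β X) = 𝟙 _ := by
      change ((i X).hom ≫ eqToHom _) ≫ (eqToHom _ ≫ (i X).inv) = _
      simp
    exact congrArg (fun γ : J.fn X ⟶ J.fn X => VNat.app γ x) this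
  have hβα (X x) : (SmallCat.ctx.{t} B X).vcomp ((β X).app x) ((α X).app x) =
      (SmallCat.ctx.{t} B X).id _ := by
    have : (show F.ctx X ⟶ J.fn X from β X) ≫
        (show J.fn X ⟶ F.ctx X from α X) = 𝟙 _ := by
      change (eqToHom _ ≫ (i X).inv) ≫ ((i X).hom ≫ eqToHom _) = _
      simp
    exact congrArg (fun γ : F.ctx X ⟶ F.ctx X => VNat.app γ x) this
  have hα (X x) : (α X).app x =
      (SmallCat.ctx.{t} B X).vcomp (θ X x)
      ((SmallCat.ctx.{t} B X).ofEq (congrFun (hF' X) x).symm) :=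
    congrArg ((SmallCat.ctx.{t} B X).vcomp (θ X x)) (VNat.eqToHom_app _ _)
  refine ⟨F, ⟨IndexedFunctor.isoMk { app := α, naturality := fun {X Y} f y => ?_ } β hαβ hβα⟩⟩
  simp only [eqToIso.hom, VNat.eqToHom_app, hα]
  rw [IndexedCat.rePt_vcomp, IndexedCat.rePt_ofEq]
  -- By `key`, both sides are `θ` at the reindexed object followed by transported identities with
  -- the same endpoints.
  refine (VCat.vcomp_assoc _ _ _ _).symm.trans ((congrArg
    (fun a => (SmallCat.ctx.{t} B X).vcomp a _) (key f y)).trans ?_)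
  refine (VCat.vcomp_assoc _ _ _ _).trans (Eq.trans ?_ (VCat.vcomp_assoc _ _ _ _).symm)
  exact congrArg ((SmallCat.ctx.{t} B X).vcomp _)
    ((VCat.ofEq_vcomp_ofEq _ _ _).trans (VCat.ofEq_vcomp_ofEq _ _ _).symm)

/-! ### Transformations between images: $\Phi$ is bijective on 2-cells. -/

/-- `eqEl` is defined in the category of generalized objects at universe level zero; this carries it
to level `t`. -/
theorem _root_.IndexedEnrichment.SmallCat.eqEl_eq_ofEq (B : SmallCat W) {I : E} {p q : I ⟶ B.ob} (h : p = q) :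
    B.eqEl h = (SmallCat.ctx.{t} B I).ofEq (x := ⟨p⟩) (y := ⟨q⟩) (congrArg _ h) := by
  subst h
  rfl

/-- Every component of `γ` is the reindexing of the component at the universal object, so that
component defines the small transformation. -/
theorem exists_toIndexed_map₂_eq {F G : SmallFunctor A B}
    (γ : IndexedNat (toIndexed.{t} F) (toIndexed.{t} G)) :
    ∃ α : SmallNat F G, SmallNat.toIndexed.{t} α = γ := by
  -- The component at the universal object runs from `𝟙 A.ob ≫ F.ob` to `𝟙 A.ob ≫ G.ob`; the outer
  -- factors remove the identities.
  let g : 𝟙_ (W.fib A.ob) ⟶ B.H F.ob G.ob :=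
    B.vc (B.eqEl (Category.id_comp F.ob).symm)
      (B.vc ((γ.app A.ob).app ⟨𝟙 A.ob⟩) (B.eqEl (Category.id_comp G.ob)))
  have hg (X : E) (x : (SmallCat.ctx.{t} A X).Ob) :
      (γ.app X).app x = B.elAt g x.down rfl rfl := by
    have hn := γ.naturality x.down ⟨𝟙 A.ob⟩
    simp only [eqToIso.hom, VNat.eqToHom_app] at hn
    have hc := (γ.app X).app_congr (show (A.ctxRe x.down).obj ⟨𝟙 A.ob⟩ = x by simp)
    -- Reindexing in the fibres of the image of `B` is `elAt`, since its action on hom-objects is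
    -- the inverse compositor.
    have hr : (SmallCat.toIndexed.{t} B).rePt x.down ((γ.app A.ob).app ⟨𝟙 A.ob⟩) =
        B.elAt ((γ.app A.ob).app ⟨𝟙 A.ob⟩) x.down rfl rfl := by
      simp only [IndexedCat.rePt, VCat.bcPt, SmallCat.elAt, IndexedMonoidalCategory.pull₀,
        transfer₀, Iso.app_inv, Category.assoc]
    rw [hr] at hn
    have hg : B.elAt g x.down rfl rfl = (SmallCat.ctx.{t} B X).vcomp ((SmallCat.ctx.{t} B X).ofEq
        (by simp)) ((SmallCat.ctx.{t} B X).vcomp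
          (B.elAt ((γ.app A.ob).app ⟨𝟙 A.ob⟩) x.down rfl rfl)
          ((SmallCat.ctx.{t} B X).ofEq (y := ⟨x.down ≫ G.ob⟩) (by simp))) := by
      simp only [g]
      rw [B.elAt_vc _ _ x.down rfl rfl rfl, B.elAt_vc _ _ x.down rfl rfl rfl, B.elAt_eqEl,
        B.elAt_eqEl,
        SmallCat.eqEl_eq_ofEq.{t}, SmallCat.eqEl_eq_ofEq.{t}]
      rfl
    -- `hc'` passes from `x` to the reindexed universal object, and `hn'` from there to the
    -- reindexed component. The transports around it then merge.
    have hc' := VCat.eq_conj_of_vcomp_ofEq _ _ hc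
    have hn' := VCat.eq_conj_of_vcomp_ofEq' _ _ hn
    rw [hg]
    refine hc'.trans ((congrArg (fun a => (SmallCat.ctx.{t} B X).vcomp _
      ((SmallCat.ctx.{t} B X).vcomp a _)) hn').trans ?_)
    rw [VCat.vcomp_assoc, VCat.vcomp_assoc]
    refine (congrArg (fun a => (SmallCat.ctx.{t} B X).vcomp _ ((SmallCat.ctx.{t} B X).vcomp _
      ((SmallCat.ctx.{t} B X).vcomp _ a))) (VCat.ofEq_vcomp_ofEq _ _ _)).trans ?_
    refine (VCat.vcomp_assoc _ _ _ _).symm.trans ?_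
    exact congrArg (fun a => (SmallCat.ctx.{t} B X).vcomp a _) (VCat.ofEq_vcomp_ofEq _ _ _)
  refine ⟨⟨g, ?_⟩, IndexedNat.ext' fun X x => (hg X x).symm⟩
  -- The naturality condition of a small transformation is that of `γ` over the square of `A.ob`, at
  -- the generic pair.
  have := (γ.app (A.ob ⊗ A.ob)).naturality ⟨fst A.ob A.ob⟩ ⟨snd A.ob A.ob⟩
  rw [hg, hg] at this
  exact this

/-- Reindexing along an identity does nothing, so the component at the universal object recovers
`hom` up to transported identities. -/
theorem toIndexed_map₂_injective (F G : SmallFunctor A B) :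
    Function.Injective (fun α : SmallNat F G => SmallNat.toIndexed.{t} α) := by
  intro α β h
  have := congrArg (fun γ : IndexedNat (toIndexed.{t} F) (toIndexed.{t} G) =>
    (γ.app A.ob).app ⟨𝟙 A.ob⟩) h
  simp only at this
  apply SmallNat.ext
  rw [← B.elAt_id α.hom (Category.id_comp _) (Category.id_comp _),
    ← B.elAt_id β.hom (Category.id_comp _) (Category.id_comp _),
    B.elAt_cast α.hom (𝟙 A.ob) _ _ rfl rfl (Category.id_comp _).symm (Category.id_comp _),
    B.elAt_cast β.hom (𝟙 A.ob) _ _ rfl rfl (Category.id_comp _).symm (Category.id_comp _), this]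


end SmallFunctor

/-! ### Equivalence of hom-categories, and small categories with equal images. -/

instance (W : IndexedMonoidalCategory.{w, w'} E) (A B : SmallCat W) :
    ((SmallCat.inclusionPseudofunctor.{t} W).toPrelaxFunctor.mapFunctor A B).IsEquivalence where
  faithful := ⟨fun {F G} _ _ h => SmallFunctor.toIndexed_map₂_injective F G h⟩
  full := ⟨fun {F G} γ => SmallFunctor.exists_toIndexed_map₂_eq (F := F) (G := G) γ⟩
  essSurj := ⟨fun J => by
    obtain ⟨F, ⟨i⟩⟩ := SmallFunctor.exists_toIndexed_iso (A := A) (B := B) J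
    exact ⟨F, ⟨i.symm⟩⟩⟩

/-- The functors `eqToHom h` and `eqToHom h.symm` commute strictly with reindexing, so they lift
exactly and not just up to isomorphism. Their composites are identities, and injectivity on functors
reflects these equations to `A` and `B`. -/
theorem SmallCat.exists_iso_of_toIndexed_eq {A B : SmallCat W}
    (h : SmallCat.toIndexed.{t} A = SmallCat.toIndexed.{t} B) :
    ∃ (F : A ⟶ B) (G : B ⟶ A), F ≫ G = 𝟙 A ∧ G ≫ F = 𝟙 B := by
  obtain ⟨F, hF⟩ := SmallFunctor.exists_toIndexed_eq _ fun f y =>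
    IndexedFunctor.eqToHom_obj h f y
  obtain ⟨G, hG⟩ := SmallFunctor.exists_toIndexed_eq _ fun f y =>
    IndexedFunctor.eqToHom_obj h.symm f y
  refine ⟨F, G, SmallFunctor.toIndexed_injective.{t} ?_, SmallFunctor.toIndexed_injective.{t} ?_⟩
  · refine (SmallFunctor.toIndexed_comp F G).trans (Eq.trans ?_ (SmallFunctor.toIndexed_id A).symm)
    rw [hF, hG]
    exact (eqToHom_trans h h.symm)
  · refine (SmallFunctor.toIndexed_comp G F).trans (Eq.trans ?_ (SmallFunctor.toIndexed_id B).symm)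
    rw [hF, hG]
    exact (eqToHom_trans h.symm h)

end IndexedEnrichment

end

/-- Only here is `W` specialized to the externalization of `V`. The first clause holds by `rfl`,
because the strict 2-functor was built by adding laws to `SmallCat.inclusion`. -/
theorem mainTheorem5 {E : Type u} [Category.{v} E] [CartesianMonoidalCategory E]
    [Limits.HasFiniteLimits E] (V : IndexedEnrichment.InternalMonoidalCategory E) :
    ∃ Φ : StrictPseudofunctor (IndexedEnrichment.SmallCat V.externalization)
        (IndexedEnrichment.IndexedCat.{max t v} V.externalization),
      Φ.toPrelaxFunctor.toPrelaxFunctorStruct =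
          IndexedEnrichment.SmallCat.inclusion.{t} V.externalization ∧
        (∀ A B : IndexedEnrichment.SmallCat V.externalization,
          (Φ.toPrelaxFunctor.mapFunctor A B).IsEquivalence) ∧
        (∀ A B : IndexedEnrichment.SmallCat V.externalization,
          Function.Injective (fun F : A ⟶ B => Φ.map F)) ∧
        (∀ A B : IndexedEnrichment.SmallCat V.externalization, Φ.obj A = Φ.obj B →
          ∃ (F : A ⟶ B) (G : B ⟶ A), F ≫ G = 𝟙 A ∧ G ≫ F = 𝟙 B) :=
  ⟨IndexedEnrichment.SmallCat.inclusionPseudofunctor.{t} V.externalization, rfl,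
    fun A B => inferInstance, fun _ _ => IndexedEnrichment.SmallFunctor.toIndexed_injective.{t},
    fun _ _ h => IndexedEnrichment.SmallCat.exists_iso_of_toIndexed_eq.{t} h⟩
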